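/- **Setting.** Let $d\ge 1$. Let $\mathcal L$ be the Lévy operator with triplet $(B,A,\nu)$, where $B\in\mathbb R^d$, $A\in\mathbb R^{d\times d}$ is symmetric positive semi-definite and $\nu\ge 0$ is a Borel measure with $\int (1\wedge|z|^2)\,\nu(dz)<\infty$: $$\mathcal L u(x)=B\cdot Du(x)+\operatorname{div}(A\,Du(x))+\int_{\mathbb R^d}\big(u(x+z)-u(x)-Du(x)\cdot z\,\mathbf 1_{B(0,1)}(z)\big)\,\nu(dz).$$ Its adjoint $\mathcal L^*$ is the Lévy operator with triplet $(-B,A,\nu(-\,\cdot))$. The symbol of $\mathcal L$ is $\Psi(\xi)=-iB\cdot\xi+\xi\cdot A\xi+\int(1-e^{i\xi\cdot z}+i\xi\cdot z\mathbf 1_{B(0,1)}(z))\,\nu(dz)$, and a heat kernel of $\mathcal L$ is a family of probability densities $K(t,\cdot)$, $t>0$, with $\int K(t,x)e^{-i\xi\cdot x}\,dx=e^{-t\Psi(\xi)}$. For $r=k+\sigma$ with $k\in\{0,1,\dots\}$ and $\sigma\in[0,1)$, $C^r_b(\mathbb R^d)$ is the space of $C^k$ functions with finite norm $\|u\|_{C^r_b}=\sum_{j\le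 k}\sup_x|D^ju(x)|$, plus the $\sigma$-Hölder seminorm of $D^ku$ if $\sigma>0$. $C^{-r}_b(\mathbb R^d)$ is the dual space of $C^r_b(\mathbb R^d)$ with the dual norm. $\mathcal M$ is the space of finite signed Borel measures on $\mathbb R^d$, with total variation norm $\|\cdot\|_{TV}$ and bounded-Lipschitz metric $d_0(\mu,\mu')=\sup\{|\int\varphi\,d(\mu-\mu')|:\ \|\varphi\|_\infty\le1,\ \operatorname{Lip}(\varphi)\le 1\}$. A functional $\rho\in C^{-n}_b$ is *measure representable* if there are $\mu_\beta\in\mathcal M$, $|\beta|\le n$, with $\langle\rho,u\rangle=\sum_{|\beta|\le n}\int\partial^\beta u\,d\mu_\beta$ for all $u\in C^n_b$. **Assumptions.** Let $T>0$, $\alpha\in(1,2]$, $n\in\{2,3,\dots\}$. Assume that $\mathcal L$ and $\mathcal L^*$ have smooth heat kernels $K$ and $K^*$ and that for every $m\in\{0,1,\dots\}$ there is $\mathcal K_m$ with $$\|D^m\tilde K(t,\cdot)\|_{L^1(\mathbb R^d)}\le \mathcal K_m\,t^{-m/\alpha},\qquad 0<t\le T,\ \tilde K\in\{K,K^*\}.$$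 Let $V_1\in (C([0,T],C^n_b(\mathbb R^d)))^d$. **Conclusion.** For every $\gamma\in(0,\alpha)$ there is a constant $C(\gamma)$, depending only on $\gamma$, $V_1$ and the fixed data $d,n,T,\alpha,\mathcal L$, such that the following holds for every $V_2:[0,T]\to\mathcal M^d$ that is continuous with respect to $d_0$ and bounded in total variation, and every $\rho_0\in C^{-n}_b(\mathbb R^d)$. The problem $$\partial_t\rho-\mathcal L\rho-\operatorname{div}(\rho V_1)-\operatorname{div}V_2=0\ \text{ on }(0,T)\times\mathbb R^d,\qquad \rho(0)=\rho_0,$$ has a distributional solution $\rho$, with $\rho(t)\in C^{-n}_b$ for all $t\in[0,T]$ and, for $t\in(0,T]$, with extensions of $\rho(t)$ to elements of $C^{\gamma-n}_b$ for all $\gamma\in(0,\alpha)$ that agree with each other and with $\rho(t)$ on common functions (and are also denoted $\rho(t)$), such that: 1. $\rho$ is bounded from $[0,T]$ to $C^{-n}_b$, and $\rho\in C((0,T],C^{\gamma-n}_b)$ for every $\gamma\in(0,\alpha)$; 2. for every $\gamma\in(0,\alpha)$, $$\sup_{t\in(0,T]}t^{\gamma/\alpha}\|\rho(t)\|_{C^{\gamma-n}_b}\le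 C(\gamma)\Big(\sup_{t\in[0,T]}\|V_2(t)\|_{TV}+\|\rho_0\|_{C^{-n}_b}\Big);$$ 3. if $\rho_0$ is measure representable, then $\rho(t)$ is measure representable (as an element of $C^{-n}_b$) for every $t\in[0,T]$. Here "distributional solution" means that $\rho(0)=\rho_0$ and that, for every $\varphi\in C([0,T],C^n_b)$ such that $D^n\varphi$ is uniformly continuous on $[0,T]\times\mathbb R^d$, $\partial_t\varphi\in C_b((0,T),C_b)$, and $\partial_t\varphi+\mathcal L^*\varphi$ is bounded from $(0,T)$ to $C^{n-1}_b$, and for every $t\in[0,T]$, $$\langle\rho(t),\varphi(t)\rangle-\langle\rho_0,\varphi(0)\rangle=\int_0^t\langle\rho(s),(\partial_t\varphi+\mathcal L^*\varphi-V_1\cdot D\varphi)(s)\rangle\,ds-\int_0^t\int_{\mathbb R^d}D\varphi(s,y)\cdot V_2(s,dy)\,ds,$$ where both integrands on the right are integrable in $s$ and, for $s>0$, $\rho(s)$ is used in the first one as an element of $C^{-(n-1)}_b$ (the case $\gamma=1$). -/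

import Mathlib

open MeasureTheory Set Filter
open scoped ENNReal NNReal Topology ContDiff

noncomputable section

namespace LevyFP

/-- The Euclidean space `ℝ^d`. -/
abbrev E (d : ℕ) := EuclideanSpace ℝ (Fin d)

/-- The partial derivative `∂_i u` of a function on `ℝ^d`. -/
def pd {d : ℕ} (i : Fin d) (u : E d → ℝ) (x : E d) : ℝ :=
  fderiv ℝ u x (EuclideanSpace.single i 1)

/-! ### Hölder spaces `C^r_b(ℝ^d)`, `r ≥ 0`, and their duals -/

/-- The (extended) norm of `C^r_b(ℝ^d)`: with `r = k + σ`, `k` the integer part of `r`,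
the sum of `sup_x |D^j u(x)|` over `j ≤ k`, plus, when `σ > 0`, the `σ`-Hölder seminorm of `D^k u`.
-/
def eNormHolder {d : ℕ} (r : ℝ) (u : E d → ℝ) : ℝ≥0∞ :=
  (∑ j ∈ Finset.range (⌊r⌋₊ + 1), ⨆ x, ‖iteratedFDeriv ℝ j u x‖ₑ) +
    if r = ⌊r⌋₊ then 0
    else eHolderNorm (Real.toNNReal (r - ⌊r⌋₊)) (iteratedFDeriv ℝ ⌊r⌋₊ u)

lemma eNormHolder_zero {d : ℕ} (r : ℝ) : eNormHolder r (0 : E d → ℝ) = 0 := by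
  have h : ∀ j, iteratedFDeriv ℝ j (0 : E d → ℝ) = 0 := fun j => iteratedFDeriv_fun_zero
  simp [eNormHolder, h]

lemma eNormHolder_add {d : ℕ} (r : ℝ) {u v : E d → ℝ} (hu : ContDiff ℝ ⌊r⌋₊ u)
    (hv : ContDiff ℝ ⌊r⌋₊ v) : eNormHolder r (u + v) ≤ eNormHolder r u + eNormHolder r v := by
  have key : ∀ j ≤ ⌊r⌋₊, iteratedFDeriv ℝ j (u + v) =
      iteratedFDeriv ℝ j u + iteratedFDeriv ℝ j v := by
    intro j hj
    have hj' : (j : ℕ∞ω) ≤ (⌊r⌋₊ : ℕ∞ω) := by exact_mod_cast hj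
    ext1 x
    exact iteratedFDeriv_add_apply (hu.of_le hj').contDiffAt (hv.of_le hj').contDiffAt
  unfold eNormHolder
  rw [add_add_add_comm, ← Finset.sum_add_distrib]
  refine add_le_add (Finset.sum_le_sum fun j hj => ?_) ?_
  · rw [key j (Nat.lt_succ_iff.1 (Finset.mem_range.1 hj))]
    refine iSup_le fun x => (enorm_add_le _ _).trans (add_le_add ?_ ?_)
    · exact le_iSup (fun x => ‖iteratedFDeriv ℝ j u x‖ₑ) x
    · exact le_iSup (fun x => ‖iteratedFDeriv ℝ j v x‖ₑ) x
  · split_ifs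
    · simp
    · rw [key _ le_rfl]
      exact eHolderNorm_add_le

lemma eNormHolder_smul {d : ℕ} (r c : ℝ) {u : E d → ℝ} (hu : ContDiff ℝ ⌊r⌋₊ u) :
    eNormHolder r (c • u) = ‖c‖ₑ * eNormHolder r u := by
  have key : ∀ j ≤ ⌊r⌋₊, iteratedFDeriv ℝ j (c • u) = c • iteratedFDeriv ℝ j u := by
    intro j hj
    have hj' : (j : ℕ∞ω) ≤ (⌊r⌋₊ : ℕ∞ω) := by exact_mod_cast hj
    ext1 x
    exact iteratedFDeriv_const_smul_apply (hu.of_le hj').contDiffAt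
  unfold eNormHolder
  rw [mul_add, Finset.mul_sum]
  congr 1
  · refine Finset.sum_congr rfl fun j hj => ?_
    rw [key j (Nat.lt_succ_iff.1 (Finset.mem_range.1 hj)), ENNReal.mul_iSup]
    exact iSup_congr fun x => by simp [enorm_smul]
  · split_ifs
    · simp
    · rw [key _ le_rfl, eHolderNorm_smul, enorm_eq_nnnorm]

lemma enorm_le_eNormHolder {d : ℕ} (r : ℝ) (u : E d → ℝ) (x : E d) :
    ‖u x‖ₑ ≤ eNormHolder r u := by
  have h0 : ‖u x‖ₑ = ‖iteratedFDeriv ℝ 0 u x‖ₑ := by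
    rw [← ofReal_norm, ← ofReal_norm, norm_iteratedFDeriv_zero]
  rw [h0]
  refine (le_iSup (fun x => ‖iteratedFDeriv ℝ 0 u x‖ₑ) x).trans ?_
  refine le_add_right ?_
  exact Finset.single_le_sum (f := fun j => ⨆ x, ‖iteratedFDeriv ℝ j u x‖ₑ)
    (fun _ _ => zero_le) (Finset.mem_range.2 (Nat.succ_pos _))

/-- The functions of class `C^r_b(ℝ^d)`, as a subspace of all functions. -/
def holderSubmodule (d : ℕ) (r : ℝ) : Submodule ℝ (E d → ℝ) where
  carrier := {u | ContDiff ℝ ⌊r⌋₊ u ∧ eNormHolder r u < ⊤}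
  add_mem' := fun hu hv => ⟨hu.1.add hv.1,
    (eNormHolder_add r hu.1 hv.1).trans_lt (ENNReal.add_lt_top.2 ⟨hu.2, hv.2⟩)⟩
  zero_mem' := ⟨contDiff_const, by rw [eNormHolder_zero]; exact ENNReal.zero_lt_top⟩
  smul_mem' := fun c u hu => ⟨hu.1.const_smul c, by
    rw [eNormHolder_smul r c hu.1]; exact ENNReal.mul_lt_top enorm_lt_top hu.2⟩

/-- The Hölder space `C^r_b(ℝ^d)`, `r ≥ 0`, as a normed space. -/
def HolderSpace (d : ℕ) (r : ℝ) : Type := holderSubmodule d r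

namespace HolderSpace

variable {d : ℕ} {r : ℝ}

instance : AddCommGroup (HolderSpace d r) := inferInstanceAs (AddCommGroup (holderSubmodule d r))

instance : Module ℝ (HolderSpace d r) := inferInstanceAs (Module ℝ (holderSubmodule d r))

instance : CoeFun (HolderSpace d r) (fun _ => E d → ℝ) := ⟨fun u => u.1⟩

instance : Norm (HolderSpace d r) := ⟨fun u => (eNormHolder r u.1).toReal⟩

lemma norm_def (u : HolderSpace d r) : ‖u‖ = (eNormHolder r (u : E d → ℝ)).toReal := rfl

lemma normedSpaceCore : NormedSpace.Core ℝ (HolderSpace d r) where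
  norm_nonneg _ := ENNReal.toReal_nonneg
  norm_smul c u := by
    change (eNormHolder r (c • u.1)).toReal = ‖c‖ * (eNormHolder r u.1).toReal
    rw [eNormHolder_smul r c u.2.1, ENNReal.toReal_mul, toReal_enorm]
  norm_triangle u v := by
    change (eNormHolder r (u.1 + v.1)).toReal ≤
      (eNormHolder r u.1).toReal + (eNormHolder r v.1).toReal
    rw [← ENNReal.toReal_add u.2.2.ne v.2.2.ne]
    exact ENNReal.toReal_mono (ENNReal.add_lt_top.2 ⟨u.2.2, v.2.2⟩).ne
      (eNormHolder_add r u.2.1 v.2.1)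
  norm_eq_zero_iff u := by
    constructor
    · intro h
      have h' : eNormHolder r u.1 = 0 :=
        ((ENNReal.toReal_eq_zero_iff _).1 h).resolve_right u.2.2.ne
      refine Subtype.ext (funext fun x => ?_)
      have hx := enorm_le_eNormHolder r u.1 x
      rw [h', nonpos_iff_eq_zero, enorm_eq_zero] at hx
      exact hx
    · rintro rfl
      change (eNormHolder r (0 : E d → ℝ)).toReal = 0
      rw [eNormHolder_zero, ENNReal.toReal_zero]

instance : NormedAddCommGroup (HolderSpace d r) := NormedAddCommGroup.ofCore normedSpaceCore

instance : NormedSpace ℝ (HolderSpace d r) := NormedSpace.ofCore normedSpaceCore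

end HolderSpace

/-- The negative order Hölder space `C^{-r}_b(ℝ^d)`: the dual of `C^r_b(ℝ^d)`, with the dual norm.
-/
abbrev NegHolder (d : ℕ) (r : ℝ) := StrongDual ℝ (HolderSpace d r)

lemma mem_holderSubmodule_of_nat {d k : ℕ} {r : ℝ} (hr : r = k) {u : E d → ℝ} :
    u ∈ holderSubmodule d r ↔
      ContDiff ℝ k u ∧ ∀ j ≤ k, ∃ C : ℝ, ∀ x, ‖iteratedFDeriv ℝ j u x‖ ≤ C := by
  subst hr
  have hfl : ⌊(k : ℝ)⌋₊ = k := Nat.floor_natCast k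
  change (ContDiff ℝ ⌊(k : ℝ)⌋₊ u ∧ eNormHolder (k : ℝ) u < ⊤) ↔ _
  unfold eNormHolder
  rw [hfl, if_pos rfl, add_zero, ENNReal.sum_lt_top]
  refine and_congr_right fun _ => ⟨fun h j hj => ?_, fun h j hj => ?_⟩
  · have hj' := h j (Finset.mem_range.2 (Nat.lt_succ_of_le hj))
    refine ⟨(⨆ x, ‖iteratedFDeriv ℝ j u x‖ₑ).toReal, fun x => ?_⟩
    rw [← toReal_enorm]
    exact ENNReal.toReal_mono hj'.ne (le_iSup (fun x => ‖iteratedFDeriv ℝ j u x‖ₑ) x)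
  · obtain ⟨C, hC⟩ := h j (Nat.le_of_lt_succ (Finset.mem_range.1 hj))
    refine lt_of_le_of_lt (iSup_le fun x => ?_) (ENNReal.ofReal_lt_top (r := C))
    rw [← ofReal_norm]
    exact ENNReal.ofReal_le_ofReal (hC x)

lemma transport_mem {d n : ℕ} (hn : 1 ≤ n) (b : Fin d → HolderSpace d n) (u : HolderSpace d n) :
    (fun x => ∑ i, b i x * pd i u x) ∈ holderSubmodule d ((n : ℝ) - 1) := by
  obtain ⟨k, rfl⟩ : ∃ k, n = k + 1 := ⟨n - 1, by omega⟩
  have hk : ((k + 1 : ℕ) : ℝ) - 1 = (k : ℝ) := by push_cast; ring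
  have hle : (k : ℕ∞ω) ≤ ((k + 1 : ℕ) : ℕ∞ω) := by exact_mod_cast Nat.le_succ k
  obtain ⟨hu, hub⟩ := (mem_holderSubmodule_of_nat (k := k + 1) rfl).1 u.2
  have hfd : ContDiff ℝ k (fderiv ℝ u.1) := hu.fderiv_right (by push_cast; exact le_rfl)
  have hterm : ∀ i, (fun x => b i x * pd i u x) ∈ holderSubmodule d ((k + 1 : ℕ) - 1 : ℝ) := by
    intro i
    obtain ⟨hb, hbb⟩ := (mem_holderSubmodule_of_nat (k := k + 1) rfl).1 (b i).2
    have hb' : ContDiff ℝ k (b i).1 := hb.of_le hle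
    have hp : ContDiff ℝ k (pd i u.1) := hfd.clm_apply contDiff_const
    refine (mem_holderSubmodule_of_nat hk).2 ⟨hb'.mul hp, fun j hj => ?_⟩
    have hpb : ∀ l ≤ j, ∃ C : ℝ, ∀ x, ‖iteratedFDeriv ℝ l (pd i u.1) x‖ ≤ C := by
      intro l hl
      obtain ⟨C, hC⟩ := hub (l + 1) (by omega)
      refine ⟨‖(EuclideanSpace.single i 1 : E d)‖ * C, fun x => ?_⟩
      refine (norm_iteratedFDeriv_clm_apply_const (c := (EuclideanSpace.single i 1 : E d))
        (f := fderiv ℝ u.1) (N := k) (n := l) hfd.contDiffAt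
        (by exact_mod_cast hl.trans hj)).trans ?_
      rw [norm_iteratedFDeriv_fderiv]
      exact mul_le_mul_of_nonneg_left (hC x) (norm_nonneg _)
    have hbb' : ∀ l ≤ j, ∃ C : ℝ, ∀ x, ‖iteratedFDeriv ℝ l (b i).1 x‖ ≤ C :=
      fun l hl => hbb l (by omega)
    choose! P hP using hpb
    choose! Q hQ using hbb'
    refine ⟨∑ l ∈ Finset.range (j + 1), (j.choose l : ℝ) * Q l * P (j - l), fun x => ?_⟩
    refine (norm_iteratedFDeriv_mul_le hb' hp x (by exact_mod_cast hj)).trans ?_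
    refine Finset.sum_le_sum fun l hl => ?_
    have hl' : l ≤ j := Nat.le_of_lt_succ (Finset.mem_range.1 hl)
    have h1 := hQ l hl' x
    have h2 := hP (j - l) (Nat.sub_le _ _) x
    have h3 : 0 ≤ Q l := (norm_nonneg _).trans h1
    gcongr
  have hsum := Submodule.sum_mem (holderSubmodule d ((k + 1 : ℕ) - 1 : ℝ))
    (t := Finset.univ) (fun i _ => hterm i)
  convert hsum using 1
  ext x
  simp [Finset.sum_apply]

/-- The transport term `b · Du`, an element of `C^{n-1}_b(ℝ^d)` for `b_1, …, b_d, u ∈ C^n_b(ℝ^d)`.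
-/
def transport {d n : ℕ} (hn : 1 ≤ n) (b : Fin d → HolderSpace d n) (u : HolderSpace d n) :
    HolderSpace d ((n : ℝ) - 1) :=
  ⟨fun x => ∑ i, b i x * pd i u x, transport_mem hn b u⟩

/-! ### Signed measures -/

/-- The total variation norm of an `ℝ^d`-valued measure given by its components. -/
def tvNorm {d : ℕ} (μ : Fin d → SignedMeasure (E d)) : ℝ :=
  ∑ i, ((μ i).totalVariation univ).toReal

/-- The bounded-Lipschitz (Kantorovich–Rubinstein) distance of finite signed measures. -/
def bLipDist {d : ℕ} (μ ν : SignedMeasure (E d)) : ℝ :=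
  ⨆ φ : {φ : E d → ℝ // (∀ x, |φ x| ≤ 1) ∧ LipschitzWith 1 φ},
    |∫ᵛ x, φ.1 x ∂•(μ - ν)|

/-- `ρ ∈ C^{-n}_b(ℝ^d)` is measure representable: `ρ` is a sum of finite signed measures tested with
the partial derivatives of order at most `n`. For `I : Fin k → Fin d`, the number
`iteratedFDeriv ℝ k u x (fun j => e_{I j})` is `∂_{I 0} ⋯ ∂_{I (k-1)} u(x)`; tuples with the same
entries up to order give the same derivative `∂^β u`, so that this is a sum over multi-indices. -/
def MeasureRepresentable {d n : ℕ} (ρ : NegHolder d n) : Prop :=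
  ∃ μ : ∀ k : ℕ, (Fin k → Fin d) → SignedMeasure (E d), ∀ u : HolderSpace d n,
    ρ u = ∑ k ∈ Finset.range (n + 1), ∑ I : Fin k → Fin d,
      ∫ᵛ x, iteratedFDeriv ℝ k (u : E d → ℝ) x (fun j => EuclideanSpace.single (I j) 1) ∂•(μ k I)

/-! ### Lévy operators and their heat kernels -/

/-- A Lévy triplet `(B, A, ν)` on `ℝ^d`. -/
structure LevyTriplet (d : ℕ) where
  B : E d
  A : Matrix (Fin d) (Fin d) ℝ
  ν : Measure (E d)
  posSemidef : A.PosSemidef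
  lintegral_lt_top : ∫⁻ z, ENNReal.ofReal (min 1 (‖z‖ ^ 2)) ∂ν < ⊤

namespace LevyTriplet

variable {d : ℕ}

/-- The Lévy operator
`𝓛u(x) = B·Du(x) + div(A Du(x)) + ∫ (u(x+z) - u(x) - Du(x)·z 1_{B(0,1)}(z)) ν(dz)`. -/
def op (L : LevyTriplet d) (u : E d → ℝ) (x : E d) : ℝ :=
  fderiv ℝ u x L.B + (∑ i, pd i (fun y => ∑ j, L.A i j * pd j u y) x) +
    ∫ z, (u (x + z) - u x - (Metric.ball 0 1).indicator (fun z => fderiv ℝ u x z) z) ∂L.ν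

/-- The triplet `(-B, A, ν(-·))` of the adjoint operator `𝓛*`. -/
def adjoint (L : LevyTriplet d) : LevyTriplet d where
  B := -L.B
  A := L.A
  ν := L.ν.map (fun z => -z)
  posSemidef := L.posSemidef
  lintegral_lt_top := by
    rw [lintegral_map (by fun_prop) measurable_neg]
    simpa using L.lintegral_lt_top

/-- The symbol `Ψ(ξ) = -iB·ξ + ξ·Aξ + ∫ (1 - e^{iξ·z} + iξ·z 1_{B(0,1)}(z)) ν(dz)` of `𝓛`. -/
def symbol (L : LevyTriplet d) (ξ : E d) : ℂ :=
  -Complex.I * (inner ℝ L.B ξ : ℝ) + ((∑ i, ∑ j, ξ i * L.A i j * ξ j : ℝ) : ℂ) +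
    ∫ z, (1 - Complex.exp (Complex.I * (inner ℝ ξ z : ℝ)) +
      (Metric.ball (0 : E d) 1).indicator (fun z => Complex.I * (inner ℝ ξ z : ℝ)) z) ∂L.ν

/-- `K` is the heat kernel of `𝓛`, with smooth densities: for `t > 0`, `K t` is a smooth probability
density whose Fourier transform is `e^{-tΨ}`. -/
def IsSmoothHeatKernel (L : LevyTriplet d) (K : ℝ → E d → ℝ) : Prop :=
  ∀ t > 0, ContDiff ℝ ∞ (K t) ∧ (∀ x, 0 ≤ K t x) ∧ Integrable (K t) ∧ ∫ x, K t x = 1 ∧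
    ∀ ξ : E d, ∫ x, (K t x : ℂ) * Complex.exp (-Complex.I * (inner ℝ ξ x : ℝ)) =
      Complex.exp (-(t : ℂ) * L.symbol ξ)

/-- `𝓛` has a smooth heat kernel `K` whose derivatives of order `m` satisfy
`‖D^m K(t,·)‖_{L¹} ≤ 𝒦_m t^{-m/α}` for `0 < t ≤ T`. -/
def HeatKernelBounds (L : LevyTriplet d) (α T : ℝ) : Prop :=
  ∃ K : ℝ → E d → ℝ, L.IsSmoothHeatKernel K ∧ ∀ m : ℕ, ∃ c : ℝ, ∀ t ∈ Ioc 0 T,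
    eLpNorm (iteratedFDeriv ℝ m (K t)) 1 volume ≤ ENNReal.ofReal (c * t ^ (-(m / α)))

/-- The assumption on the diffusion operator: `α ∈ (1,2]`, and the heat kernels of `𝓛` and of `𝓛*`
satisfy the derivative bounds of order `α`. -/
def Admissible (L : LevyTriplet d) (α T : ℝ) : Prop :=
  1 < α ∧ α ≤ 2 ∧ L.HeatKernelBounds α T ∧ L.adjoint.HeatKernelBounds α T

end LevyTriplet

/-! ### Distributional solutions -/

/-- A test function on `[0,T]`: `φ ∈ C([0,T], C^n_b)` with `D^n φ` uniformly continuous,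
`∂_t φ ∈ C_b((0,T), C_b)`, and `g = ∂_t φ + 𝓛*φ` bounded on `(0,T)` with values in `C^{n-1}_b`. -/
structure TestFunction {d : ℕ} (L : LevyTriplet d) (T : ℝ) (n : ℕ) where
  φ : ℝ → HolderSpace d n
  dtφ : ℝ → HolderSpace d 0
  g : ℝ → HolderSpace d ((n : ℝ) - 1)
  continuousOn : ContinuousOn φ (Icc 0 T)
  uniformContinuousOn : UniformContinuousOn
    (fun p : ℝ × E d => iteratedFDeriv ℝ n (φ p.1 : E d → ℝ) p.2) (Icc 0 T ×ˢ univ)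
  hasDerivAt : ∀ t ∈ Ioo 0 T, ∀ x, HasDerivAt (fun s => φ s x) (dtφ t x) t
  dtφ_continuousOn : ContinuousOn dtφ (Ioo 0 T)
  dtφ_bounded : ∃ M, ∀ t ∈ Ioo 0 T, ‖dtφ t‖ ≤ M
  g_eq : ∀ t ∈ Ioo 0 T, ∀ x, g t x = dtφ t x + L.adjoint.op (φ t) x
  g_bounded : ∃ M, ∀ t ∈ Ioo 0 T, ‖g t‖ ≤ M

/-- A functional in `C^{-n}_b` that has been extended to larger Hölder spaces: a family of elements
of the duals of `C^r_b`, `r ∈ (n - α, n]`, any two of which agree on the functions on which both are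
defined. -/
def Coherent {d : ℕ} (n : ℕ) (α : ℝ) (ρ : ∀ r : ℝ, NegHolder d r) : Prop :=
  ∀ r ∈ Ioc (n - α) n, ∀ s ∈ Ioc (n - α) n, ∀ (u : HolderSpace d r) (v : HolderSpace d s),
    (u : E d → ℝ) = v → ρ r u = ρ s v

/-- `ρ` is a distributional solution of `∂_t ρ - 𝓛ρ - div(ρ V1) - div V2 = 0` on `(0,T) × ℝ^d`,
`ρ(0) = ρ0`. Here `ρ r t` is the functional `ρ(t)` regarded as an element of `C^{-r}_b`: it is paired
with `φ(t)` for `r = n`, and with `∂_t φ + 𝓛*φ - V1·Dφ` for `r = n - 1`. -/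
def IsDistributionalSolution {d : ℕ} (L : LevyTriplet d) (T : ℝ) {n : ℕ} (hn : 1 ≤ n)
    (V1 : ℝ → Fin d → HolderSpace d n) (V2 : ℝ → Fin d → SignedMeasure (E d))
    (ρ0 : NegHolder d n) (ρ : ∀ r : ℝ, ℝ → NegHolder d r) : Prop :=
  ρ n 0 = ρ0 ∧ ∀ Φ : TestFunction L T n, ∀ t ∈ Icc 0 T,
    IntervalIntegrable
      (fun s => ρ ((n : ℝ) - 1) s (Φ.g s - transport hn (V1 s) (Φ.φ s))) volume 0 t ∧
    IntervalIntegrable (fun s => ∑ i, ∫ᵛ y, pd i (Φ.φ s) y ∂•(V2 s i)) volume 0 t ∧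
    ρ n t (Φ.φ t) - ρ0 (Φ.φ 0) =
      (∫ s in 0..t, ρ ((n : ℝ) - 1) s (Φ.g s - transport hn (V1 s) (Φ.φ s))) -
      ∫ s in 0..t, ∑ i, ∫ᵛ y, pd i (Φ.φ s) y ∂•(V2 s i)

end LevyFP

end

open LevyFP

noncomputable section

set_option linter.unusedSectionVars false

namespace LevyFP

section

variable {d : ℕ}

/-! ### The spaces `C^r_b(ℝ^d)` -/

namespace HolderSpace

variable {r : ℝ} {k : ℕ}

/-! Let `P_t` be the heat semigroup of `𝓛*`, acting on test functions by convolution with `K*(t,·)`.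
By duality the problem takes the mild form `ρ(t) = P_t* ρ₀ - ∫_0^t P_{t-s}* q(s) ds`, with the
source `⟨q(s), u⟩ = ⟨ρ(s), V₁·Du⟩ + ∫ Du·dV₂(s)`. Since `u ↦ V₁·Du` maps `C^n_b` to `C^{n-1}_b`, the
source lies in `C^{-n}_b` as soon as `ρ(s) ∈ C^{-(n-1)}_b`, and the lost derivative has to be
regained from `P_{t-s}`.

The gain is `‖P_t‖ ≤ c t^{-γ/α}` from `C^{n-γ}_b` to `C^n_b` (`exists_norm_heat_le`): the
derivatives that `u` possesses fall on `u`, the others on the kernel, and a fractional part of the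
regularity is exploited through increments of length `t^{1/α}`. For `γ = 1` the singularity
`t^{-1/α}` is integrable because `α > 1`, and a contraction argument in the weight `t^{1/α} e^{-λt}`
yields `ρ` with values in `C^{-(n-1)}_b` and a bound linear in the data (`exists_mild_solution`).
After that `q` is known and `‖q(t)‖ ≤ M t^{-1/α}`, so the mild formula defines `ρ(t)` on every
`C^{n-γ}_b` with `0 ≤ γ < α`. Coherence is immediate, and the weighted bounds are estimates of Beta
integrals (`norm_mildSol_le`).

For the weak formulation, Duhamel's formula `P_{t-s}φ(t) - φ(s) = ∫_s^t P_{τ-s}(∂_tφ + 𝓛*φ)(τ) dτ`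
(`heat_sub_eq_integral`) is tested with `q(s)`, and the order of integration is exchanged on the
triangle `s < τ < t` (`mildSol_weak`). It rests on the Kolmogorov equation `P_t u - u = ∫_0^t P_r
𝓛*u dr` for `u ∈ C²_b`, which is verified by Fourier transform on `C_c^∞` and extended by truncation
and mollification, under bounded pointwise convergence of the derivatives. The same equation gives
continuity of `t ↦ P_t` in operator norm on `(0,T]`, hence the continuity of `ρ` in time.

Measure representability is characterised intrinsically: it is sequential continuity with respect to
bounded pointwise convergence of the derivatives of order at most `n`
(`MeasureRepresentable.mem_bpContinuous`, `measureRepresentable_of_mem_bpContinuous`). The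
functionals with this continuity form a closed subspace which contains the `V₂` term and is
respected by `P_t*` and by the adjoint of the transport operator. The Picard iterates therefore stay
in it, and so does their limit. -/

lemma contDiff (u : HolderSpace d r) : ContDiff ℝ ⌊r⌋₊ (u : E d → ℝ) := u.2.1

lemma coe_add (u v : HolderSpace d r) : ((u + v : HolderSpace d r) : E d → ℝ) = u + v := rfl

lemma coe_sub (u v : HolderSpace d r) : ((u - v : HolderSpace d r) : E d → ℝ) = u - v := rfl

lemma coe_smul (c : ℝ) (u : HolderSpace d r) : ((c • u : HolderSpace d r) : E d → ℝ) = c • u := rfl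

lemma ext {u v : HolderSpace d r} (h : (u : E d → ℝ) = v) : u = v := Subtype.ext h

lemma continuous (u : HolderSpace d r) : Continuous (u : E d → ℝ) := u.contDiff.continuous

lemma norm_iteratedFDeriv_le (u : HolderSpace d r) {j : ℕ} (hj : j ≤ ⌊r⌋₊) (x : E d) :
    ‖iteratedFDeriv ℝ j (u : E d → ℝ) x‖ ≤ ‖u‖ := by
  rw [norm_def, ← toReal_enorm]
  refine ENNReal.toReal_mono u.2.2.ne ?_
  refine (le_iSup (fun x => ‖iteratedFDeriv ℝ j (u : E d → ℝ) x‖ₑ) x).trans (le_add_right ?_)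
  exact Finset.single_le_sum (f := fun j => ⨆ x, ‖iteratedFDeriv ℝ j (u : E d → ℝ) x‖ₑ)
    (fun _ _ => zero_le) (Finset.mem_range.2 (Nat.lt_succ_of_le hj))

lemma abs_le_norm (u : HolderSpace d r) (x : E d) : |u x| ≤ ‖u‖ := by
  rw [← Real.norm_eq_abs, ← norm_iteratedFDeriv_zero (𝕜 := ℝ)]
  exact u.norm_iteratedFDeriv_le (Nat.zero_le _) x

lemma norm_sub_le_rpow (u : HolderSpace d r) (hr : r ≠ ⌊r⌋₊) (x y : E d) :
    ‖iteratedFDeriv ℝ ⌊r⌋₊ (u : E d → ℝ) x - iteratedFDeriv ℝ ⌊r⌋₊ (u : E d → ℝ) y‖ ≤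
      ‖u‖ * ‖x - y‖ ^ ((Real.toNNReal (r - ⌊r⌋₊) : ℝ≥0) : ℝ) := by
  set s := Real.toNNReal (r - ⌊r⌋₊)
  have hle : eHolderNorm s (iteratedFDeriv ℝ ⌊r⌋₊ (u : E d → ℝ)) ≤ eNormHolder r u := by
    unfold eNormHolder
    rw [if_neg hr]
    exact le_add_left le_rfl
  have hlt := hle.trans_lt u.2.2
  have hm : MemHolder s (iteratedFDeriv ℝ ⌊r⌋₊ (u : E d → ℝ)) := by
    rw [← eHolderNorm_lt_top]; exact hlt
  have h1 := hm.holderWith.dist_le x y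
  rw [dist_eq_norm, dist_eq_norm] at h1
  refine h1.trans ?_
  gcongr
  rw [norm_def]
  have := ENNReal.toReal_mono u.2.2.ne hle
  simpa [← hm.coe_nnHolderNorm_eq_eHolderNorm] using this

/-- An element of `C^k_b(ℝ^d)`, `k ∈ ℕ`, from bounds on the derivatives. -/
def ofBounds (hr : r = k) (u : E d → ℝ) (hu : ContDiff ℝ k u) (C : ℝ)
    (hC : ∀ j ≤ k, ∀ x, ‖iteratedFDeriv ℝ j u x‖ ≤ C) : HolderSpace d r :=
  ⟨u, (mem_holderSubmodule_of_nat hr).2 ⟨hu, fun j hj => ⟨C, hC j hj⟩⟩⟩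

lemma coe_ofBounds (hr : r = k) (u : E d → ℝ) (hu : ContDiff ℝ k u) (C : ℝ)
    (hC : ∀ j ≤ k, ∀ x, ‖iteratedFDeriv ℝ j u x‖ ≤ C) :
    (ofBounds hr u hu C hC : E d → ℝ) = u := rfl

lemma ofBounds_apply (hr : r = k) (u : E d → ℝ) (hu : ContDiff ℝ k u) (C : ℝ)
    (hC : ∀ j ≤ k, ∀ x, ‖iteratedFDeriv ℝ j u x‖ ≤ C) (x : E d) :
    (ofBounds hr u hu C hC : E d → ℝ) x = u x := rfl

lemma norm_le_of_bounds (hr : r = k) (u : HolderSpace d r) {C : ℝ}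
    (hC : ∀ j ≤ k, ∀ x, ‖iteratedFDeriv ℝ j (u : E d → ℝ) x‖ ≤ C) : ‖u‖ ≤ (k + 1) * C := by
  subst hr
  have hC0 : 0 ≤ C := (norm_nonneg _).trans (hC 0 (Nat.zero_le _) 0)
  rw [norm_def]
  refine ENNReal.toReal_le_of_le_ofReal (by positivity) ?_
  unfold eNormHolder
  have hfl : ⌊(k : ℝ)⌋₊ = k := Nat.floor_natCast k
  rw [hfl, if_pos rfl, add_zero]
  calc ∑ j ∈ Finset.range (k + 1), ⨆ x, ‖iteratedFDeriv ℝ j (u : E d → ℝ) x‖ₑ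
      ≤ ∑ j ∈ Finset.range (k + 1), ENNReal.ofReal C := by
        refine Finset.sum_le_sum fun j hj => iSup_le fun x => ?_
        rw [← ofReal_norm]
        exact ENNReal.ofReal_le_ofReal (hC j (Nat.le_of_lt_succ (Finset.mem_range.1 hj)) x)
    _ = ENNReal.ofReal ((k + 1) * C) := by
        rw [Finset.sum_const, Finset.card_range, nsmul_eq_mul,
          ENNReal.ofReal_mul (by positivity)]
        congr 1
        rw [ENNReal.ofReal_add (by positivity) (by norm_num)]
        simp

lemma contDiff_nat (u : HolderSpace d k) : ContDiff ℝ k (u : E d → ℝ) := by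
  have := u.contDiff
  rwa [Nat.floor_natCast] at this

lemma norm_iteratedFDeriv_le_nat (u : HolderSpace d k) {j : ℕ} (hj : j ≤ k) (x : E d) :
    ‖iteratedFDeriv ℝ j (u : E d → ℝ) x‖ ≤ ‖u‖ :=
  u.norm_iteratedFDeriv_le (by rwa [Nat.floor_natCast]) x

/-- Evaluation at a point. -/
def eval (r : ℝ) (x : E d) : NegHolder d r :=
  LinearMap.mkContinuous
    { toFun := fun u : HolderSpace d r => (u : E d → ℝ) x
      map_add' := fun _ _ => rfl
      map_smul' := fun _ _ => rfl } 1
    fun u => by rw [one_mul]; exact u.abs_le_norm x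

@[simp] lemma eval_apply (x : E d) (u : HolderSpace d r) : eval r x u = u x := rfl

lemma contDiff_tsum_and_bound {u : ℕ → E d → ℝ} {v : ℕ → ℝ} (hv : Summable v)
    (hu : ∀ i, ContDiff ℝ k (u i)) (hb : ∀ i, ∀ j ≤ k, ∀ x, ‖iteratedFDeriv ℝ j (u i) x‖ ≤ v i) :
    ContDiff ℝ k (fun x => ∑' i, u i x) ∧
      ∀ j ≤ k, ∀ x, ‖iteratedFDeriv ℝ j (fun x => ∑' i, u i x) x‖ ≤ ∑' i, v i := by
  refine ⟨contDiff_tsum (N := (k : ℕ∞)) (v := fun _ => v) hu (fun j _ => hv)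
      fun j i x hj => hb i j (by exact_mod_cast hj) x, fun j hj x => ?_⟩
  rw [iteratedFDeriv_tsum_apply (N := (k : ℕ∞)) (v := fun _ => v) hu (fun j _ => hv)
      (fun j i x hj => hb i j (by exact_mod_cast hj) x) (by exact_mod_cast hj)]
  exact tsum_of_norm_bounded hv.hasSum fun i => hb i j hj x

/-- The series may be differentiated term by term, and the derivatives of a remainder are bounded by
the remainder of the series of norms. This is completeness of `C^k_b`, needed for the integral in
Duhamel's formula, which takes values in this space. -/
lemma exists_tendsto_of_summable (u : ℕ → HolderSpace d k) (hu : Summable fun i => ‖u i‖) :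
    ∃ a, Tendsto (fun n => ∑ i ∈ Finset.range n, u i) atTop (𝓝 a) := by
  have hsum : ∀ N : ℕ, Summable fun i : ℕ => ‖u (i + N)‖ := fun N =>
    (summable_nat_add_iff (f := fun i => ‖u i‖) N).2 hu
  have h := fun N => contDiff_tsum_and_bound (hsum N) (fun i => (u (i + N)).contDiff_nat)
    fun i j hj x => (u (i + N)).norm_iteratedFDeriv_le_nat hj x
  refine ⟨ofBounds rfl _ (h 0).1 _ (h 0).2, ?_⟩
  rw [tendsto_iff_norm_sub_tendsto_zero]
  have htail := (tendsto_sum_nat_add fun i => ‖u i‖).const_mul ((k : ℝ) + 1)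
  rw [mul_zero] at htail
  refine squeeze_zero (fun _ => norm_nonneg _) (fun N => ?_) htail
  rw [norm_sub_rev]
  have hcoe : ((ofBounds rfl _ (h 0).1 _ (h 0).2 - ∑ i ∈ Finset.range N, u i : HolderSpace d k) :
      E d → ℝ) = fun x => ∑' i, (u (i + N) : E d → ℝ) x := by
    funext x
    have hs : Summable fun i => (u i : E d → ℝ) x :=
      Summable.of_norm_bounded hu fun i => (u i).abs_le_norm x
    have h1 := hs.sum_add_tsum_nat_add N
    rw [← eval_apply, map_sub, map_sum]
    simp only [eval_apply]
    rw [ofBounds_apply]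
    simp only [add_zero]
    linarith
  refine norm_le_of_bounds rfl _ fun j hj x => ?_
  rw [hcoe]
  exact (h N).2 j hj x

instance : CompleteSpace (HolderSpace d k) :=
  NormedAddCommGroup.completeSpace_of_summable_imp_tendsto exists_tendsto_of_summable

end HolderSpace

end

section

variable {d : ℕ}

/-! ### Functions with bounded derivatives -/

/-- `u` is of class `C^k` with bounded derivatives up to the order `k`. -/
def CB {F : Type} [NormedAddCommGroup F] [NormedSpace ℝ F] (k : ℕ) (u : E d → F) : Prop :=
  ContDiff ℝ k u ∧ ∀ j ≤ k, ∃ C : ℝ, ∀ x, ‖iteratedFDeriv ℝ j u x‖ ≤ C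

section CB

variable {F : Type} [NormedAddCommGroup F] [NormedSpace ℝ F] {u : E d → F} {k : ℕ}

lemma CB.of_le {l : ℕ} (h : CB k u) (hl : l ≤ k) : CB l u :=
  ⟨h.1.of_le (by exact_mod_cast hl), fun j hj => h.2 j (hj.trans hl)⟩

lemma CB.fderiv (h : CB (k + 1) u) : CB k (fderiv ℝ u) := by
  refine ⟨h.1.fderiv_right (by push_cast; exact le_rfl), fun j hj => ?_⟩
  obtain ⟨C, hC⟩ := h.2 (j + 1) (by omega)
  exact ⟨C, fun x => by rw [norm_iteratedFDeriv_fderiv]; exact hC x⟩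

lemma CB.bounded (h : CB k u) : ∃ C : ℝ, ∀ x, ‖u x‖ ≤ C := by
  obtain ⟨C, hC⟩ := h.2 0 (Nat.zero_le _)
  exact ⟨C, fun x => by simpa using hC x⟩

lemma CB.continuous (h : CB k u) : Continuous u := h.1.continuous

lemma CB.differentiable (h : CB (k + 1) u) : Differentiable ℝ u :=
  h.1.differentiable (by simp)

lemma HolderSpace.cb {r : ℝ} (u : HolderSpace d r) : CB ⌊r⌋₊ (u : E d → ℝ) :=
  ⟨u.contDiff, fun _ hj => ⟨‖u‖, u.norm_iteratedFDeriv_le hj⟩⟩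

lemma HolderSpace.cb_nat (u : HolderSpace d k) : CB k (u : E d → ℝ) :=
  (mem_holderSubmodule_of_nat rfl).1 u.2

end CB

/-! ### Averages with respect to a finite measure -/

/-- The average `x ↦ ∫ u(x - y) μ(dy)`, the convolution of `u` with the measure `μ`. -/
def avg {F : Type} [NormedAddCommGroup F] [NormedSpace ℝ F] (μ : Measure (E d)) (u : E d → F)
    (x : E d) : F := ∫ y, u (x - y) ∂μ

section avg

variable {F : Type} [NormedAddCommGroup F] [NormedSpace ℝ F] {u : E d → F} {k : ℕ}
  {μ : Measure (E d)}

lemma integrable_avg [IsFiniteMeasure μ] (hu : Continuous u) {C : ℝ} (hC : ∀ x, ‖u x‖ ≤ C)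
    (x : E d) : Integrable (fun y => u (x - y)) μ :=
  Integrable.of_bound (hu.comp (by fun_prop)).aestronglyMeasurable C (ae_of_all _ fun y => hC _)

lemma norm_avg_le [IsProbabilityMeasure μ] {C : ℝ} (hC : ∀ x, ‖u x‖ ≤ C) (x : E d) :
    ‖avg μ u x‖ ≤ C := by
  have := norm_integral_le_of_norm_le_const (μ := μ) (f := fun y => u (x - y)) (C := C)
    (ae_of_all _ fun y => hC _)
  simpa [avg] using this

lemma avg_dirac_zero (u : E d → F) [CompleteSpace F] : avg (Measure.dirac 0) u = u := by
  funext x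
  simp [avg]

lemma continuous_avg [IsFiniteMeasure μ] (hu : Continuous u) {C : ℝ} (hC : ∀ x, ‖u x‖ ≤ C) :
    Continuous (avg μ u) := by
  refine continuous_of_dominated (bound := fun _ => C) (fun x => ?_) (fun x => ?_)
    (integrable_const _) (ae_of_all _ fun y => hu.comp (by fun_prop))
  · exact (hu.comp (by fun_prop)).aestronglyMeasurable
  · exact ae_of_all _ fun y => hC _

lemma hasFDerivAt_avg [IsFiniteMeasure μ] (hu : CB 1 u) (x : E d) :
    HasFDerivAt (avg μ u) (avg μ (fderiv ℝ u) x) x := by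
  obtain ⟨C, hC⟩ := hu.bounded
  obtain ⟨C', hC'⟩ := (CB.fderiv (k := 0) hu).bounded
  have hc := (CB.fderiv (k := 0) hu).continuous
  refine hasFDerivAt_integral_of_dominated_of_fderiv_le (bound := fun _ => C') (s := univ)
    (F := fun x y => u (x - y)) (F' := fun x y => fderiv ℝ u (x - y)) univ_mem ?_ ?_ ?_ ?_ ?_ ?_
  · exact Eventually.of_forall fun x =>
      (hu.continuous.comp (by fun_prop : Continuous fun y => x - y)).aestronglyMeasurable
  · exact integrable_avg hu.continuous hC x
  · exact (hc.comp (by fun_prop)).aestronglyMeasurable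
  · exact ae_of_all _ fun y x _ => hC' _
  · exact integrable_const _
  · refine ae_of_all _ fun y x _ => ?_
    have := (CB.differentiable (k := 0) hu (x - y)).hasFDerivAt
    have h2 := this.comp x ((hasFDerivAt_id x).sub_const y)
    rwa [ContinuousLinearMap.comp_id] at h2

lemma fderiv_avg [IsFiniteMeasure μ] (hu : CB 1 u) : fderiv ℝ (avg μ u) = avg μ (fderiv ℝ u) :=
  funext fun x => (hasFDerivAt_avg hu x).fderiv

lemma contDiff_avg [IsFiniteMeasure μ] (hu : CB k u) : ContDiff ℝ k (avg μ u) := by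
  induction k generalizing F with
  | zero =>
    obtain ⟨C, hC⟩ := hu.bounded
    exact contDiff_zero.2 (continuous_avg hu.continuous hC)
  | succ k ih =>
    rw [Nat.cast_succ, contDiff_succ_iff_fderiv]
    refine ⟨fun x => (hasFDerivAt_avg (hu.of_le (by omega)) x).differentiableAt, by simp, ?_⟩
    rw [fderiv_avg (hu.of_le (by omega))]
    exact ih hu.fderiv

lemma iteratedFDeriv_avg_apply [IsFiniteMeasure μ] [CompleteSpace F] (hu : CB k u) (x : E d)
    (m : Fin k → E d) :
    iteratedFDeriv ℝ k (avg μ u) x m = avg μ (fun z => iteratedFDeriv ℝ k u z m) x := by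
  induction k generalizing F with
  | zero => simp [avg]
  | succ k ih =>
    rw [iteratedFDeriv_succ_apply_right]
    change iteratedFDeriv ℝ k (fderiv ℝ (avg μ u)) x (Fin.init m) _ = _
    rw [fderiv_avg (hu.of_le (by omega)), ih hu.fderiv]
    have key : ∀ φ : E d → E d →L[ℝ] F, Integrable φ μ → (∫ y, φ y ∂μ) (m (Fin.last k)) =
        ∫ y, φ y (m (Fin.last k)) ∂μ := fun φ hφ => ContinuousLinearMap.integral_apply hφ _
    unfold avg
    rw [key]
    · simp_rw [iteratedFDeriv_succ_apply_right]
    · obtain ⟨C, hC⟩ := hu.fderiv.2 k le_rfl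
      refine integrable_avg (u := fun z => iteratedFDeriv ℝ k (fderiv ℝ u) z (Fin.init m))
        (C := C * ∏ i, ‖Fin.init m i‖) ?_ (fun z => ?_) x
      · exact (hu.fderiv.1.continuous_iteratedFDeriv (by simp)).eval_const _
      · exact (ContinuousMultilinearMap.le_opNorm _ _).trans (by gcongr; exact hC z)

lemma norm_iteratedFDeriv_avg_le [IsProbabilityMeasure μ] [CompleteSpace F] (hu : CB k u) {C : ℝ}
    (hC : ∀ x, ‖iteratedFDeriv ℝ k u x‖ ≤ C) (x : E d) :
    ‖iteratedFDeriv ℝ k (avg μ u) x‖ ≤ C := by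
  refine ContinuousMultilinearMap.opNorm_le_bound ((norm_nonneg _).trans (hC x)) fun m => ?_
  rw [iteratedFDeriv_avg_apply hu]
  exact norm_avg_le (fun z => (ContinuousMultilinearMap.le_opNorm _ _).trans
    (by gcongr; exact hC z)) x

lemma CB.avg [IsProbabilityMeasure μ] [CompleteSpace F] (hu : CB k u) : CB k (avg μ u) := by
  refine ⟨contDiff_avg hu, fun j hj => ?_⟩
  obtain ⟨C, hC⟩ := hu.2 j hj
  exact ⟨C, norm_iteratedFDeriv_avg_le (hu.of_le hj) hC⟩

lemma avg_conv {ν : Measure (E d)} [IsFiniteMeasure μ] [IsFiniteMeasure ν]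
    (hu : Continuous u) {C : ℝ} (hC : ∀ x, ‖u x‖ ≤ C) :
    LevyFP.avg (μ.conv ν) u = LevyFP.avg μ (LevyFP.avg ν u) := by
  funext x
  unfold LevyFP.avg
  rw [Measure.conv, integral_map (f := fun y => u (x - y)) (by fun_prop)
    (hu.comp (by fun_prop)).aestronglyMeasurable,
    integral_prod]
  · simp_rw [sub_sub]
  · exact Integrable.of_bound (hu.comp (by fun_prop)).aestronglyMeasurable C
      (ae_of_all _ fun y => hC _)

end avg

/-! ### Cut-off functions -/

/-- A smooth cut-off function: equal to `1` on the unit ball, supported in the ball of radius `2`.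
-/
def cutoffBump (d : ℕ) : ContDiffBump (0 : E d) := ⟨1, 2, one_pos, one_lt_two⟩

/-- The cut-off function at scale `R`. -/
def cutoff (R : ℝ) (x : E d) : ℝ := cutoffBump d (R⁻¹ • x)

section cutoff

lemma contDiff_cutoff (R : ℝ) : ContDiff ℝ ∞ (cutoff R : E d → ℝ) :=
  (cutoffBump d).contDiff.comp (contDiff_const_smul _)

lemma hasCompactSupport_cutoff {R : ℝ} (hR : 0 < R) : HasCompactSupport (cutoff R : E d → ℝ) :=
  (cutoffBump d).hasCompactSupport.comp_smul (inv_ne_zero hR.ne')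

lemma cutoff_nonneg (R : ℝ) (x : E d) : 0 ≤ cutoff R x := (cutoffBump d).nonneg

lemma cutoff_le_one (R : ℝ) (x : E d) : cutoff R x ≤ 1 := (cutoffBump d).le_one

lemma cutoff_eq_one {R : ℝ} (hR : 0 < R) {x : E d} (hx : ‖x‖ ≤ R) : cutoff R x = 1 := by
  refine (cutoffBump d).one_of_mem_closedBall ?_
  rw [mem_closedBall_zero_iff, norm_smul, norm_inv, Real.norm_of_nonneg hR.le]
  change _ ≤ (1 : ℝ)
  rw [inv_mul_le_iff₀ hR]
  simpa using hx

lemma cutoff_eventuallyEq_one (x : E d) :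
    ∀ᶠ R : ℕ in atTop, cutoff (R : ℝ) =ᶠ[𝓝 x] fun _ => (1 : ℝ) := by
  filter_upwards [eventually_ge_atTop (⌈‖x‖⌉₊ + 1)] with R hR
  have h1 : ‖x‖ < R := by
    have h2 : ((⌈‖x‖⌉₊ + 1 : ℕ) : ℝ) ≤ R := by exact_mod_cast hR
    push_cast at h2
    linarith [Nat.le_ceil ‖x‖]
  have h2 : ∀ᶠ y in 𝓝 x, ‖y‖ < R := continuous_norm.continuousAt.eventually_lt
    continuousAt_const h1
  filter_upwards [h2] with y hy
  exact cutoff_eq_one ((norm_nonneg _).trans_lt hy) hy.le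

/-- By scaling, each derivative of the cut-off produces a factor `R⁻¹`, and the derivatives of the
fixed bump are bounded by compactness. -/
lemma exists_iteratedFDeriv_cutoff_le (d j : ℕ) :
    ∃ C : ℝ, ∀ R ≥ (1 : ℝ), ∀ x : E d, ‖iteratedFDeriv ℝ j (cutoff R) x‖ ≤ C / R ^ j := by
  have hs : ContDiff ℝ ∞ (cutoffBump d) := (cutoffBump d).contDiff
  have hc : HasCompactSupport (iteratedFDeriv ℝ j (cutoffBump d)) :=
    (cutoffBump d).hasCompactSupport.iteratedFDeriv j
  obtain ⟨C, hC⟩ := (hs.continuous_iteratedFDeriv (m := j)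
    (by exact_mod_cast le_top)).bounded_above_of_compact_support hc
  refine ⟨C, fun R hR x => ?_⟩
  have h1 : iteratedFDeriv ℝ j (cutoff R) x = (R⁻¹) ^ j • iteratedFDeriv ℝ j (cutoffBump d) (R⁻¹ • x) := by
    exact congrFun (iteratedFDeriv_comp_const_smul (i := j) R⁻¹
      (hs.of_le (by exact_mod_cast le_top))) x
  rw [h1, norm_smul, norm_pow, norm_inv, Real.norm_of_nonneg (by linarith), inv_pow, div_eq_inv_mul]
  gcongr
  exact hC _

end cutoff

end

section

variable {d : ℕ}

/-! ### Smoothing by convolution with a kernel whose derivatives are integrable -/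

open scoped Convolution

section smoothing

variable {F G H : Type} [NormedAddCommGroup F] [NormedSpace ℝ F] [NormedAddCommGroup G]
  [NormedSpace ℝ G] [NormedAddCommGroup H] [NormedSpace ℝ H] {κ : E d → G} {u : E d → F} {k : ℕ}
  {B : G →L[ℝ] F →L[ℝ] H} {C : ℝ}

lemma norm_convolution_le (hκ : Integrable κ) (hC : ∀ x, ‖u x‖ ≤ C) (x : E d) :
    ‖(κ ⋆[B, volume] u) x‖ ≤ ‖B‖ * (∫ y, ‖κ y‖) * C := by
  rw [convolution_def, mul_right_comm, ← integral_const_mul]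
  refine norm_integral_le_of_norm_le (hκ.norm.const_mul _) (ae_of_all _ fun y => ?_)
  calc ‖B (κ y) (u (x - y))‖ ≤ ‖B‖ * ‖κ y‖ * ‖u (x - y)‖ := B.le_opNorm₂ _ _
    _ ≤ ‖B‖ * ‖κ y‖ * C := by gcongr; exact hC _
    _ = _ := by ring

lemma integrable_convolution_integrand (hκ : Integrable κ) (hu : Continuous u)
    (hC : ∀ x, ‖u x‖ ≤ C) (x : E d) : Integrable (fun y => B (κ y) (u (x - y))) := by
  refine (hκ.norm.const_mul (‖B‖ * C)).mono' ?_ (ae_of_all _ fun y => ?_)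
  · exact B.aestronglyMeasurable_comp₂ hκ.aestronglyMeasurable
      (hu.comp (by fun_prop)).aestronglyMeasurable
  · calc ‖B (κ y) (u (x - y))‖ ≤ ‖B‖ * ‖κ y‖ * ‖u (x - y)‖ := B.le_opNorm₂ _ _
      _ ≤ ‖B‖ * ‖κ y‖ * C := by gcongr; exact hC _
      _ = _ := by ring

lemma convolution_sub_left {κ' : E d → G} (hκ : Integrable κ) (hκ' : Integrable κ')
    (hu : Continuous u) (hC : ∀ x, ‖u x‖ ≤ C) (x : E d) :
    (κ ⋆[B, volume] u) x - (κ' ⋆[B, volume] u) x = ((κ - κ') ⋆[B, volume] u) x := by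
  simp only [convolution_def]
  rw [← integral_sub (integrable_convolution_integrand hκ hu hC x)
    (integrable_convolution_integrand hκ' hu hC x)]
  simp

lemma convolution_sub_right {v : E d → F} {C' : ℝ} (hκ : Integrable κ)
    (hu : Continuous u) (hC : ∀ x, ‖u x‖ ≤ C) (hv : Continuous v) (hC' : ∀ x, ‖v x‖ ≤ C')
    (x : E d) :
    (κ ⋆[B, volume] u) x - (κ ⋆[B, volume] v) x = (κ ⋆[B, volume] (u - v)) x := by
  simp only [convolution_def]
  rw [← integral_sub (integrable_convolution_integrand hκ hu hC x)
    (integrable_convolution_integrand hκ hv hC' x)]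
  simp

lemma hasFDerivAt_cutoff_smul (hκ : ContDiff ℝ 1 κ) (R : ℝ) (x : E d) :
    HasFDerivAt (fun y => cutoff R y • κ y)
      (cutoff R x • fderiv ℝ κ x + (fderiv ℝ (cutoff R) x).smulRight (κ x)) x :=
  (((contDiff_cutoff R).differentiable (by simp)) x).hasFDerivAt.smul
    ((hκ.differentiable (by simp)) x).hasFDerivAt

lemma fderiv_cutoff_bound (hκ : ContDiff ℝ 1 κ) : ∃ c : ℝ, ∀ R ≥ (1 : ℝ), ∀ x,
    ‖fderiv ℝ (fun y => cutoff R y • κ y) x‖ ≤ ‖fderiv ℝ κ x‖ + c * ‖κ x‖ := by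
  obtain ⟨c, hc⟩ := exists_iteratedFDeriv_cutoff_le d 1
  refine ⟨c, fun R hR x => ?_⟩
  rw [(hasFDerivAt_cutoff_smul hκ R x).fderiv]
  refine (norm_add_le _ _).trans (add_le_add ?_ ?_)
  · rw [norm_smul, Real.norm_of_nonneg (cutoff_nonneg R x)]
    exact mul_le_of_le_one_left (norm_nonneg _) (cutoff_le_one R x)
  · rw [ContinuousLinearMap.norm_smulRight_apply]
    gcongr
    have h1 := hc R hR x
    have hc0 : 0 ≤ c := by
      have := (norm_nonneg _).trans h1
      rw [pow_one] at this
      by_contra h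
      exact absurd this (not_le.2 (div_neg_of_neg_of_pos (not_le.1 h) (by linarith)))
    rw [norm_iteratedFDeriv_one, pow_one] at h1
    exact h1.trans (div_le_self hc0 hR)

/-- Dominated convergence: near a given point the cut-off is eventually equal to one, and the
derivative that falls on the cut-off costs at most a multiple of `‖κ‖`, which is integrable. -/
lemma tendsto_integral_norm_cutoff_sub (hκ : ContDiff ℝ 1 κ) (hi : Integrable κ)
    (hi' : Integrable (fderiv ℝ κ)) :
    Tendsto (fun R : ℕ => ∫ x, ‖fderiv ℝ (fun y => cutoff (R : ℝ) y • κ y) x - fderiv ℝ κ x‖)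
      atTop (𝓝 0) := by
  obtain ⟨c, hc⟩ := fderiv_cutoff_bound hκ
  have h0 : (0 : ℝ) = ∫ _ : E d, (0 : ℝ) := by simp
  rw [h0]
  refine tendsto_integral_filter_of_dominated_convergence
    (fun x => ‖fderiv ℝ κ x‖ + c * ‖κ x‖ + ‖fderiv ℝ κ x‖) ?_ ?_ ?_ ?_
  · refine Eventually.of_forall fun R => Continuous.aestronglyMeasurable ?_
    refine Continuous.norm (Continuous.sub ?_ (hκ.continuous_fderiv (by simp)))
    exact (((contDiff_cutoff (R : ℝ)).of_le (by simp)).smul hκ).continuous_fderiv (by simp)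
  · filter_upwards [eventually_ge_atTop 1] with R hR
    refine ae_of_all _ fun x => ?_
    rw [norm_norm]
    exact (norm_sub_le _ _).trans (add_le_add_left (hc R (by exact_mod_cast hR) x) _)
  · exact (hi'.norm.add (hi.norm.const_mul c)).add hi'.norm
  · refine ae_of_all _ fun x => tendsto_const_nhds.congr' ?_
    filter_upwards [cutoff_eventuallyEq_one x] with R hR
    have : (fun y => cutoff (R : ℝ) y • κ y) =ᶠ[𝓝 x] κ := by
      filter_upwards [hR] with y hy
      rw [hy, one_smul]
    rw [this.fderiv_eq, sub_self, norm_zero]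

lemma integrable_fderiv_cutoff_smul (hκ : ContDiff ℝ 1 κ) {R : ℝ} (hR : 0 < R) :
    Integrable (fderiv ℝ (fun y => cutoff R y • κ y)) := by
  refine Continuous.integrable_of_hasCompactSupport ?_ ?_
  · exact (((contDiff_cutoff R).of_le (by simp)).smul hκ).continuous_fderiv (by simp)
  · exact HasCompactSupport.fderiv ℝ (hasCompactSupport_cutoff hR).smul_right

/-- Neither factor has compact support, so the kernel is truncated. The derivatives of the
truncations converge in `L¹`; as `u` is bounded, the differentiated convolutions converge uniformly,
while the convolutions themselves converge pointwise. -/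
lemma hasFDerivAt_convolution [CompleteSpace F] (hκ : ContDiff ℝ 1 κ) (hi : Integrable κ)
    (hi' : Integrable (fderiv ℝ κ)) (hu : Continuous u) (hC : ∀ x, ‖u x‖ ≤ C) (x : E d) :
    HasFDerivAt (κ ⋆[B, volume] u) ((fderiv ℝ κ ⋆[B.precompL (E d), volume] u) x) x := by
  have hC0 : 0 ≤ C := (norm_nonneg _).trans (hC 0)
  refine hasFDerivAt_of_tendstoUniformly (l := atTop)
    -- The shift by one keeps the cut-off radius positive at `R = 0`.
    (f := fun R : ℕ => (fun y => cutoff ((R : ℝ) + 1) y • κ y) ⋆[B, volume] u)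
    (f' := fun R : ℕ => fderiv ℝ (fun y => cutoff ((R : ℝ) + 1) y • κ y) ⋆[B.precompL (E d), volume] u)
    ?_ ?_ ?_ x
  · rw [Metric.tendstoUniformly_iff]
    intro ε hε
    have h1 := ((tendsto_integral_norm_cutoff_sub hκ hi hi').comp
      (tendsto_add_atTop_nat 1)).const_mul ‖B‖
    have h2 := h1.mul_const C
    rw [mul_zero, zero_mul] at h2
    filter_upwards [h2.eventually_lt_const hε] with R hR x
    rw [dist_comm, dist_eq_norm, convolution_sub_left (integrable_fderiv_cutoff_smul hκ (by positivity))
      hi' hu hC]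
    refine lt_of_le_of_lt ((norm_convolution_le
      ((integrable_fderiv_cutoff_smul hκ (by positivity)).sub hi') hC x).trans ?_) hR
    simp only [Function.comp_apply, Nat.cast_add, Nat.cast_one, Pi.sub_apply]
    have := ContinuousLinearMap.norm_precompL_le (E d) B
    gcongr
  · intro R x
    refine HasCompactSupport.hasFDerivAt_convolution_left B ?_ ?_ hu.locallyIntegrable x
    · exact (hasCompactSupport_cutoff (by positivity)).smul_right
    · exact ((contDiff_cutoff _).of_le (by simp)).smul hκ
  · intro x
    simp only [convolution_def]
    refine tendsto_integral_of_dominated_convergence (fun y => ‖B‖ * C * ‖κ y‖) ?_ ?_ ?_ ?_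
    · intro R
      exact B.aestronglyMeasurable_comp₂
        (((contDiff_cutoff _).continuous).smul hκ.continuous).aestronglyMeasurable
        (hu.comp (by fun_prop)).aestronglyMeasurable
    · exact hi.norm.const_mul _
    · refine fun R => ae_of_all _ fun y => ?_
      calc ‖B (cutoff ((R : ℝ) + 1) y • κ y) (u (x - y))‖
          ≤ ‖B‖ * ‖cutoff ((R : ℝ) + 1) y • κ y‖ * ‖u (x - y)‖ := B.le_opNorm₂ _ _
        _ ≤ ‖B‖ * ‖κ y‖ * C := by
          gcongr
          · rw [norm_smul, Real.norm_of_nonneg (cutoff_nonneg _ _)]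
            exact mul_le_of_le_one_left (norm_nonneg _) (cutoff_le_one _ _)
          · exact hC _
        _ = _ := by ring
    · refine ae_of_all _ fun y => tendsto_const_nhds.congr' ?_
      have h := (tendsto_add_atTop_nat 1).eventually (cutoff_eventuallyEq_one y)
      filter_upwards [h] with R hR
      have := hR.self_of_nhds
      push_cast at this
      rw [this, one_smul]

lemma fderiv_convolution [CompleteSpace F] (hκ : ContDiff ℝ 1 κ) (hi : Integrable κ)
    (hi' : Integrable (fderiv ℝ κ)) (hu : Continuous u) (hC : ∀ x, ‖u x‖ ≤ C) :
    fderiv ℝ (κ ⋆[B, volume] u) = fderiv ℝ κ ⋆[B.precompL (E d), volume] u :=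
  funext fun x => (hasFDerivAt_convolution hκ hi hi' hu hC x).fderiv

lemma integrable_fderiv_of_iteratedFDeriv
    (hi : ∀ j ≤ k + 1, Integrable (iteratedFDeriv ℝ j κ)) (hκ : ContDiff ℝ (k + 1 : ℕ) κ) :
    ∀ j ≤ k, Integrable (iteratedFDeriv ℝ j (fderiv ℝ κ)) := by
  intro j hj
  refine ((hi (j + 1) (by omega)).norm).mono' ?_ (ae_of_all _ fun x => ?_)
  · exact (ContDiff.continuous_iteratedFDeriv (by exact_mod_cast hj)
      (hκ.fderiv_right (m := k) (by push_cast; exact le_rfl))).aestronglyMeasurable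
  · rw [norm_iteratedFDeriv_fderiv]

lemma integrable_of_iteratedFDeriv_zero (hi : Integrable (iteratedFDeriv ℝ 0 κ))
    (hκ : Continuous κ) : Integrable κ :=
  hi.norm.mono' hκ.aestronglyMeasurable (ae_of_all _ fun x => by simp)

lemma integrable_fderiv_of_iteratedFDeriv_one (hi : Integrable (iteratedFDeriv ℝ 1 κ))
    (hκ : ContDiff ℝ 1 κ) : Integrable (fderiv ℝ κ) :=
  hi.norm.mono' (hκ.continuous_fderiv (by simp)).aestronglyMeasurable (ae_of_all _ fun x => by simp)

/-- The kernel may take values in any normed space and the pairing `B` is arbitrary, because the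
induction replaces `κ` by its derivative and `B` by `B.precompL`, whose norm is not larger. Only
boundedness and continuity of `u` are used: all derivatives fall on the kernel. -/
lemma contDiff_convolution_of_integrable [CompleteSpace F] (hκ : ContDiff ℝ k κ)
    (hi : ∀ j ≤ k, Integrable (iteratedFDeriv ℝ j κ)) (hu : Continuous u) (hC : ∀ x, ‖u x‖ ≤ C) :
    ContDiff ℝ k (κ ⋆[B, volume] u) := by
  induction k generalizing G H with
  | zero =>
    refine contDiff_zero.2 (BddAbove.continuous_convolution_right_of_integrable B ?_
      (integrable_of_iteratedFDeriv_zero (hi 0 le_rfl) hκ.continuous) hu)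
    exact ⟨C, by rintro _ ⟨x, rfl⟩; exact hC x⟩
  | succ k ih =>
    have hκ1 : ContDiff ℝ 1 κ := hκ.of_le (by exact_mod_cast Nat.le_add_left 1 k)
    have hi0 := integrable_of_iteratedFDeriv_zero (hi 0 (by omega)) hκ.continuous
    have hi1 := integrable_fderiv_of_iteratedFDeriv_one (hi 1 (by omega)) hκ1
    rw [Nat.cast_succ, contDiff_succ_iff_fderiv]
    refine ⟨fun x => (hasFDerivAt_convolution hκ1 hi0 hi1 hu hC x).differentiableAt, by simp, ?_⟩
    rw [fderiv_convolution hκ1 hi0 hi1 hu hC]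
    exact ih (hκ.fderiv_right (by push_cast; exact le_rfl))
      (integrable_fderiv_of_iteratedFDeriv hi hκ)

lemma norm_iteratedFDeriv_convolution_le [CompleteSpace F] (hκ : ContDiff ℝ k κ)
    (hi : ∀ j ≤ k, Integrable (iteratedFDeriv ℝ j κ)) (hu : Continuous u) (hC : ∀ x, ‖u x‖ ≤ C)
    (x : E d) :
    ‖iteratedFDeriv ℝ k (κ ⋆[B, volume] u) x‖ ≤ ‖B‖ * (∫ y, ‖iteratedFDeriv ℝ k κ y‖) * C := by
  have hC0 : 0 ≤ C := (norm_nonneg _).trans (hC 0)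
  induction k generalizing G H with
  | zero =>
    simpa using norm_convolution_le (B := B)
      (integrable_of_iteratedFDeriv_zero (hi 0 le_rfl) hκ.continuous) hC x
  | succ k ih =>
    have hκ1 : ContDiff ℝ 1 κ := hκ.of_le (by exact_mod_cast Nat.le_add_left 1 k)
    have hi0 := integrable_of_iteratedFDeriv_zero (hi 0 (by omega)) hκ.continuous
    have hi1 := integrable_fderiv_of_iteratedFDeriv_one (hi 1 (by omega)) hκ1
    rw [← norm_iteratedFDeriv_fderiv, fderiv_convolution hκ1 hi0 hi1 hu hC]
    refine (ih (hκ.fderiv_right (by push_cast; exact le_rfl))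
      (integrable_fderiv_of_iteratedFDeriv hi hκ)).trans ?_
    simp_rw [norm_iteratedFDeriv_fderiv]
    gcongr
    · exact ContinuousLinearMap.norm_precompL_le _ _

/-- A Hölder continuous function gains smoothness under convolution, at the expense of fewer
derivatives of the kernel. -/
lemma norm_fderiv_convolution_le_of_holder [CompleteSpace F] (hκ : ContDiff ℝ 1 κ)
    (hi : Integrable κ) (hi' : Integrable (fderiv ℝ κ)) (hu : Continuous u) (hC : ∀ x, ‖u x‖ ≤ C)
    {σ c : ℝ} (hσ : 0 < σ) (hc : 0 ≤ c) (hh : ∀ x y, ‖u x - u y‖ ≤ c * ‖x - y‖ ^ σ) {s : ℝ}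
    (hs : 0 < s) (x : E d) :
    ‖fderiv ℝ (κ ⋆[B, volume] u) x‖ ≤
      ‖B‖ * (∫ y, ‖fderiv ℝ κ y‖) * (c * s ^ σ) + ‖B‖ * (∫ y, ‖κ y‖) * (c * s ^ σ) / s := by
  set f := κ ⋆[B, volume] u with hf
  set a := ‖B‖ * (∫ y, ‖fderiv ℝ κ y‖) * (c * s ^ σ)
  set b := ‖B‖ * (∫ y, ‖κ y‖) * (c * s ^ σ)
  have ha : 0 ≤ a := by positivity
  have hb : 0 ≤ b := by positivity
  have hsh : ∀ h : E d, ‖h‖ ≤ s → ∀ z, ‖u z - u (z - h)‖ ≤ c * s ^ σ := by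
    intro h hh' z
    refine (hh _ _).trans ?_
    gcongr
    simpa using hh'
  -- A translation of the convolution is the convolution with the translated `u`, so its increment
  -- sees only `u - u(· - h)`, of size at most `c s^σ`.
  have hshift : ∀ {G' H' : Type} [NormedAddCommGroup G'] [NormedSpace ℝ G'] [NormedAddCommGroup H']
      [NormedSpace ℝ H'] (B' : G' →L[ℝ] F →L[ℝ] H') {κ' : E d → G'} (_ : Integrable κ') (h : E d),
      ‖h‖ ≤ s → ‖(κ' ⋆[B', volume] u) x - (κ' ⋆[B', volume] u) (x - h)‖ ≤
        ‖B'‖ * (∫ y, ‖κ' y‖) * (c * s ^ σ) := by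
    intro G' H' _ _ _ _ B' κ' hκ' h hh'
    have h1 : (κ' ⋆[B', volume] u) (x - h) = (κ' ⋆[B', volume] (fun z => u (z - h))) x := by
      simp only [convolution_def, sub_right_comm]
    rw [h1, convolution_sub_right (v := fun z => u (z - h)) (C' := C) hκ' hu hC
      (hu.comp (by fun_prop)) fun z => hC _]
    exact norm_convolution_le hκ' (fun z => hsh h hh' z) x
  have hfd : fderiv ℝ f = fderiv ℝ κ ⋆[B.precompL (E d), volume] u :=
    fderiv_convolution hκ hi hi' hu hC
  have hdiff : Differentiable ℝ f := fun z =>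
    (hasFDerivAt_convolution hκ hi hi' hu hC z).differentiableAt
  have hnear : ∀ y ∈ Metric.closedBall x s, ‖fderiv ℝ f y - fderiv ℝ f x‖ ≤ a := by
    intro y hy
    rw [mem_closedBall_iff_norm'] at hy
    have := hshift (B.precompL (E d)) hi' (x - y) hy
    rw [sub_sub_cancel, ← hfd, norm_sub_rev] at this
    refine this.trans ?_
    have := ContinuousLinearMap.norm_precompL_le (E d) B
    simp only [a]
    gcongr
  refine ContinuousLinearMap.opNorm_le_of_unit_norm (by positivity) fun e he => ?_
  have hmem : x - s • e ∈ Metric.closedBall x s := by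
    rw [mem_closedBall_iff_norm']
    simp [norm_smul, he, abs_of_pos hs]
  have h1 := (convex_closedBall x s).norm_image_sub_le_of_norm_fderiv_le' (𝕜 := ℝ)
    (φ := fderiv ℝ f x) (fun y _ => hdiff y) hnear (Metric.mem_closedBall_self hs.le) hmem
  have h2 : x - s • e - x = -(s • e) := by abel
  rw [h2, norm_neg, norm_smul, he, mul_one, Real.norm_of_nonneg hs.le, map_neg, map_smul] at h1
  have h3 := hshift B hi (s • e) (by simp [norm_smul, he, abs_of_pos hs])
  -- On the ball of radius `s` the derivative of `f` varies by at most `a`, and `f` itself changes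
  -- by at most `b` along `s • e`. Comparing `f` with its linearisation at `x` bounds the derivative
  -- in the direction `e`.
  have h4 : s * ‖fderiv ℝ f x e‖ ≤ a * s + b := by
    calc s * ‖fderiv ℝ f x e‖ = ‖s • fderiv ℝ f x e‖ := by
          rw [norm_smul, Real.norm_of_nonneg hs.le]
      _ = ‖(f (x - s • e) - f x - -(s • fderiv ℝ f x e)) + (f x - f (x - s • e))‖ := by
          congr 1; abel
      _ ≤ a * s + b := (norm_add_le _ _).trans (add_le_add h1 h3)
  rw [show a + b / s = (a * s + b) / s by field_simp, le_div_iff₀ hs, mul_comm]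
  exact h4

lemma norm_iteratedFDeriv_convolution_le_of_holder [CompleteSpace F]
    (hκ : ContDiff ℝ (k + 1 : ℕ) κ) (hi : ∀ j ≤ k + 1, Integrable (iteratedFDeriv ℝ j κ))
    (hu : Continuous u) (hC : ∀ x, ‖u x‖ ≤ C)
    {σ c : ℝ} (hσ : 0 < σ) (hc : 0 ≤ c) (hh : ∀ x y, ‖u x - u y‖ ≤ c * ‖x - y‖ ^ σ) {s : ℝ}
    (hs : 0 < s) (x : E d) :
    ‖iteratedFDeriv ℝ (k + 1) (κ ⋆[B, volume] u) x‖ ≤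
      ‖B‖ * (∫ y, ‖iteratedFDeriv ℝ (k + 1) κ y‖) * (c * s ^ σ) +
        ‖B‖ * (∫ y, ‖iteratedFDeriv ℝ k κ y‖) * (c * s ^ σ) / s := by
  have hκ1 : ContDiff ℝ 1 κ := hκ.of_le (by exact_mod_cast Nat.le_add_left 1 k)
  have hi0 := integrable_of_iteratedFDeriv_zero (hi 0 (by omega)) hκ.continuous
  have hi1 := integrable_fderiv_of_iteratedFDeriv_one (hi 1 (by omega)) hκ1
  induction k generalizing G H with
  | zero =>
    simpa using norm_fderiv_convolution_le_of_holder (B := B) hκ1 hi0 hi1 hu hC hσ hc hh hs x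
  | succ k ih =>
    have hκ' : ContDiff ℝ (k + 1 : ℕ) (fderiv ℝ κ) := hκ.fderiv_right (by push_cast; exact le_rfl)
    have hκ1' : ContDiff ℝ 1 (fderiv ℝ κ) := hκ'.of_le (by exact_mod_cast Nat.le_add_left 1 k)
    have hi' := integrable_fderiv_of_iteratedFDeriv hi hκ
    rw [← norm_iteratedFDeriv_fderiv, fderiv_convolution hκ1 hi0 hi1 hu hC]
    refine (ih hκ' hi' hκ1' hi1 (integrable_fderiv_of_iteratedFDeriv_one (hi' 1 (by omega))
      hκ1')).trans ?_
    simp_rw [norm_iteratedFDeriv_fderiv]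
    have := ContinuousLinearMap.norm_precompL_le (E d) B
    gcongr

end smoothing

end

section

variable {d : ℕ}

/-! ### The convolution semigroup of a heat kernel -/

/-- The measures `K(t,x) dx`, `t > 0`, and the Dirac mass at the origin for `t ≤ 0`. -/
def heatMeasure (K : ℝ → E d → ℝ) (t : ℝ) : Measure (E d) :=
  if 0 < t then volume.withDensity fun x => ENNReal.ofReal (K t x) else Measure.dirac 0

lemma heatMeasure_zero (K : ℝ → E d → ℝ) : heatMeasure K 0 = Measure.dirac 0 := by
  simp [heatMeasure]

namespace LevyTriplet.IsSmoothHeatKernel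

variable {L : LevyTriplet d} {K : ℝ → E d → ℝ} {t : ℝ}

lemma contDiff (hK : L.IsSmoothHeatKernel K) (ht : 0 < t) : ContDiff ℝ ∞ (K t) := (hK t ht).1

lemma nonneg (hK : L.IsSmoothHeatKernel K) (ht : 0 < t) (x : E d) : 0 ≤ K t x := (hK t ht).2.1 x

lemma integrable (hK : L.IsSmoothHeatKernel K) (ht : 0 < t) : Integrable (K t) := (hK t ht).2.2.1

lemma isProbabilityMeasure (hK : L.IsSmoothHeatKernel K) (t : ℝ) :
    IsProbabilityMeasure (heatMeasure K t) := by
  unfold heatMeasure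
  split_ifs with ht
  · refine ⟨?_⟩
    rw [withDensity_apply _ MeasurableSet.univ, Measure.restrict_univ,
      ← ofReal_integral_eq_lintegral_ofReal (hK.integrable ht) (ae_of_all _ (hK.nonneg ht)),
      (hK t ht).2.2.2.1, ENNReal.ofReal_one]
  · infer_instance

lemma integral_heatMeasure {F : Type} [NormedAddCommGroup F] [NormedSpace ℝ F]
    (hK : L.IsSmoothHeatKernel K) (ht : 0 < t) (u : E d → F) :
    ∫ y, u y ∂(heatMeasure K t) = ∫ y, K t y • u y := by
  unfold heatMeasure
  rw [if_pos ht, integral_withDensity_eq_integral_toReal_smul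
    (hK.contDiff ht).continuous.measurable.ennreal_ofReal (ae_of_all _ fun _ => ENNReal.ofReal_lt_top)]
  simp_rw [ENNReal.toReal_ofReal (hK.nonneg ht _)]

lemma charFun_heatMeasure (hK : L.IsSmoothHeatKernel K) (ht : 0 ≤ t) (ξ : E d) :
    charFun (heatMeasure K t) (-ξ) = Complex.exp (-(t : ℂ) * L.symbol ξ) := by
  rcases ht.eq_or_lt with rfl | ht
  · simp [heatMeasure_zero]
  · rw [charFun_apply, hK.integral_heatMeasure ht, ← (hK t ht).2.2.2.2 ξ]
    refine integral_congr_ae (ae_of_all _ fun x => ?_)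
    simp only [Complex.real_smul]
    congr 2
    rw [inner_neg_right, real_inner_comm]
    push_cast
    ring

/-- The characteristic functions `e^{-tΨ}` multiply, and a finite measure is determined by its
characteristic function. Time `0` is included because the Dirac mass has characteristic function
one. -/
lemma heatMeasure_conv (hK : L.IsSmoothHeatKernel K) {s : ℝ} (hs : 0 ≤ s) (ht : 0 ≤ t) :
    (heatMeasure K s).conv (heatMeasure K t) = heatMeasure K (s + t) := by
  have := hK.isProbabilityMeasure
  refine Measure.ext_of_charFun (funext fun ξ => ?_)
  rw [charFun_conv, ← neg_neg ξ, hK.charFun_heatMeasure hs, hK.charFun_heatMeasure ht,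
    hK.charFun_heatMeasure (add_nonneg hs ht), ← Complex.exp_add]
  congr 1
  push_cast
  ring

lemma avg_avg {F : Type} [NormedAddCommGroup F] [NormedSpace ℝ F]
    (hK : L.IsSmoothHeatKernel K) {s : ℝ} (hs : 0 ≤ s) (ht : 0 ≤ t) {u : E d → F}
    (hu : Continuous u) {C : ℝ} (hC : ∀ x, ‖u x‖ ≤ C) :
    avg (heatMeasure K s) (avg (heatMeasure K t) u) = avg (heatMeasure K (s + t)) u := by
  have := hK.isProbabilityMeasure
  rw [← hK.heatMeasure_conv hs ht, avg_conv hu hC]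

lemma avg_eq_convolution {F : Type} [NormedAddCommGroup F] [NormedSpace ℝ F]
    (hK : L.IsSmoothHeatKernel K) (ht : 0 < t) (u : E d → F) :
    avg (heatMeasure K t) u = convolution (K t) u (ContinuousLinearMap.lsmul ℝ ℝ) volume := by
  funext x
  unfold avg
  rw [hK.integral_heatMeasure ht]
  rfl

/-- The characteristic functions depend continuously on `t`, so Lévy's continuity theorem gives weak
convergence of the heat measures, also at `t = 0`, where the limit is the Dirac mass. -/
lemma continuousOn_avg (hK : L.IsSmoothHeatKernel K) {u : E d → ℝ}
    (hu : Continuous u) {C : ℝ} (hC : ∀ x, ‖u x‖ ≤ C) (x : E d) :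
    ContinuousOn (fun t => avg (heatMeasure K t) u x) (Ici 0) := by
  have hp := hK.isProbabilityMeasure
  rw [continuousOn_iff_continuous_domRestrict, continuous_iff_seqContinuous]
  intro s t hst
  let μ : Ici (0 : ℝ) → ProbabilityMeasure (E d) := fun r => ⟨heatMeasure K r, hp r⟩
  have h1 : Tendsto (fun n => μ (s n)) atTop (𝓝 (μ t)) := by
    refine ProbabilityMeasure.tendsto_of_tendsto_charFun fun ξ => ?_
    have h2 : ∀ r : Ici (0 : ℝ), charFun (μ r : Measure (E d)) ξ =
        Complex.exp (-((r : ℝ) : ℂ) * L.symbol (-ξ)) := fun r => by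
      rw [← hK.charFun_heatMeasure r.2, neg_neg]; rfl
    simp_rw [h2]
    have h3 : Continuous fun r : Ici (0 : ℝ) => Complex.exp (-((r : ℝ) : ℂ) * L.symbol (-ξ)) := by
      fun_prop
    exact (h3.tendsto t).comp hst
  rw [ProbabilityMeasure.tendsto_iff_forall_integral_tendsto] at h1
  exact h1 (BoundedContinuousFunction.ofNormedAddCommGroup (fun y => u (x - y))
    (hu.comp (by fun_prop)) C fun y => hC _)

end LevyTriplet.IsSmoothHeatKernel

/-! ### The Lévy operator on `C²_b` -/

lemma CB.sub {F : Type} [NormedAddCommGroup F] [NormedSpace ℝ F] {k : ℕ} {u v : E d → F}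
    (hu : CB k u) (hv : CB k v) : CB k (u - v) := by
  refine ⟨hu.1.sub hv.1, fun j hj => ?_⟩
  obtain ⟨c, hc⟩ := hu.2 j hj
  obtain ⟨c', hc'⟩ := hv.2 j hj
  refine ⟨c + c', fun x => ?_⟩
  rw [iteratedFDeriv_sub_apply (hu.1.of_le (by exact_mod_cast hj)).contDiffAt
    (hv.1.of_le (by exact_mod_cast hj)).contDiffAt]
  exact (norm_sub_le _ _).trans (add_le_add (hc x) (hc' x))

namespace LevyTriplet

/-- The integrand of the nonlocal part of the Lévy operator. -/
def jump (u : E d → ℝ) (x z : E d) : ℝ :=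
  u (x + z) - u x - (Metric.ball 0 1).indicator (fun z => fderiv ℝ u x z) z

lemma integrable_min (L : LevyTriplet d) : Integrable (fun z => min 1 (‖z‖ ^ 2)) L.ν := by
  refine ⟨(by fun_prop), ?_⟩
  rw [hasFiniteIntegral_iff_ofReal (ae_of_all _ fun z => by positivity)]
  exact L.lintegral_lt_top

variable {u v : E d → ℝ} {c : ℝ}

lemma norm_fderiv_sub_le (hu : CB 2 u) (h2 : ∀ x, ‖iteratedFDeriv ℝ 2 u x‖ ≤ c) (x y : E d) :
    ‖fderiv ℝ u y - fderiv ℝ u x‖ ≤ c * ‖y - x‖ := by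
  refine Convex.norm_image_sub_le_of_norm_fderiv_le (𝕜 := ℝ) (s := univ) (fun z _ => ?_)
    (fun z _ => ?_) convex_univ (mem_univ x) (mem_univ y)
  · exact (CB.fderiv (k := 1) hu).differentiable z
  · have := h2 z
    rwa [← norm_iteratedFDeriv_fderiv, norm_iteratedFDeriv_one] at this

/-- For `|z| < 1` the jump is a first-order Taylor remainder, controlled by the second derivative;
for larger `z` the indicator vanishes and the sup bound on `u` suffices. -/
lemma abs_jump_le (hu : CB 2 u) (h0 : ∀ x, ‖u x‖ ≤ c) (h2 : ∀ x, ‖iteratedFDeriv ℝ 2 u x‖ ≤ c)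
    (x z : E d) : |jump u x z| ≤ 2 * c * min 1 (‖z‖ ^ 2) := by
  have hc : 0 ≤ c := (norm_nonneg _).trans (h0 0)
  unfold jump
  by_cases hz : z ∈ Metric.ball (0 : E d) 1
  · rw [indicator_of_mem hz]
    rw [mem_ball_zero_iff] at hz
    rw [min_eq_right (by nlinarith [norm_nonneg z])]
    have h := (convex_closedBall x ‖z‖).norm_image_sub_le_of_norm_fderiv_le' (𝕜 := ℝ)
      (f := u) (φ := fderiv ℝ u x) (C := c * ‖z‖)
      (fun y _ => (hu.of_le (l := 1) (by omega)).differentiable (k := 0) y) (fun y hy => ?_)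
      (Metric.mem_closedBall_self (norm_nonneg z)) (y := x + z) (by simp)
    · rw [add_sub_cancel_left, Real.norm_eq_abs] at h
      nlinarith [mul_nonneg hc (sq_nonneg ‖z‖)]
    · refine (norm_fderiv_sub_le hu h2 x y).trans ?_
      gcongr
      rwa [← mem_closedBall_iff_norm]
  · rw [indicator_of_notMem hz, sub_zero]
    rw [mem_ball_zero_iff, not_lt] at hz
    rw [min_eq_left (by nlinarith), mul_one]
    have h3 := h0 (x + z)
    have h4 := h0 x
    rw [Real.norm_eq_abs] at h3 h4
    exact (abs_sub _ _).trans (by linarith)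

lemma measurable_jump (hu : CB 1 u) (x : E d) : Measurable (jump u x) := by
  have h1 := hu.continuous
  refine Measurable.sub (Continuous.measurable (by fun_prop)) ?_
  exact (fderiv ℝ u x).continuous.measurable.indicator Metric.isOpen_ball.measurableSet

lemma integrable_jump (L : LevyTriplet d) (hu : CB 2 u) (x : E d) :
    Integrable (jump u x) L.ν := by
  obtain ⟨c0, h0⟩ := hu.bounded
  obtain ⟨c2, h2⟩ := hu.2 2 le_rfl
  refine (L.integrable_min.const_mul (2 * max c0 c2)).mono'
    (measurable_jump (hu.of_le (by omega)) x).aestronglyMeasurable (ae_of_all _ fun z => ?_)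
  exact abs_jump_le hu (fun x => (h0 x).trans (le_max_left _ _))
    (fun x => (h2 x).trans (le_max_right _ _)) x z

lemma pd_pd (hu : CB 2 u) (i : Fin d) (a : Fin d → ℝ) (x : E d) :
    pd i (fun y => ∑ j, a j * pd j u y) x = ∑ j, a j *
      fderiv ℝ (fderiv ℝ u) x (EuclideanSpace.single i 1) (EuclideanSpace.single j 1) := by
  have hd : HasFDerivAt (fderiv ℝ u) (fderiv ℝ (fderiv ℝ u) x) x :=
    ((CB.fderiv (k := 1) hu).differentiable x).hasFDerivAt
  have h1 : ∀ j, HasFDerivAt (pd j u)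
      ((fderiv ℝ (fderiv ℝ u) x).flip (EuclideanSpace.single j 1)) x := fun j => by
    have := hd.clm_apply (hasFDerivAt_const (EuclideanSpace.single j (1 : ℝ)) x)
    rw [ContinuousLinearMap.comp_zero, zero_add] at this
    exact this
  have h2 : HasFDerivAt (fun y => ∑ j, a j * pd j u y)
      (∑ j, a j • (fderiv ℝ (fderiv ℝ u) x).flip (EuclideanSpace.single j 1)) x :=
    HasFDerivAt.fun_sum fun j _ => (h1 j).const_mul (a j)
  change fderiv ℝ (fun y => ∑ j, a j * pd j u y) x _ = _
  rw [h2.fderiv]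
  simp

lemma op_eq (L : LevyTriplet d) (hu : CB 2 u) (x : E d) :
    L.op u x = fderiv ℝ u x L.B + (∑ i, ∑ j, L.A i j *
      fderiv ℝ (fderiv ℝ u) x (EuclideanSpace.single i 1) (EuclideanSpace.single j 1)) +
      ∫ z, jump u x z ∂L.ν := by
  simp_rw [op, pd_pd hu]
  rfl

lemma op_sub (L : LevyTriplet d) (hu : CB 2 u) (hv : CB 2 v) (x : E d) :
    L.op (u - v) x = L.op u x - L.op v x := by
  have hu1 := (hu.of_le (l := 1) (by omega)).differentiable (k := 0)
  have hv1 := (hv.of_le (l := 1) (by omega)).differentiable (k := 0)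
  have h1 : fderiv ℝ (u - v) = fderiv ℝ u - fderiv ℝ v := funext fun y => fderiv_sub (hu1 y) (hv1 y)
  have h2 : fderiv ℝ (fderiv ℝ u - fderiv ℝ v) x = fderiv ℝ (fderiv ℝ u) x -
      fderiv ℝ (fderiv ℝ v) x := fderiv_sub ((CB.fderiv (k := 1) hu).differentiable x)
        ((CB.fderiv (k := 1) hv).differentiable x)
  have h3 : jump (u - v) x = fun z => jump u x z - jump v x z := by
    funext z
    simp only [jump, h1]
    by_cases hz : z ∈ Metric.ball (0 : E d) 1
    · simp [hz]; ring
    · simp [hz]; ring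
  rw [L.op_eq (hu.sub hv), L.op_eq hu, L.op_eq hv, h3, h1, h2,
    integral_sub (L.integrable_jump hu x) (L.integrable_jump hv x)]
  simp [mul_sub, Finset.sum_sub_distrib]
  ring

/-- A bound for the Lévy operator as an operator from `C²_b` to `C_b`. -/
def opBound (L : LevyTriplet d) : ℝ :=
  ‖L.B‖ + (∑ i, ∑ j, |L.A i j|) + 2 * ∫ z, min 1 (‖z‖ ^ 2) ∂L.ν

lemma opBound_nonneg (L : LevyTriplet d) : 0 ≤ L.opBound := by
  have : 0 ≤ ∫ z, min 1 (‖z‖ ^ 2) ∂L.ν := integral_nonneg fun z => by positivity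
  unfold opBound
  positivity

lemma abs_op_le (L : LevyTriplet d) (hu : CB 2 u)
    (hc : ∀ j ≤ 2, ∀ x, ‖iteratedFDeriv ℝ j u x‖ ≤ c) (x : E d) : |L.op u x| ≤ L.opBound * c := by
  have hc0 : 0 ≤ c := (norm_nonneg _).trans (hc 0 (by omega) 0)
  rw [L.op_eq hu]
  unfold opBound
  rw [add_mul, add_mul]
  refine (abs_add_le _ _).trans (add_le_add ((abs_add_le _ _).trans (add_le_add ?_ ?_)) ?_)
  · have := hc 1 (by omega) x
    rw [norm_iteratedFDeriv_one] at this
    rw [mul_comm]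
    exact ((fderiv ℝ u x).le_opNorm L.B).trans (by gcongr)
  · have h2 := hc 2 le_rfl x
    rw [← norm_iteratedFDeriv_fderiv, norm_iteratedFDeriv_one] at h2
    rw [Finset.sum_mul]
    refine (Finset.abs_sum_le_sum_abs _ _).trans (Finset.sum_le_sum fun i _ => ?_)
    rw [Finset.sum_mul]
    refine (Finset.abs_sum_le_sum_abs _ _).trans (Finset.sum_le_sum fun j _ => ?_)
    rw [abs_mul]
    gcongr
    refine (ContinuousLinearMap.le_opNorm₂ (fderiv ℝ (fderiv ℝ u) x) _ _).trans ?_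
    simpa using h2
  · have h := norm_integral_le_of_norm_le (μ := L.ν) (f := jump u x)
      (L.integrable_min.const_mul (2 * c)) (ae_of_all _ fun z => abs_jump_le hu (fun x => by simpa using hc 0 (by omega) x)
        (hc 2 le_rfl) x z)
    rw [Real.norm_eq_abs, integral_const_mul] at h
    linarith

end LevyTriplet

end

/-! ### The Kolmogorov equation under bounded pointwise convergence -/

section

variable {d : ℕ}

/-- Bounded pointwise convergence of the derivatives of order at most two. -/
structure BPTendsto (u : ℕ → E d → ℝ) (v : E d → ℝ) (c : ℝ) : Prop where
  cb : ∀ m, CB 2 (u m)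
  cb_lim : CB 2 v
  bound : ∀ m, ∀ j ≤ 2, ∀ x, ‖iteratedFDeriv ℝ j (u m) x‖ ≤ c
  tendsto : ∀ j ≤ 2, ∀ x w, Tendsto (fun m => iteratedFDeriv ℝ j (u m) x w) atTop
    (𝓝 (iteratedFDeriv ℝ j v x w))

namespace BPTendsto

variable {u : ℕ → E d → ℝ} {v : E d → ℝ} {c : ℝ}

lemma tendsto_zero (h : BPTendsto u v c) (x : E d) : Tendsto (fun m => u m x) atTop (𝓝 (v x)) := by
  simpa using h.tendsto 0 (by omega) x ![]

lemma tendsto_fderiv (h : BPTendsto u v c) (x w : E d) :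
    Tendsto (fun m => fderiv ℝ (u m) x w) atTop (𝓝 (fderiv ℝ v x w)) := by
  simpa using h.tendsto 1 (by omega) x ![w]

lemma tendsto_fderiv_fderiv (h : BPTendsto u v c) (x w w' : E d) :
    Tendsto (fun m => fderiv ℝ (fderiv ℝ (u m)) x w w') atTop
      (𝓝 (fderiv ℝ (fderiv ℝ v) x w w')) := by
  simpa [iteratedFDeriv_two_apply] using h.tendsto 2 le_rfl x ![w, w']

lemma abs_le (h : BPTendsto u v c) (m : ℕ) (x : E d) : ‖u m x‖ ≤ c := by
  simpa using h.bound m 0 (by omega) x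

lemma tendsto_op (h : BPTendsto u v c) (L : LevyTriplet d) (x : E d) :
    Tendsto (fun m => L.op (u m) x) atTop (𝓝 (L.op v x)) := by
  simp_rw [fun m => L.op_eq (h.cb m)]
  rw [L.op_eq h.cb_lim]
  refine ((h.tendsto_fderiv x _).add (tendsto_finsetSum _ fun i _ => tendsto_finsetSum _
    fun j _ => (h.tendsto_fderiv_fderiv x _ _).const_mul _)).add ?_
  refine tendsto_integral_of_dominated_convergence (fun z => 2 * c * min 1 (‖z‖ ^ 2)) (fun m => ?_)
    (L.integrable_min.const_mul _) (fun m => ae_of_all _ fun z => ?_) (ae_of_all _ fun z => ?_)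
  · exact (LevyTriplet.measurable_jump ((h.cb m).of_le (by omega)) x).aestronglyMeasurable
  · exact LevyTriplet.abs_jump_le (h.cb m) (h.abs_le m) (h.bound m 2 le_rfl) x z
  · refine ((h.tendsto_zero (x + z)).sub (h.tendsto_zero x)).sub ?_
    by_cases hz : z ∈ Metric.ball (0 : E d) 1
    · simpa [hz] using h.tendsto_fderiv x z
    · simp [hz]

lemma tendsto_avg (h : BPTendsto u v c) (μ : Measure (E d)) [IsFiniteMeasure μ] (x : E d) :
    Tendsto (fun m => avg μ (u m) x) atTop (𝓝 (avg μ v x)) := by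
  refine tendsto_integral_of_dominated_convergence (fun _ => c) (fun m => ?_)
    (integrable_const _) (fun m => ae_of_all _ fun z => ?_) (ae_of_all _ fun z => ?_)
  · exact ((h.cb m).continuous.comp (by fun_prop)).aestronglyMeasurable
  · exact h.abs_le m _
  · exact h.tendsto_zero _

end BPTendsto

namespace LevyTriplet

variable {u : E d → ℝ} {L : LevyTriplet d} {K : ℝ → E d → ℝ}

lemma exists_common_bound {F : Type} [NormedAddCommGroup F] [NormedSpace ℝ F] {u : E d → F}
    {k : ℕ} (hu : CB k u) :
    ∃ c : ℝ, 0 ≤ c ∧ ∀ j ≤ k, ∀ x, ‖iteratedFDeriv ℝ j u x‖ ≤ c := by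
  choose! C hC using hu.2
  have h0 : ∀ j ≤ k, 0 ≤ C j := fun j hj => (norm_nonneg _).trans (hC j hj 0)
  refine ⟨∑ j ∈ Finset.range (k + 1), C j, Finset.sum_nonneg fun j hj =>
    h0 j (Nat.le_of_lt_succ (Finset.mem_range.1 hj)), fun j hj x => (hC j hj x).trans ?_⟩
  exact Finset.single_le_sum (f := C) (fun j hj => h0 j (Nat.le_of_lt_succ (Finset.mem_range.1 hj)))
    (Finset.mem_range.2 (Nat.lt_succ_of_le hj))

lemma op_comp_add_left (x : E d) :
    L.op (fun z => u (x + z)) 0 = L.op u x := by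
  have h1 : ∀ f : E d → ℝ, fderiv ℝ (fun z => f (x + z)) 0 = fderiv ℝ f x := fun f => by
    rw [fderiv_comp_add_left, add_zero]
  have h2 : ∀ i, pd i (fun z => u (x + z)) = fun y => pd i u (x + y) := fun i => funext fun y => by
    simp only [pd, fderiv_comp_add_left]
  have h3 : ∀ (i : Fin d) (f : E d → ℝ), pd i (fun z => f (x + z)) 0 = pd i f x := fun i f => by
    simp only [pd, h1]
  simp only [op, h1, h2, add_zero, zero_add]
  simp only [fun i => h3 i fun y => ∑ j, L.A i j * pd j u y]

lemma cb_comp_add_left (hu : CB 2 u) (x : E d) : CB 2 fun z => u (x + z) := by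
  refine ⟨hu.1.comp (contDiff_const.add contDiff_id), fun j hj => ?_⟩
  obtain ⟨c, hc⟩ := hu.2 j hj
  refine ⟨c, fun y => ?_⟩
  rw [iteratedFDeriv_comp_add_left]
  exact hc _

/-- By translation invariance `𝓛u(x)` is `𝓛` of the translate `u(x + ·)` evaluated at `0`, and
translates along a convergent sequence converge in the bounded pointwise sense, for which `𝓛` is
continuous. -/
lemma continuous_op (hu : CB 2 u) : Continuous (L.op u) := by
  obtain ⟨c, hc0, hc⟩ := exists_common_bound hu
  rw [continuous_iff_seqContinuous]
  intro x x₀ hx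
  have hop : L.op u = fun y => L.op (fun z => u (y + z)) 0 := funext fun y =>
    (op_comp_add_left y).symm
  rw [hop]
  refine BPTendsto.tendsto_op (c := c) ⟨fun m => cb_comp_add_left hu _, cb_comp_add_left hu _,
    fun m j hj y => ?_, fun j hj y w => ?_⟩ L 0
  · rw [iteratedFDeriv_comp_add_left]; exact hc j hj _
  · simp_rw [iteratedFDeriv_comp_add_left]
    have h1 := (hu.1.continuous_iteratedFDeriv (m := j) (by exact_mod_cast hj)).eval_const w
    exact (h1.tendsto _).comp (hx.add_const y)

/-- The Kolmogorov equation `P_t u - u = ∫_0^t P_r 𝓛u dr`. -/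
def Kolmogorov (L : LevyTriplet d) (K : ℝ → E d → ℝ) (u : E d → ℝ) : Prop :=
  ∀ t ≥ 0, ∀ x, avg (heatMeasure K t) u x - u x = ∫ r in 0..t, avg (heatMeasure K r) (L.op u) x

lemma exists_op_bound (L : LevyTriplet d) (hu : CB 2 u) : ∃ C : ℝ, ∀ x, ‖L.op u x‖ ≤ C := by
  obtain ⟨c, hc0, hc⟩ := exists_common_bound hu
  exact ⟨_, L.abs_op_le hu hc⟩

lemma continuousOn_avg_op (hK : L.IsSmoothHeatKernel K) (hu : CB 2 u) (x : E d) :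
    ContinuousOn (fun t => avg (heatMeasure K t) (L.op u) x) (Ici 0) := by
  obtain ⟨C, hC⟩ := exists_op_bound L hu
  exact hK.continuousOn_avg (continuous_op hu) hC x

/-- Every term passes to the limit by dominated convergence, with bounds uniform in the sequence.
This replaces density in norm, which fails for functions with compact support in `C²_b`. -/
lemma Kolmogorov.of_tendsto (hK : L.IsSmoothHeatKernel K) {u : ℕ → E d → ℝ} {v : E d → ℝ} {c : ℝ}
    (h : BPTendsto u v c) (hu : ∀ m, L.Kolmogorov K (u m)) : L.Kolmogorov K v := by
  intro t ht x
  have hp := hK.isProbabilityMeasure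
  have h1 : Tendsto (fun m => avg (heatMeasure K t) (u m) x - u m x) atTop
      (𝓝 (avg (heatMeasure K t) v x - v x)) := (h.tendsto_avg _ x).sub (h.tendsto_zero x)
  refine tendsto_nhds_unique h1 ?_
  simp_rw [fun m => hu m t ht x]
  refine intervalIntegral.tendsto_integral_filter_of_dominated_convergence
    (fun _ => L.opBound * c) ?_ ?_ ?_ ?_
  · refine Eventually.of_forall fun m => ContinuousOn.aestronglyMeasurable ?_ measurableSet_uIoc
    refine (continuousOn_avg_op hK (h.cb m) x).mono ?_
    rw [uIoc_of_le ht]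
    exact fun r hr => hr.1.le
  · refine Eventually.of_forall fun m => ae_of_all _ fun r _ => ?_
    exact norm_avg_le (fun y => L.abs_op_le (h.cb m) (h.bound m) y) x
  · exact intervalIntegrable_const
  · refine ae_of_all _ fun r _ => ?_
    refine tendsto_integral_of_dominated_convergence (fun _ => L.opBound * c) (fun m => ?_)
      (integrable_const _) (fun m => ae_of_all _ fun y => ?_) (ae_of_all _ fun y => ?_)
    · exact ((continuous_op (h.cb m)).comp (by fun_prop)).aestronglyMeasurable
    · exact L.abs_op_le (h.cb m) (h.bound m) _
    · exact h.tendsto_op L _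

/-- Truncation by smooth cut-offs of growing radius: the derivatives of the products stay bounded by
the Leibniz rule, and near each point the product eventually coincides with `u`. -/
lemma Kolmogorov.of_contDiff (hK : L.IsSmoothHeatKernel K)
    (hL : ∀ f : E d → ℝ, HasCompactSupport f → ContDiff ℝ ∞ f → L.Kolmogorov K f)
    (hu : CB 2 u) (hs : ContDiff ℝ ∞ u) : L.Kolmogorov K u := by
  obtain ⟨c, hc0, hc⟩ := exists_common_bound hu
  choose C hC using exists_iteratedFDeriv_cutoff_le d
  have hC0 : ∀ j, 0 ≤ C j := fun j => by
    have := (norm_nonneg _).trans (hC j 1 le_rfl 0)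
    simpa using this
  have hC' : ∀ j (m : ℕ) (x : E d), ‖iteratedFDeriv ℝ j (cutoff ((m : ℝ) + 1)) x‖ ≤ C j := by
    intro j m x
    have h1 : (1 : ℝ) ≤ (m : ℝ) + 1 := by
      have : (0 : ℝ) ≤ m := Nat.cast_nonneg m
      linarith
    exact (hC j _ h1 x).trans (div_le_self (hC0 j) (one_le_pow₀ h1))
  have hcs : ∀ m : ℕ, ContDiff ℝ ∞ (fun x : E d => cutoff ((m : ℝ) + 1) x * u x) := fun m =>
    (contDiff_cutoff _).mul hs
  have hb : ∀ m : ℕ, ∀ j ≤ 2, ∀ x, ‖iteratedFDeriv ℝ j (fun x => cutoff ((m : ℝ) + 1) x * u x) x‖ ≤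
      ∑ j ∈ Finset.range 3, ∑ i ∈ Finset.range (j + 1), (j.choose i : ℝ) * C i * c := by
    intro m j hj x
    refine (norm_iteratedFDeriv_mul_le (N := j) ((contDiff_cutoff _).of_le (by exact_mod_cast le_top))
      (hs.of_le (by exact_mod_cast le_top)) x le_rfl).trans ?_
    refine (Finset.sum_le_sum (g := fun i => (j.choose i : ℝ) * C i * c) fun i _ => ?_).trans ?_
    · have := hC0 i
      gcongr
      · exact hC' i m x
      · exact hc _ (by omega) x
    · exact Finset.single_le_sum
        (f := fun j => ∑ i ∈ Finset.range (j + 1), (j.choose i : ℝ) * C i * c)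
        (fun j _ => Finset.sum_nonneg fun i _ => by have := hC0 i; positivity)
        (Finset.mem_range.2 (by omega))
  refine Kolmogorov.of_tendsto hK (u := fun (m : ℕ) x => cutoff ((m : ℝ) + 1) x * u x)
    ⟨fun m => ⟨contDiff_infty.1 (hcs m) 2, fun j hj => ⟨_, hb m j hj⟩⟩, hu, hb,
      fun j hj x w => ?_⟩ fun m => hL _ (hasCompactSupport_cutoff (by positivity)).mul_right (hcs m)
  refine tendsto_const_nhds.congr' ?_
  filter_upwards [(tendsto_add_atTop_nat 1).eventually (cutoff_eventuallyEq_one x)] with m hm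
  have : (fun x => cutoff ((m : ℝ) + 1) x * u x) =ᶠ[𝓝 x] u := by
    filter_upwards [hm] with y hy
    push_cast at hy
    rw [hy, one_mul]
  rw [this.iteratedFDeriv ℝ j |>.eq_of_nhds]

/-- The heat flow itself serves as mollifier: at the times `T / (m + 1)` it makes `u` smooth without
increasing the bounds of its derivatives, which converge pointwise to those of `u` by continuity of
the flow at time `0`. -/
lemma Kolmogorov.of_cb (hK : L.IsSmoothHeatKernel K) {T : ℝ} (hT : 0 < T)
    (hi : ∀ m, ∀ t ∈ Ioc 0 T, Integrable (iteratedFDeriv ℝ m (K t)))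
    (hL : ∀ f : E d → ℝ, HasCompactSupport f → ContDiff ℝ ∞ f → L.Kolmogorov K f)
    (hu : CB 2 u) : L.Kolmogorov K u := by
  obtain ⟨c, hc0, hc⟩ := exists_common_bound hu
  have hp := hK.isProbabilityMeasure
  let t : ℕ → ℝ := fun m => T / (m + 1)
  have ht : ∀ m, t m ∈ Ioc 0 T := fun m => ⟨by positivity, div_le_self hT.le (by simp)⟩
  have hlim : Tendsto t atTop (𝓝[Ici 0] 0) :=
    tendsto_nhdsWithin_iff.2 ⟨tendsto_const_div_atTop_nhds_zero_nat T |>.comp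
      (tendsto_add_atTop_nat 1) |>.congr fun m => by simp [t], Eventually.of_forall fun m => (ht m).1.le⟩
  refine Kolmogorov.of_tendsto hK (u := fun m => avg (heatMeasure K (t m)) u) (c := c)
    ⟨fun m => hu.avg, hu, fun m j hj x => norm_iteratedFDeriv_avg_le (hu.of_le hj) (hc j hj) x,
      fun j hj x w => ?_⟩ fun m => Kolmogorov.of_contDiff hK hL hu.avg ?_
  · simp_rw [fun m => iteratedFDeriv_avg_apply (μ := heatMeasure K (t m)) (hu.of_le hj) x w]
    have h1 := hK.continuousOn_avg (u := fun z => iteratedFDeriv ℝ j u z w)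
      (C := c * ∏ i, ‖w i‖)
      ((hu.1.continuous_iteratedFDeriv (m := j) (by exact_mod_cast hj)).eval_const w)
      (fun z => (ContinuousMultilinearMap.le_opNorm _ _).trans (by gcongr; exact hc j hj z)) x
      0 self_mem_Ici
    have h2 := h1.tendsto.comp hlim
    simpa [Function.comp_def, heatMeasure_zero, avg_dirac_zero] using h2
  · rw [hK.avg_eq_convolution (ht m).1]
    refine contDiff_infty.2 fun k => contDiff_convolution_of_integrable (C := c)
      ((hK.contDiff (ht m).1).of_le (by exact_mod_cast le_top)) (fun j _ => hi j _ (ht m))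
      hu.continuous fun x => by simpa using hc 0 (by omega) x

end LevyTriplet

end

section

variable {d : ℕ}

namespace LevyTriplet

open scoped FourierTransform LineDeriv SchwartzMap

/-! ### The symbol -/

/-- The integrand of the nonlocal part of the symbol. -/
def symbolJump (ξ z : E d) : ℂ :=
  1 - Complex.exp (Complex.I * (inner ℝ ξ z : ℝ)) +
    (Metric.ball (0 : E d) 1).indicator (fun z => Complex.I * (inner ℝ ξ z : ℝ)) z

lemma norm_one_sub_exp_add_le (s : ℝ) :
    ‖1 - Complex.exp (Complex.I * s) + Complex.I * s‖ ≤ 3 * s ^ 2 := by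
  rw [show 1 - Complex.exp (Complex.I * s) + Complex.I * s =
    -(Complex.exp (Complex.I * s) - 1 - Complex.I * s) by ring, norm_neg]
  by_cases hs : |s| ≤ 1
  · have h := Complex.norm_exp_sub_one_sub_id_le (x := Complex.I * s) (by simpa using hs)
    simp only [norm_mul, Complex.norm_I, one_mul, Complex.norm_real, Real.norm_eq_abs, sq_abs] at h
    nlinarith [sq_nonneg s]
  · have h1 : ‖Complex.exp (Complex.I * s) - 1‖ ≤ |s| := Real.norm_exp_I_mul_ofReal_sub_one_le
    have h2 : ‖Complex.I * (s : ℂ)‖ = |s| := by simp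
    refine (norm_sub_le _ _).trans ?_
    rw [h2, ← sq_abs s]
    nlinarith

lemma norm_symbolJump_le (ξ z : E d) :
    ‖symbolJump ξ z‖ ≤ 3 * (1 + ‖ξ‖ ^ 2) * min 1 (‖z‖ ^ 2) := by
  unfold symbolJump
  by_cases hz : z ∈ Metric.ball (0 : E d) 1
  · rw [indicator_of_mem hz]
    rw [mem_ball_zero_iff] at hz
    rw [min_eq_right (by nlinarith [norm_nonneg z])]
    refine (norm_one_sub_exp_add_le _).trans ?_
    have h : (inner ℝ ξ z : ℝ) ^ 2 ≤ ‖ξ‖ ^ 2 * ‖z‖ ^ 2 := by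
      rw [← mul_pow, ← sq_abs]
      exact pow_le_pow_left₀ (abs_nonneg _) (abs_real_inner_le_norm ξ z) 2
    nlinarith [sq_nonneg ‖z‖]
  · rw [indicator_of_notMem hz, add_zero]
    rw [mem_ball_zero_iff, not_lt] at hz
    rw [min_eq_left (by nlinarith)]
    have h1 : ‖Complex.exp (Complex.I * (inner ℝ ξ z : ℝ))‖ = 1 :=
      Complex.norm_exp_I_mul_ofReal _
    refine (norm_sub_le _ _).trans ?_
    rw [h1, norm_one]
    nlinarith [sq_nonneg ‖ξ‖]

lemma measurable_symbolJump : Measurable fun p : E d × E d => symbolJump p.1 p.2 := by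
  have h1 : Continuous fun p : E d × E d => Complex.I * ((inner ℝ p.1 p.2 : ℝ) : ℂ) := by fun_prop
  have h2 : (fun p : E d × E d => symbolJump p.1 p.2) = fun p =>
      1 - Complex.exp (Complex.I * ((inner ℝ p.1 p.2 : ℝ) : ℂ)) +
        (Prod.snd ⁻¹' Metric.ball (0 : E d) 1).indicator
          (fun p : E d × E d => Complex.I * ((inner ℝ p.1 p.2 : ℝ) : ℂ)) p := by
    funext p
    simp [symbolJump, indicator]
  rw [h2]
  refine Measurable.add (by fun_prop) ?_
  exact h1.measurable.indicator (measurable_snd Metric.isOpen_ball.measurableSet)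

lemma symbol_eq (L : LevyTriplet d) (ξ : E d) :
    L.symbol ξ = -Complex.I * (inner ℝ L.B ξ : ℝ) + ((∑ i, ∑ j, ξ i * L.A i j * ξ j : ℝ) : ℂ) +
      ∫ z, symbolJump ξ z ∂L.ν := rfl

lemma continuous_integral_symbolJump (L : LevyTriplet d) :
    Continuous fun ξ : E d => ∫ z, symbolJump ξ z ∂L.ν := by
  refine continuous_iff_continuousAt.2 fun ξ => ?_
  refine continuousAt_of_dominated (bound := fun z => 3 * (1 + (‖ξ‖ + 1) ^ 2) * min 1 (‖z‖ ^ 2))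
    (Eventually.of_forall fun ζ => ?_) ?_ (L.integrable_min.const_mul _) (ae_of_all _ fun z => ?_)
  · exact (measurable_symbolJump.comp (measurable_prodMk_left)).aestronglyMeasurable
  · filter_upwards [Metric.ball_mem_nhds ξ one_pos] with ζ hζ
    refine ae_of_all _ fun z => (norm_symbolJump_le ζ z).trans ?_
    have : ‖ζ‖ ≤ ‖ξ‖ + 1 := by
      rw [mem_ball_iff_norm] at hζ
      have := norm_sub_norm_le ζ ξ
      linarith
    gcongr
  · unfold symbolJump
    by_cases hz : z ∈ Metric.ball (0 : E d) 1
    · simp only [hz, indicator_of_mem]; fun_prop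
    · simp only [hz, indicator_of_notMem, not_false_eq_true]; fun_prop

lemma continuous_symbol (L : LevyTriplet d) : Continuous L.symbol := by
  have h := L.continuous_integral_symbolJump
  have h2 : L.symbol = fun ξ => -Complex.I * (inner ℝ L.B ξ : ℝ) +
    ((∑ i, ∑ j, ξ i * L.A i j * ξ j : ℝ) : ℂ) + ∫ z, symbolJump ξ z ∂L.ν := rfl
  rw [h2]
  fun_prop

lemma norm_integral_symbolJump_le (L : LevyTriplet d) (ξ : E d) :
    ‖∫ z, symbolJump ξ z ∂L.ν‖ ≤ (3 * ∫ z, min 1 (‖z‖ ^ 2) ∂L.ν) * (1 + ‖ξ‖ ^ 2) := by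
  have h := norm_integral_le_of_norm_le (μ := L.ν) (f := symbolJump ξ)
    (L.integrable_min.const_mul (3 * (1 + ‖ξ‖ ^ 2))) (ae_of_all _ fun z => norm_symbolJump_le ξ z)
  rw [integral_const_mul] at h
  linarith

lemma exists_norm_symbol_le (L : LevyTriplet d) :
    ∃ C : ℝ, ∀ ξ, ‖L.symbol ξ‖ ≤ C * (1 + ‖ξ‖ ^ 2) := by
  refine ⟨‖L.B‖ + (∑ i, ∑ j, |L.A i j|) + 3 * ∫ z, min 1 (‖z‖ ^ 2) ∂L.ν, fun ξ => ?_⟩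
  rw [symbol_eq, add_mul, add_mul]
  have hξ : ‖ξ‖ ≤ 1 + ‖ξ‖ ^ 2 := by nlinarith [sq_nonneg (‖ξ‖ - 1), norm_nonneg ξ]
  have hi : ∀ i, |ξ i| ≤ ‖ξ‖ := fun i => by simpa using PiLp.norm_apply_le ξ i
  refine (norm_add_le _ _).trans (add_le_add ((norm_add_le _ _).trans (add_le_add ?_ ?_)) ?_)
  · rw [norm_mul, norm_neg, Complex.norm_I, one_mul, Complex.norm_real]
    refine (norm_inner_le_norm L.B ξ).trans ?_
    gcongr
  · rw [Complex.norm_real, Finset.sum_mul]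
    refine (norm_sum_le _ _).trans (Finset.sum_le_sum fun i _ => ?_)
    rw [Finset.sum_mul]
    refine (norm_sum_le _ _).trans (Finset.sum_le_sum fun j _ => ?_)
    rw [norm_mul, norm_mul, Real.norm_eq_abs, Real.norm_eq_abs, Real.norm_eq_abs, mul_comm |ξ i|,
      mul_assoc]
    gcongr
    have := mul_le_mul (hi i) (hi j) (abs_nonneg _) (norm_nonneg _)
    nlinarith
  · exact L.norm_integral_symbolJump_le ξ

/-! ### Fourier representation of smooth functions with compact support -/

/-- The inverse Fourier integral of `h` at `x`. -/
def invFourier (h : E d → ℂ) (x : E d) : ℂ :=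
  ∫ ξ, Complex.exp (Complex.I * (inner ℝ ((2 * Real.pi) • ξ) x : ℝ)) * h ξ

lemma norm_exp_inner_mul (ζ x : E d) (c : ℂ) :
    ‖Complex.exp (Complex.I * (inner ℝ ζ x : ℝ)) * c‖ = ‖c‖ := by
  rw [norm_mul, Complex.norm_exp_I_mul_ofReal, one_mul]

lemma integrable_exp_mul {h : E d → ℂ} (hh : Integrable h) (x : E d) :
    Integrable fun ξ => Complex.exp (Complex.I * (inner ℝ ((2 * Real.pi) • ξ) x : ℝ)) * h ξ := by
  refine hh.norm.mono' ((Continuous.aestronglyMeasurable (by fun_prop)).mul hh.aestronglyMeasurable)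
    (ae_of_all _ fun ξ => ?_)
  rw [norm_exp_inner_mul]

/-- The transform has the frequency normalisation `2π`; hence symbols are evaluated at `(2π) • ξ` in
all that follows. -/
lemma fourierInv_eq_invFourier (h : 𝓢(E d, ℂ)) (x : E d) : (𝓕⁻ h : 𝓢(E d, ℂ)) x = invFourier h x := by
  rw [SchwartzMap.fourierInv_coe, Real.fourierInv_eq']
  unfold invFourier
  refine integral_congr_ae (ae_of_all _ fun ξ => ?_)
  simp only [smul_eq_mul, inner_smul_left]
  congr 2
  simp only [conj_trivial]
  push_cast
  ring

lemma schwartz_eq_invFourier (f : 𝓢(E d, ℂ)) (x : E d) : f x = invFourier (𝓕 f : 𝓢(E d, ℂ)) x := by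
  rw [← fourierInv_eq_invFourier, FourierTransform.fourierInv_fourier_eq]

lemma fourier_lineDeriv_apply (f : 𝓢(E d, ℂ)) (w ξ : E d) :
    (𝓕 (∂_{w} f) : 𝓢(E d, ℂ)) ξ = Complex.I * (inner ℝ ((2 * Real.pi) • ξ) w : ℝ) * (𝓕 f : 𝓢(E d, ℂ)) ξ := by
  rw [SchwartzMap.fourier_lineDerivOp_eq]
  have : (inner ℝ · w : E d → ℝ).HasTemperateGrowth := ((innerSL ℝ).flip w).hasTemperateGrowth
  simp [this, inner_smul_left]
  ring

variable {f : E d → ℝ}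

/-- A real test function as a complex Schwartz function. -/
def toSchwartz (hf : HasCompactSupport f) (hs : ContDiff ℝ ∞ f) : 𝓢(E d, ℂ) :=
  HasCompactSupport.toSchwartzMap (f := fun x => (f x : ℂ))
    (hf.comp_left (g := fun r : ℝ => (r : ℂ)) Complex.ofReal_zero)
    (Complex.ofRealCLM.contDiff.comp hs)

lemma toSchwartz_apply (hf : HasCompactSupport f) (hs : ContDiff ℝ ∞ f) (x : E d) :
    toSchwartz hf hs x = f x := rfl

lemma lineDeriv_toSchwartz (hf : HasCompactSupport f) (hs : ContDiff ℝ ∞ f) (w : E d) :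
    ∂_{w} (toSchwartz hf hs) = toSchwartz (f := fun x => fderiv ℝ f x w)
      (hf.fderiv_apply ℝ w) ((hs.fderiv_right (m := ∞) (by simp)).clm_apply contDiff_const) := by
  ext x
  rw [SchwartzMap.lineDerivOp_apply_eq_fderiv]
  have h1 : HasFDerivAt f (fderiv ℝ f x) x := ((hs.differentiable (by simp)) x).hasFDerivAt
  have h2 := Complex.ofRealCLM.hasFDerivAt.comp x h1
  have h3 : HasFDerivAt (toSchwartz hf hs : E d → ℂ) (Complex.ofRealCLM.comp (fderiv ℝ f x)) x := h2
  rw [h3.fderiv]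
  rfl

end LevyTriplet

end

/-! ### The Lévy operator and its semigroup as Fourier multipliers -/

section

variable {d : ℕ}

namespace LevyTriplet

open scoped FourierTransform LineDeriv SchwartzMap

/-- The measure `ν` may be infinite near the origin, so Fubini's theorem is applied to the finite
measure `(1 ∧ |z|²) ν`, the integrand being divided by the weight. The weight vanishes only at `z =
0`; there the integrand vanishes too, so that a mass of `ν` at the origin is harmless. -/
lemma integral_levy_swap (L : LevyTriplet d) {φ : E d → E d → ℂ} {a : E d → ℝ} (ha : Integrable a)
    (hm : AEStronglyMeasurable (fun p : E d × E d => φ p.1 p.2) (volume.prod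
      (L.ν.withDensity fun z => ((min 1 (‖z‖₊ ^ 2) : ℝ≥0) : ℝ≥0∞))))
    (hφ : ∀ ξ z, ‖φ ξ z‖ ≤ a ξ * min 1 (‖z‖ ^ 2)) :
    ∫ z, (∫ ξ, φ ξ z) ∂L.ν = ∫ ξ, ∫ z, φ ξ z ∂L.ν := by
  set w : E d → ℝ≥0 := fun z => min 1 (‖z‖₊ ^ 2) with hw
  have hwm : Measurable w := by fun_prop
  have hwc : ∀ z, (w z : ℝ) = min 1 (‖z‖ ^ 2) := fun z => by simp [hw]
  set η := L.ν.withDensity fun z => (w z : ℝ≥0∞) with hη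
  have hfin : IsFiniteMeasure η := by
    refine isFiniteMeasure_withDensity (ne_of_lt ?_)
    refine lt_of_le_of_lt (lintegral_mono fun z => ?_) L.lintegral_lt_top
    rw [← hwc z]
    simp
  have hw0 : ∀ z, z ≠ 0 → w z ≠ 0 := fun z hz => by
    have : 0 < ‖z‖₊ := by simpa using hz
    exact (lt_min one_pos (by positivity)).ne'
  have key : ∀ h : E d → ℂ, h 0 = 0 → ∫ z, h z ∂L.ν = ∫ z, (w z)⁻¹ • h z ∂η := by
    intro h h0
    rw [hη, integral_withDensity_eq_integral_smul hwm]
    refine integral_congr_ae (ae_of_all _ fun z => ?_)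
    by_cases hz : z = 0
    · simp [hz, h0]
    · change h z = w z • (w z)⁻¹ • h z
      rw [smul_smul, mul_inv_cancel₀ (hw0 z hz), one_smul]
  have hz0 : ∀ ξ, φ ξ 0 = 0 := fun ξ => by
    have := hφ ξ 0
    simpa using this
  have h1 : ∀ ξ, ∫ z, φ ξ z ∂L.ν = ∫ z, (w z)⁻¹ • φ ξ z ∂η := fun ξ => key _ (hz0 ξ)
  have h2 : ∀ z, (w z)⁻¹ • ∫ ξ, φ ξ z = ∫ ξ, (w z)⁻¹ • φ ξ z := fun z => by
    simp only [NNReal.smul_def, integral_smul]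
  rw [key (fun z => ∫ ξ, φ ξ z) (by simp [hz0])]
  simp_rw [h1, h2]
  refine (integral_integral_swap (f := fun ξ z => (w z)⁻¹ • φ ξ z) ?_).symm
  refine (ha.norm.comp_fst η).mono' ?_ (ae_of_all _ fun p => ?_)
  · exact (hwm.inv.comp measurable_snd).aestronglyMeasurable.smul hm
  · change ‖(w p.2)⁻¹ • φ p.1 p.2‖ ≤ ‖a p.1‖
    by_cases hz : p.2 = 0
    · simp [hz, hz0]
    have h1 : (0 : ℝ) < w p.2 := by
      have := hw0 _ hz
      positivity
    rw [NNReal.smul_def, norm_smul, NNReal.coe_inv, norm_inv, Real.norm_of_nonneg h1.le,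
      inv_mul_le_iff₀ h1, mul_comm, hwc]
    refine (hφ _ _).trans ?_
    gcongr
    exact le_abs_self _

variable {f : E d → ℝ}

lemma coe_eq_invFourier (hf : HasCompactSupport f) (hs : ContDiff ℝ ∞ f) (x : E d) :
    (f x : ℂ) = invFourier (𝓕 (toSchwartz hf hs) : 𝓢(E d, ℂ)) x := by
  rw [← schwartz_eq_invFourier, toSchwartz_apply]

lemma coe_fderiv_eq_invFourier (hf : HasCompactSupport f) (hs : ContDiff ℝ ∞ f) (x w : E d) :
    (fderiv ℝ f x w : ℂ) = invFourier (fun ξ => Complex.I * (inner ℝ ((2 * Real.pi) • ξ) w : ℝ) *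
      (𝓕 (toSchwartz hf hs) : 𝓢(E d, ℂ)) ξ) x := by
  rw [coe_eq_invFourier (f := fun x => fderiv ℝ f x w)
    (hf.fderiv_apply ℝ w) ((hs.fderiv_right (m := ∞) (by simp)).clm_apply contDiff_const),
    ← lineDeriv_toSchwartz]
  congr 1
  funext ξ
  rw [fourier_lineDeriv_apply]

lemma coe_fderiv_fderiv_eq_invFourier (hf : HasCompactSupport f) (hs : ContDiff ℝ ∞ f)
    (x w w' : E d) :
    (fderiv ℝ (fderiv ℝ f) x w w' : ℂ) = invFourier (fun ξ =>
      -(((inner ℝ ((2 * Real.pi) • ξ) w : ℝ) : ℂ) * (inner ℝ ((2 * Real.pi) • ξ) w' : ℝ)) *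
      (𝓕 (toSchwartz hf hs) : 𝓢(E d, ℂ)) ξ) x := by
  have h1 : ContDiff ℝ ∞ (fderiv ℝ f) := hs.fderiv_right (m := ∞) (by simp)
  have h2 : fderiv ℝ (fderiv ℝ f) x w w' = fderiv ℝ (fun y => fderiv ℝ f y w') x w := by
    have := (h1.differentiable (by simp) x).hasFDerivAt.clm_apply (hasFDerivAt_const w' x)
    rw [this.fderiv]
    simp
  rw [h2, coe_fderiv_eq_invFourier (hf.fderiv_apply ℝ w') (h1.clm_apply contDiff_const),
    ← lineDeriv_toSchwartz hf hs]
  congr 1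
  funext ξ
  rw [fourier_lineDeriv_apply]
  linear_combination ((inner ℝ ((2 * Real.pi) • ξ) w : ℝ) : ℂ) *
    ((inner ℝ ((2 * Real.pi) • ξ) w' : ℝ) : ℂ) *
      (𝓕 (toSchwartz hf hs) : 𝓢(E d, ℂ)) ξ * Complex.I_mul_I

lemma integrable_mul_schwartz (g : 𝓢(E d, ℂ)) {a : E d → ℂ} (ha : Continuous a) {C : ℝ}
    (hC : ∀ ξ, ‖a ξ‖ ≤ C * (1 + ‖ξ‖ ^ 2)) : Integrable fun ξ => a ξ * g ξ := by
  have h := ((g.integrable_pow_mul volume 0).add (g.integrable_pow_mul volume 2)).const_mul C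
  refine h.mono' (ha.mul g.continuous).aestronglyMeasurable (ae_of_all _ fun ξ => ?_)
  rw [norm_mul]
  simp only [Pi.add_apply]
  calc ‖a ξ‖ * ‖g ξ‖ ≤ C * (1 + ‖ξ‖ ^ 2) * ‖g ξ‖ := by gcongr; exact hC ξ
    _ = _ := by ring

lemma invFourier_add {g h : E d → ℂ} (hg : Integrable g) (hh : Integrable h) (x : E d) :
    invFourier (fun ξ => g ξ + h ξ) x = invFourier g x + invFourier h x := by
  unfold invFourier
  rw [← integral_add (integrable_exp_mul hg x) (integrable_exp_mul hh x)]
  simp_rw [mul_add]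

lemma invFourier_sub {g h : E d → ℂ} (hg : Integrable g) (hh : Integrable h) (x : E d) :
    invFourier (fun ξ => g ξ - h ξ) x = invFourier g x - invFourier h x := by
  unfold invFourier
  rw [← integral_sub (integrable_exp_mul hg x) (integrable_exp_mul hh x)]
  simp_rw [mul_sub]

lemma invFourier_const_mul (c : ℂ) (h : E d → ℂ) (x : E d) :
    invFourier (fun ξ => c * h ξ) x = c * invFourier h x := by
  unfold invFourier
  rw [← integral_const_mul]
  simp_rw [mul_left_comm]

lemma invFourier_sum {ι : Type} (s : Finset ι) {g : ι → E d → ℂ} (hg : ∀ i ∈ s, Integrable (g i))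
    (x : E d) :
    invFourier (fun ξ => ∑ i ∈ s, g i ξ) x = ∑ i ∈ s, invFourier (g i) x := by
  unfold invFourier
  rw [← integral_finsetSum s fun i hi => integrable_exp_mul (hg i hi) x]
  simp_rw [Finset.mul_sum]

lemma norm_two_pi_smul_sq (ξ : E d) :
    1 + ‖(2 * Real.pi) • ξ‖ ^ 2 ≤ (1 + (2 * Real.pi) ^ 2) * (1 + ‖ξ‖ ^ 2) := by
  rw [norm_smul, mul_pow, Real.norm_of_nonneg (by positivity)]
  nlinarith [sq_nonneg ‖ξ‖, sq_nonneg (2 * Real.pi)]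

lemma integrable_inner_mul (g : 𝓢(E d, ℂ)) (w : E d) :
    Integrable fun ξ => Complex.I * (inner ℝ ((2 * Real.pi) • ξ) w : ℝ) * g ξ := by
  refine integrable_mul_schwartz g (by fun_prop) (C := ‖w‖ * (1 + (2 * Real.pi) ^ 2)) fun ξ => ?_
  rw [norm_mul, Complex.norm_I, one_mul, Complex.norm_real]
  refine (norm_inner_le_norm _ _).trans ?_
  rw [mul_comm, mul_assoc]
  gcongr
  refine le_trans ?_ (norm_two_pi_smul_sq ξ)
  nlinarith [sq_nonneg (‖(2 * Real.pi) • ξ‖ - 1), norm_nonneg ((2 * Real.pi) • ξ)]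

lemma integrable_inner_inner_mul (g : 𝓢(E d, ℂ)) (w w' : E d) : Integrable fun ξ =>
    -(((inner ℝ ((2 * Real.pi) • ξ) w : ℝ) : ℂ) * (inner ℝ ((2 * Real.pi) • ξ) w' : ℝ)) * g ξ := by
  refine integrable_mul_schwartz g (by fun_prop) (C := ‖w‖ * ‖w'‖ * (1 + (2 * Real.pi) ^ 2))
    fun ξ => ?_
  rw [norm_neg, norm_mul, Complex.norm_real, Complex.norm_real]
  calc _ ≤ (‖(2 * Real.pi) • ξ‖ * ‖w‖) * (‖(2 * Real.pi) • ξ‖ * ‖w'‖) := by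
        gcongr <;> exact norm_inner_le_norm _ _
    _ = ‖w‖ * ‖w'‖ * ‖(2 * Real.pi) • ξ‖ ^ 2 := by ring
    _ ≤ ‖w‖ * ‖w'‖ * ((1 + (2 * Real.pi) ^ 2) * (1 + ‖ξ‖ ^ 2)) := by
        gcongr
        linarith [norm_two_pi_smul_sq ξ]
    _ = _ := by ring

lemma integrable_mul_schwartz_two_pi (g : 𝓢(E d, ℂ)) {a : E d → ℂ} (ha : Continuous a) {C : ℝ}
    (hC : ∀ ξ, ‖a ξ‖ ≤ C * (1 + ‖ξ‖ ^ 2)) : Integrable fun ξ => a ((2 * Real.pi) • ξ) * g ξ := by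
  refine integrable_mul_schwartz g (ha.comp (by fun_prop))
    (C := |C| * (1 + (2 * Real.pi) ^ 2)) fun ξ => (hC _).trans ?_
  rw [mul_assoc]
  gcongr
  · exact le_abs_self C
  · exact norm_two_pi_smul_sq ξ

lemma coe_jump_eq (hf : HasCompactSupport f) (hs : ContDiff ℝ ∞ f) (x z : E d) :
    (jump f x z : ℂ) = -invFourier (fun ξ => symbolJump ((2 * Real.pi) • ξ) z *
      (𝓕 (toSchwartz hf hs) : 𝓢(E d, ℂ)) ξ) x := by
  set g : 𝓢(E d, ℂ) := 𝓕 (toSchwartz hf hs) with hg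
  have hgi : Integrable g := g.integrable
  have hshift : invFourier (fun ξ => Complex.exp (Complex.I * (inner ℝ ((2 * Real.pi) • ξ) z : ℝ)) *
      g ξ) x = invFourier g (x + z) := by
    unfold invFourier
    refine integral_congr_ae (ae_of_all _ fun ξ => ?_)
    simp only [← mul_assoc, ← Complex.exp_add]
    rw [inner_add_right]
    push_cast
    ring_nf
  have hei : Integrable fun ξ => Complex.exp (Complex.I * (inner ℝ ((2 * Real.pi) • ξ) z : ℝ)) *
      g ξ := integrable_exp_mul hgi z
  unfold jump symbolJump
  by_cases hz : z ∈ Metric.ball (0 : E d) 1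
  · simp only [hz, indicator_of_mem]
    have h1 : ∀ ξ, (1 - Complex.exp (Complex.I * (inner ℝ ((2 * Real.pi) • ξ) z : ℝ)) +
        Complex.I * (inner ℝ ((2 * Real.pi) • ξ) z : ℝ)) * g ξ = (g ξ -
          Complex.exp (Complex.I * (inner ℝ ((2 * Real.pi) • ξ) z : ℝ)) * g ξ) +
          Complex.I * (inner ℝ ((2 * Real.pi) • ξ) z : ℝ) * g ξ := fun ξ => by ring
    simp_rw [h1]
    have hsub : Integrable fun ξ => g ξ -
        Complex.exp (Complex.I * (inner ℝ ((2 * Real.pi) • ξ) z : ℝ)) * g ξ := hgi.sub hei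
    rw [invFourier_add hsub (integrable_inner_mul g z), invFourier_sub hgi hei, hshift]
    push_cast
    rw [coe_eq_invFourier hf hs, coe_eq_invFourier hf hs, coe_fderiv_eq_invFourier hf hs]
    ring
  · simp only [hz, indicator_of_notMem, not_false_eq_true, add_zero, sub_zero]
    have h1 : ∀ ξ, (1 - Complex.exp (Complex.I * (inner ℝ ((2 * Real.pi) • ξ) z : ℝ))) * g ξ =
        g ξ - Complex.exp (Complex.I * (inner ℝ ((2 * Real.pi) • ξ) z : ℝ)) * g ξ :=
      fun ξ => by ring
    simp_rw [h1]
    rw [invFourier_sub hgi hei, hshift]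
    push_cast
    rw [coe_eq_invFourier hf hs, coe_eq_invFourier hf hs]
    ring

lemma measurable_exp_symbolJump (g : 𝓢(E d, ℂ)) (x : E d) :
    Measurable fun p : E d × E d =>
      Complex.exp (Complex.I * ((inner ℝ ((2 * Real.pi) • p.1) x : ℝ) : ℂ)) *
        (symbolJump ((2 * Real.pi) • p.1) p.2 * g p.1) := by
  have h0 : Continuous fun p : E d × E d => ((2 * Real.pi) • p.1, p.2) := by fun_prop
  have h1 := (measurable_symbolJump (d := d)).comp h0.measurable
  have h2 : Continuous fun p : E d × E d => g p.1 := g.continuous.comp continuous_fst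
  have h3 : Continuous fun p : E d × E d =>
      Complex.exp (Complex.I * ((inner ℝ ((2 * Real.pi) • p.1) x : ℝ) : ℂ)) := by fun_prop
  exact h3.measurable.mul (h1.mul h2.measurable)

lemma norm_exp_symbolJump_le (g : 𝓢(E d, ℂ)) (x ξ z : E d) :
    ‖Complex.exp (Complex.I * ((inner ℝ ((2 * Real.pi) • ξ) x : ℝ) : ℂ)) *
        (symbolJump ((2 * Real.pi) • ξ) z * g ξ)‖ ≤
      3 * (1 + (2 * Real.pi) ^ 2) * (‖g ξ‖ + ‖ξ‖ ^ 2 * ‖g ξ‖) * min 1 (‖z‖ ^ 2) := by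
  rw [norm_exp_inner_mul, norm_mul]
  calc _ ≤ 3 * (1 + ‖(2 * Real.pi) • ξ‖ ^ 2) * min 1 (‖z‖ ^ 2) * ‖g ξ‖ := by
        gcongr
        exact norm_symbolJump_le _ z
    _ ≤ 3 * ((1 + (2 * Real.pi) ^ 2) * (1 + ‖ξ‖ ^ 2)) * min 1 (‖z‖ ^ 2) * ‖g ξ‖ := by
        gcongr
        exact norm_two_pi_smul_sq ξ
    _ = _ := by ring

lemma integral_invFourier_symbolJump (L : LevyTriplet d) (g : 𝓢(E d, ℂ)) (x : E d) :
    ∫ z, invFourier (fun ξ => symbolJump ((2 * Real.pi) • ξ) z * g ξ) x ∂L.ν =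
      invFourier (fun ξ => (∫ z, symbolJump ((2 * Real.pi) • ξ) z ∂L.ν) * g ξ) x := by
  have ha : Integrable fun ξ => 3 * (1 + (2 * Real.pi) ^ 2) * (‖g ξ‖ + ‖ξ‖ ^ 2 * ‖g ξ‖) :=
    (g.integrable.norm.add (g.integrable_pow_mul volume 2)).const_mul _
  unfold invFourier
  rw [L.integral_levy_swap ha (measurable_exp_symbolJump g x).aestronglyMeasurable
    (norm_exp_symbolJump_le g x)]
  simp_rw [integral_const_mul, integral_mul_const]

lemma coe_integral_jump_eq (L : LevyTriplet d) (hf : HasCompactSupport f) (hs : ContDiff ℝ ∞ f)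
    (x : E d) :
    ((∫ z, jump f x z ∂L.ν : ℝ) : ℂ) =
      -invFourier (fun ξ => (∫ z, symbolJump ((2 * Real.pi) • ξ) z ∂L.ν) *
        (𝓕 (toSchwartz hf hs) : 𝓢(E d, ℂ)) ξ) x := by
  rw [← integral_complex_ofReal]
  simp_rw [coe_jump_eq hf hs]
  rw [integral_neg, integral_invFourier_symbolJump]

/-- On exponentials the Lévy operator acts as multiplication by minus the symbol. -/
lemma coe_op_eq_invFourier (L : LevyTriplet d) (hf : HasCompactSupport f) (hs : ContDiff ℝ ∞ f)
    (hu : CB 2 f) (x : E d) :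
    (L.op f x : ℂ) = invFourier (fun ξ => -(L.symbol ((2 * Real.pi) • ξ)) *
      (𝓕 (toSchwartz hf hs) : 𝓢(E d, ℂ)) ξ) x := by
  rw [L.op_eq hu]
  push_cast
  rw [coe_integral_jump_eq L hf hs, coe_fderiv_eq_invFourier hf hs]
  simp_rw [coe_fderiv_fderiv_eq_invFourier hf hs, ← invFourier_const_mul]
  set g : 𝓢(E d, ℂ) := 𝓕 (toSchwartz hf hs) with hg
  have hJi : Integrable fun ξ => (∫ z, symbolJump ((2 * Real.pi) • ξ) z ∂L.ν) * g ξ :=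
    integrable_mul_schwartz_two_pi g L.continuous_integral_symbolJump L.norm_integral_symbolJump_le
  have hq := fun i j : Fin d => (integrable_inner_inner_mul g (EuclideanSpace.single i 1)
    (EuclideanSpace.single j 1)).const_mul (L.A i j : ℂ)
  simp_rw [fun i : Fin d => (invFourier_sum Finset.univ (fun j _ => hq i j) x).symm]
  rw [← invFourier_sum Finset.univ (fun i _ => integrable_finsetSum _ fun j _ => hq i j),
    ← invFourier_add (integrable_inner_mul g L.B)
      (integrable_finsetSum _ fun i _ => integrable_finsetSum _ fun j _ => hq i j),
    ← sub_eq_add_neg, ← invFourier_sub _ hJi]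
  · congr 1
    funext ξ
    rw [symbol_eq, real_inner_comm L.B]
    have h1 : ∀ i : Fin d, (inner ℝ ((2 * Real.pi) • ξ) (EuclideanSpace.single i 1) : ℝ) =
        ((2 * Real.pi) • ξ) i := fun i => by
      rw [EuclideanSpace.inner_single_right]; simp
    simp_rw [h1]
    push_cast
    rw [neg_add, neg_add, add_mul, add_mul, ← Finset.sum_neg_distrib, Finset.sum_mul]
    rw [sub_eq_add_neg, ← neg_mul]
    congr 2
    · ring
    · refine Finset.sum_congr rfl fun i _ => ?_
      rw [← Finset.sum_neg_distrib, Finset.sum_mul]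
      refine Finset.sum_congr rfl fun j _ => ?_
      ring
  · exact (integrable_inner_mul g L.B).add
      (integrable_finsetSum _ fun i _ => integrable_finsetSum _ fun j _ => hq i j)

variable {L : LevyTriplet d} {K : ℝ → E d → ℝ}

/-- After exchanging the integrals, the average of the exponential of frequency `2πξ` is the
characteristic function of the heat measure at `-2πξ`, that is, the multiplier `e^{-tΨ}`. -/
lemma coe_avg_eq_invFourier (hK : L.IsSmoothHeatKernel K) {t : ℝ} (ht : 0 ≤ t) {u : E d → ℝ}
    {h : E d → ℂ} (hh : Integrable h) (hu : ∀ x, (u x : ℂ) = invFourier h x) (x : E d) :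
    ((avg (heatMeasure K t) u x : ℝ) : ℂ) =
      invFourier (fun ξ => Complex.exp (-(t : ℂ) * L.symbol ((2 * Real.pi) • ξ)) * h ξ) x := by
  have hp := hK.isProbabilityMeasure t
  unfold avg
  rw [← integral_complex_ofReal]
  simp_rw [hu]
  unfold invFourier
  rw [integral_integral_swap]
  · refine integral_congr_ae (ae_of_all _ fun ξ => ?_)
    simp only
    rw [← hK.charFun_heatMeasure ht, charFun_apply, ← integral_mul_const, ← integral_const_mul]
    refine integral_congr_ae (ae_of_all _ fun y => ?_)
    simp only
    rw [← mul_assoc, ← Complex.exp_add, inner_sub_right, inner_neg_right, real_inner_comm y]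
    congr 2
    push_cast
    ring
  · refine (hh.norm.comp_snd (heatMeasure K t)).mono' ?_ (ae_of_all _ fun p => ?_)
    · refine AEStronglyMeasurable.mul ?_ hh.aestronglyMeasurable.comp_snd
      exact (Continuous.aestronglyMeasurable (by fun_prop))
    · exact (norm_exp_inner_mul _ _ _).le

/-- The multiplier is the characteristic function of a probability measure, so no sign of the real
part of the symbol has to be computed. -/
lemma norm_exp_symbol_le (hK : L.IsSmoothHeatKernel K) {t : ℝ} (ht : 0 ≤ t) (ξ : E d) :
    ‖Complex.exp (-(t : ℂ) * L.symbol ξ)‖ ≤ 1 := by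
  have hp := hK.isProbabilityMeasure t
  rw [← hK.charFun_heatMeasure ht]
  exact norm_charFun_le_one _

lemma integral_exp_mul_const (c : ℂ) (t : ℝ) :
    ∫ r in (0 : ℝ)..t, Complex.exp (-(r : ℂ) * c) * -c = Complex.exp (-(t : ℂ) * c) - 1 := by
  have h : ∀ r ∈ uIcc 0 t, HasDerivAt (fun r : ℝ => Complex.exp (-(r : ℂ) * c))
      (Complex.exp (-(r : ℂ) * c) * -c) r := fun r _ => by
    have h1 : HasDerivAt (fun r : ℝ => -(r : ℂ) * c) (-c) r := by
      have := ((hasDerivAt_id r).ofReal_comp.neg).mul_const c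
      simpa using this
    exact h1.cexp
  rw [intervalIntegral.integral_eq_sub_of_hasDerivAt h
    (Continuous.intervalIntegrable (by fun_prop) _ _)]
  simp

lemma cb_of_hasCompactSupport (hf : HasCompactSupport f) (hs : ContDiff ℝ ∞ f) (k : ℕ) :
    CB k f := by
  refine ⟨hs.of_le (by exact_mod_cast le_top), fun j _ => ?_⟩
  exact (hf.iteratedFDeriv j).exists_bound_of_continuous
    (hs.continuous_iteratedFDeriv (by exact_mod_cast le_top))

/-- At each fixed frequency this is the integration in time of `-Ψ e^{-rΨ}`; the exchange with the
frequency integral is justified because the multiplier is bounded by one and `Ψ g` is integrable. -/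
lemma integral_invFourier_exp_symbol (hK : L.IsSmoothHeatKernel K) {t : ℝ} (ht : 0 ≤ t)
    {g : E d → ℂ} (hg : Integrable g)
    (hψ : Integrable fun ξ => -(L.symbol ((2 * Real.pi) • ξ)) * g ξ) (x : E d) :
    ∫ r in (0 : ℝ)..t, invFourier (fun ξ => Complex.exp (-(r : ℂ) * L.symbol ((2 * Real.pi) • ξ)) *
        (-(L.symbol ((2 * Real.pi) • ξ)) * g ξ)) x =
      invFourier (fun ξ => Complex.exp (-(t : ℂ) * L.symbol ((2 * Real.pi) • ξ)) * g ξ) x -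
        invFourier g x := by
  have hcs : Continuous fun ξ : E d => L.symbol ((2 * Real.pi) • ξ) :=
    L.continuous_symbol.comp (by fun_prop)
  have hm : ∀ r : ℝ, Continuous fun ξ : E d =>
      Complex.exp (-(r : ℂ) * L.symbol ((2 * Real.pi) • ξ)) := fun r => by fun_prop
  have hei : Integrable fun ξ => Complex.exp (-(t : ℂ) * L.symbol ((2 * Real.pi) • ξ)) * g ξ := by
    refine hg.norm.mono' ((hm t).aestronglyMeasurable.mul hg.aestronglyMeasurable)
      (ae_of_all _ fun ξ => ?_)
    rw [norm_mul]
    exact mul_le_of_le_one_left (norm_nonneg _) (norm_exp_symbol_le hK ht _)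
  rw [← invFourier_sub hei hg, intervalIntegral.integral_of_le ht]
  unfold invFourier
  rw [integral_integral_swap]
  · refine integral_congr_ae (ae_of_all _ fun ξ => ?_)
    simp only
    rw [integral_const_mul, ← intervalIntegral.integral_of_le ht]
    simp_rw [← mul_assoc]
    rw [intervalIntegral.integral_mul_const, integral_exp_mul_const]
    ring
  · have hae : ∀ᵐ p : ℝ × E d ∂((volume.restrict (Ioc 0 t)).prod volume), p.1 ∈ Ioc 0 t :=
      Measure.quasiMeasurePreserving_fst.ae (ae_restrict_mem measurableSet_Ioc)
    refine (hψ.norm.comp_snd (volume.restrict (Ioc 0 t))).mono' ?_ (hae.mono fun p hp => ?_)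
    · have h1 : Continuous fun p : ℝ × E d =>
          Complex.exp (Complex.I * ((inner ℝ ((2 * Real.pi) • p.2) x : ℝ) : ℂ)) := by fun_prop
      have h2 : Continuous fun p : ℝ × E d =>
          Complex.exp (-(p.1 : ℂ) * L.symbol ((2 * Real.pi) • p.2)) := by
        have := hcs.comp (continuous_snd (X := ℝ))
        simp only [Function.comp_def] at this
        fun_prop
      exact h1.aestronglyMeasurable.mul (h2.aestronglyMeasurable.mul hψ.aestronglyMeasurable.comp_snd)
    · change ‖_ * (_ * _)‖ ≤ _
      rw [norm_exp_inner_mul, norm_mul]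
      exact mul_le_of_le_one_left (norm_nonneg _) (norm_exp_symbol_le hK hp.1.le _)

/-- On the Fourier side the flow multiplies by `e^{-tΨ}` and the operator by `-Ψ`. The transform of
a test function decays rapidly and `Ψ` grows at most quadratically, so all the integrals converge.
-/
lemma kolmogorov_of_hasCompactSupport (hK : L.IsSmoothHeatKernel K)
    (hf : HasCompactSupport f) (hs : ContDiff ℝ ∞ f) : L.Kolmogorov K f := by
  intro t ht x
  have hu : CB 2 f := cb_of_hasCompactSupport hf hs 2
  set g : 𝓢(E d, ℂ) := 𝓕 (toSchwartz hf hs) with hg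
  have hψ : Integrable fun ξ => -(L.symbol ((2 * Real.pi) • ξ)) * g ξ := by
    obtain ⟨C, hC⟩ := L.exists_norm_symbol_le
    refine integrable_mul_schwartz_two_pi g (a := fun ξ => -L.symbol ξ) L.continuous_symbol.neg
      (C := C) fun ξ => ?_
    rw [norm_neg]
    exact hC ξ
  have h1 := coe_avg_eq_invFourier hK ht g.integrable (coe_eq_invFourier hf hs) x
  have h2 : ∀ r ∈ uIcc 0 t, ((avg (heatMeasure K r) (L.op f) x : ℝ) : ℂ) = _ := fun r hr =>
    coe_avg_eq_invFourier hK (by rw [uIcc_of_le ht] at hr; exact hr.1) hψ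
      (coe_op_eq_invFourier L hf hs hu) x
  rw [← Complex.ofReal_inj, ← intervalIntegral.integral_ofReal,
    intervalIntegral.integral_congr h2]
  push_cast
  rw [h1, coe_eq_invFourier hf hs, integral_invFourier_exp_symbol hK ht g.integrable hψ]

end LevyTriplet

end

/-! ### Smoothing estimates for the heat flow -/

section

variable {d : ℕ}

namespace LevyTriplet

/-- `K` is a smooth heat kernel of `L` with derivative bounds of order `α` on `(0,T]`. -/
structure SmoothingKernel (L : LevyTriplet d) (K : ℝ → E d → ℝ) (α T : ℝ) : Prop where
  isSmoothHeatKernel : L.IsSmoothHeatKernel K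
  exists_bound : ∀ m : ℕ, ∃ c : ℝ, 0 ≤ c ∧ ∀ t ∈ Ioc 0 T, Integrable (iteratedFDeriv ℝ m (K t)) ∧
    ∫ x, ‖iteratedFDeriv ℝ m (K t) x‖ ≤ c * t ^ (-(m / α))

lemma HeatKernelBounds.exists_smoothingKernel {L : LevyTriplet d} {α T : ℝ}
    (h : L.HeatKernelBounds α T) : ∃ K, L.SmoothingKernel K α T := by
  obtain ⟨K, hK, hb⟩ := h
  refine ⟨K, hK, fun m => ?_⟩
  obtain ⟨c, hc⟩ := hb m
  refine ⟨|c|, abs_nonneg c, fun t ht => ?_⟩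
  have hp : 0 ≤ t ^ (-(m / α)) := Real.rpow_nonneg ht.1.le _
  have hle := (hc t ht).trans (ENNReal.ofReal_le_ofReal
    (mul_le_mul_of_nonneg_right (le_abs_self c) hp))
  have hi : Integrable (iteratedFDeriv ℝ m (K t)) := by
    refine memLp_one_iff_integrable.1 ⟨?_, hle.trans_lt ENNReal.ofReal_lt_top⟩
    exact ((hK.contDiff ht.1).continuous_iteratedFDeriv
      (by exact_mod_cast le_top)).aestronglyMeasurable
  refine ⟨hi, ?_⟩
  rw [eLpNorm_one_eq_lintegral_enorm, ← ofReal_integral_norm_eq_lintegral_enorm hi] at hle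
  exact (ENNReal.ofReal_le_ofReal_iff (by positivity)).1 hle

namespace SmoothingKernel

variable {L : LevyTriplet d} {K : ℝ → E d → ℝ} {α T t : ℝ}
  {F : Type} [NormedAddCommGroup F] [NormedSpace ℝ F] [CompleteSpace F] {u : E d → F} {C σ : ℝ}

/-- The constant in the derivative bound of order `m`. -/
def coeff (hK : L.SmoothingKernel K α T) (m : ℕ) : ℝ := (hK.exists_bound m).choose

lemma coeff_nonneg (hK : L.SmoothingKernel K α T) (m : ℕ) : 0 ≤ hK.coeff m :=
  (hK.exists_bound m).choose_spec.1

lemma integrable (hK : L.SmoothingKernel K α T) (ht : t ∈ Ioc 0 T) (m : ℕ) :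
    Integrable (iteratedFDeriv ℝ m (K t)) :=
  ((hK.exists_bound m).choose_spec.2 t ht).1

lemma integral_le (hK : L.SmoothingKernel K α T) (ht : t ∈ Ioc 0 T) (m : ℕ) :
    ∫ x, ‖iteratedFDeriv ℝ m (K t) x‖ ≤ hK.coeff m * t ^ (-(m / α)) :=
  ((hK.exists_bound m).choose_spec.2 t ht).2

lemma isProbabilityMeasure (hK : L.SmoothingKernel K α T) (t : ℝ) :
    IsProbabilityMeasure (heatMeasure K t) :=
  hK.isSmoothHeatKernel.isProbabilityMeasure t

lemma contDiff_kernel (hK : L.SmoothingKernel K α T) (ht : t ∈ Ioc 0 T) (m : ℕ) :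
    ContDiff ℝ m (K t) :=
  (hK.isSmoothHeatKernel.contDiff ht.1).of_le (by exact_mod_cast le_top)

lemma contDiff_avg (hK : L.SmoothingKernel K α T) (ht : t ∈ Ioc 0 T) (hu : Continuous u)
    (hC : ∀ x, ‖u x‖ ≤ C) (m : ℕ) : ContDiff ℝ m (avg (heatMeasure K t) u) := by
  rw [hK.isSmoothHeatKernel.avg_eq_convolution ht.1]
  exact contDiff_convolution_of_integrable (hK.contDiff_kernel ht m)
    (fun j _ => hK.integrable ht j) hu hC

lemma norm_iteratedFDeriv_le (hK : L.SmoothingKernel K α T) (ht : t ∈ Ioc 0 T) (hu : Continuous u)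
    (hC : ∀ x, ‖u x‖ ≤ C) (m : ℕ) (x : E d) :
    ‖iteratedFDeriv ℝ m (avg (heatMeasure K t) u) x‖ ≤ hK.coeff m * t ^ (-(m / α)) * C := by
  have hC0 : 0 ≤ C := (norm_nonneg _).trans (hC x)
  rw [hK.isSmoothHeatKernel.avg_eq_convolution ht.1]
  refine (norm_iteratedFDeriv_convolution_le (hK.contDiff_kernel ht m)
    (fun j _ => hK.integrable ht j) hu hC x).trans ?_
  refine mul_le_mul_of_nonneg_right ?_ hC0
  have hl : ‖(ContinuousLinearMap.lsmul ℝ ℝ : ℝ →L[ℝ] F →L[ℝ] F)‖ ≤ 1 :=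
    ContinuousLinearMap.opNorm_lsmul_le
  refine (mul_le_mul_of_nonneg_right hl (integral_nonneg fun _ => norm_nonneg _)).trans ?_
  rw [one_mul]
  exact hK.integral_le ht m

lemma cb_avg (hK : L.SmoothingKernel K α T) (ht : t ∈ Ioc 0 T) (hu : Continuous u)
    (hC : ∀ x, ‖u x‖ ≤ C) (m : ℕ) : CB m (avg (heatMeasure K t) u) :=
  ⟨hK.contDiff_avg ht hu hC m, fun j _ => ⟨_, hK.norm_iteratedFDeriv_le ht hu hC j⟩⟩

lemma norm_iteratedFDeriv_le_of_holder (hK : L.SmoothingKernel K α T) (ht : t ∈ Ioc 0 T)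
    (hu : Continuous u) (hb : ∀ x, ‖u x‖ ≤ C) {c : ℝ} (hσ : 0 < σ) (hc : 0 ≤ c)
    (hh : ∀ x y, ‖u x - u y‖ ≤ c * ‖x - y‖ ^ σ) (m : ℕ) (x : E d) :
    ‖iteratedFDeriv ℝ (m + 1) (avg (heatMeasure K t) u) x‖ ≤
      (hK.coeff (m + 1) + hK.coeff m) * t ^ (-((m + 1 - σ) / α)) * c := by
  have ht0 := ht.1
  rw [hK.isSmoothHeatKernel.avg_eq_convolution ht.1]
  -- The increment length `t^{1/α}` balances the two terms of the Hölder estimate: both become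
  -- multiples of `t^{-(m+1-σ)/α}`.
  have hs : 0 < t ^ (1 / α) := Real.rpow_pos_of_pos ht.1 _
  refine (norm_iteratedFDeriv_convolution_le_of_holder (hK.contDiff_kernel ht (m + 1))
    (fun j _ => hK.integrable ht j) hu hb hσ hc hh hs x).trans ?_
  have hl : ‖(ContinuousLinearMap.lsmul ℝ ℝ : ℝ →L[ℝ] F →L[ℝ] F)‖ ≤ 1 :=
    ContinuousLinearMap.opNorm_lsmul_le
  have e1 : t ^ (-(((m + 1 : ℕ) : ℝ) / α)) * (t ^ (1 / α)) ^ σ = t ^ (-((m + 1 - σ) / α)) := by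
    rw [← Real.rpow_mul ht0.le, ← Real.rpow_add ht0]
    congr 1
    push_cast
    ring
  have e2 : t ^ (-((m : ℝ) / α)) * (t ^ (1 / α)) ^ σ / t ^ (1 / α) =
      t ^ (-((m + 1 - σ) / α)) := by
    rw [← Real.rpow_mul ht0.le, ← Real.rpow_add ht0, ← Real.rpow_sub ht0]
    congr 1
    ring
  calc _ ≤ 1 * (hK.coeff (m + 1) * t ^ (-(((m + 1 : ℕ) : ℝ) / α))) * (c * (t ^ (1 / α)) ^ σ) +
        1 * (hK.coeff m * t ^ (-((m : ℝ) / α))) * (c * (t ^ (1 / α)) ^ σ) / t ^ (1 / α) := by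
        gcongr
        · exact hK.integral_le ht _
        · exact hK.integral_le ht _
    _ = hK.coeff (m + 1) * (t ^ (-(((m + 1 : ℕ) : ℝ) / α)) * (t ^ (1 / α)) ^ σ) * c +
        hK.coeff m * (t ^ (-((m : ℝ) / α)) * (t ^ (1 / α)) ^ σ / t ^ (1 / α)) * c := by ring
    _ = _ := by rw [e1, e2]; ring

/-- The first `k` derivatives are moved onto `u`, and only the remaining `m` fall on the kernel and
cost a power of `t`. -/
lemma norm_iteratedFDeriv_add_le (hK : L.SmoothingKernel K α T) (ht : t ∈ Ioc 0 T) (m k : ℕ)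
    {F : Type} [NormedAddCommGroup F] [NormedSpace ℝ F] [CompleteSpace F] {u : E d → F}
    (hu : CB k u) (hC : ∀ x, ‖iteratedFDeriv ℝ k u x‖ ≤ C) (x : E d) :
    ‖iteratedFDeriv ℝ (k + m) (avg (heatMeasure K t) u) x‖ ≤ hK.coeff m * t ^ (-(m / α)) * C := by
  have hp := hK.isProbabilityMeasure t
  induction k generalizing F with
  | zero =>
    simp only [norm_iteratedFDeriv_zero] at hC
    rw [zero_add]
    exact hK.norm_iteratedFDeriv_le ht hu.continuous hC m x
  | succ k ih =>
    rw [add_right_comm, ← norm_iteratedFDeriv_fderiv, fderiv_avg (hu.of_le (by omega))]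
    refine ih hu.fderiv fun y => ?_
    rw [norm_iteratedFDeriv_fderiv]
    exact hC y

lemma norm_iteratedFDeriv_add_le_of_holder (hK : L.SmoothingKernel K α T) (ht : t ∈ Ioc 0 T)
    (m k : ℕ) {c : ℝ} (hσ : 0 < σ) (hc : 0 ≤ c)
    {F : Type} [NormedAddCommGroup F] [NormedSpace ℝ F] [CompleteSpace F] {u : E d → F}
    (hu : CB k u)
    (hh : ∀ x y, ‖iteratedFDeriv ℝ k u x - iteratedFDeriv ℝ k u y‖ ≤ c * ‖x - y‖ ^ σ) (x : E d) :
    ‖iteratedFDeriv ℝ (k + (m + 1)) (avg (heatMeasure K t) u) x‖ ≤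
      (hK.coeff (m + 1) + hK.coeff m) * t ^ (-((m + 1 - σ) / α)) * c := by
  have hp := hK.isProbabilityMeasure t
  induction k generalizing F with
  | zero =>
    obtain ⟨C, hC⟩ := hu.bounded
    have h0 : ∀ x y, ‖u x - u y‖ ≤ c * ‖x - y‖ ^ σ := fun x y => by
      have := hh x y
      simp only [iteratedFDeriv_zero_eq_comp, Function.comp_apply] at this
      rwa [← map_sub, LinearIsometryEquiv.norm_map] at this
    rw [zero_add]
    exact hK.norm_iteratedFDeriv_le_of_holder ht hu.continuous hC hσ hc h0 m x
  | succ k ih =>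
    rw [add_right_comm, ← norm_iteratedFDeriv_fderiv, fderiv_avg (hu.of_le (by omega))]
    refine ih hu.fderiv fun y z => ?_
    have := hh y z
    simp only [iteratedFDeriv_succ_eq_comp_right, Function.comp_apply] at this
    have e := (continuousMultilinearCurryRightEquiv' ℝ k (E d) F).symm.dist_map
      (iteratedFDeriv ℝ k (fderiv ℝ u) y) (iteratedFDeriv ℝ k (fderiv ℝ u) z)
    rw [dist_eq_norm, dist_eq_norm] at e
    exact e.ge.trans this

lemma kolmogorov (hK : L.SmoothingKernel K α T) (hT : 0 < T) {u : E d → ℝ} (hu : CB 2 u) :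
    L.Kolmogorov K u :=
  Kolmogorov.of_cb hK.isSmoothHeatKernel hT (fun m _ ht => hK.integrable ht m)
    (fun _ => kolmogorov_of_hasCompactSupport hK.isSmoothHeatKernel) hu

lemma abs_avg_sub_le (hK : L.SmoothingKernel K α T) (hT : 0 < T) {u : E d → ℝ} (hu : CB 2 u)
    {c : ℝ} (hc : ∀ j ≤ 2, ∀ x, ‖iteratedFDeriv ℝ j u x‖ ≤ c) (ht : 0 ≤ t) (x : E d) :
    |avg (heatMeasure K t) u x - u x| ≤ t * (L.opBound * c) := by
  have hp := fun t => hK.isProbabilityMeasure t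
  rw [hK.kolmogorov hT hu t ht x, ← Real.norm_eq_abs]
  refine (intervalIntegral.norm_integral_le_of_norm_le_const (C := L.opBound * c)
    fun r _ => norm_avg_le (fun y => L.abs_op_le hu hc y) x).trans_eq ?_
  rw [sub_zero, abs_of_nonneg ht, mul_comm]

/-- A norming functional reduces the vector-valued case to the scalar Kolmogorov equation. Vector
values are needed because the estimate is applied to derivatives of functions. -/
lemma norm_avg_sub_le (hK : L.SmoothingKernel K α T) (hT : 0 < T) (hu : CB 2 u)
    {c : ℝ} (hc : ∀ j ≤ 2, ∀ x, ‖iteratedFDeriv ℝ j u x‖ ≤ c) (ht : 0 ≤ t) (x : E d) :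
    ‖avg (heatMeasure K t) u x - u x‖ ≤ t * (L.opBound * c) := by
  have hp := hK.isProbabilityMeasure t
  obtain ⟨ℓ, hℓ, hx⟩ := exists_dual_vector'' ℝ (avg (heatMeasure K t) u x - u x)
  have hc0 : 0 ≤ c := (norm_nonneg _).trans (hc 0 (by omega) 0)
  have hb : ∀ j ≤ 2, ∀ x, ‖iteratedFDeriv ℝ j (ℓ ∘ u) x‖ ≤ c := fun j hj y => by
    refine (ℓ.norm_iteratedFDeriv_comp_left (N := ((2 : ℕ) : ℕ∞ω)) (n := j) hu.1.contDiffAt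
      (by exact_mod_cast hj)).trans
      ((mul_le_mul hℓ (hc j hj y) (norm_nonneg _) zero_le_one).trans_eq (one_mul c))
  have hcb : CB 2 (ℓ ∘ u) := ⟨ℓ.contDiff.comp hu.1, fun j hj => ⟨c, hb j hj⟩⟩
  have h := hK.abs_avg_sub_le hT hcb hb ht x
  obtain ⟨C, hC⟩ := hu.bounded
  have h1 : avg (heatMeasure K t) (ℓ ∘ u) x = ℓ (avg (heatMeasure K t) u x) := by
    unfold avg
    exact ℓ.integral_comp_comm (integrable_avg hu.continuous hC x)
  rw [h1, Function.comp_apply, ← map_sub, hx] at h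
  simpa using h

/-- The flow commutes with derivatives, so the case `k = 0` is applied to the `k`-th derivative; the
Lévy operator consumes two more. -/
lemma norm_iteratedFDeriv_avg_sub_le (hK : L.SmoothingKernel K α T) (hT : 0 < T) (k : ℕ)
    {F : Type} [NormedAddCommGroup F] [NormedSpace ℝ F] [CompleteSpace F] {u : E d → F}
    (hu : CB (k + 2) u) {c : ℝ} (hc : ∀ j ≤ k + 2, ∀ x, ‖iteratedFDeriv ℝ j u x‖ ≤ c)
    (ht : 0 ≤ t) (x : E d) :
    ‖iteratedFDeriv ℝ k (fun y => avg (heatMeasure K t) u y - u y) x‖ ≤ t * (L.opBound * c) := by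
  have hp := hK.isProbabilityMeasure t
  induction k generalizing F with
  | zero =>
    rw [norm_iteratedFDeriv_zero]
    exact hK.norm_avg_sub_le hT hu hc ht x
  | succ k ih =>
    have h1 : CB (0 + 1) u := hu.of_le (by omega)
    have h2 : CB (k + 2 + 1) u := hu
    have h3 : fderiv ℝ (fun y => avg (heatMeasure K t) u y - u y) =
        fun y => avg (heatMeasure K t) (fderiv ℝ u) y - fderiv ℝ u y := by
      funext y
      rw [fderiv_fun_sub (hasFDerivAt_avg h1 y).differentiableAt (h1.differentiable y),
        fderiv_avg h1]
    rw [← norm_iteratedFDeriv_fderiv, h3]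
    refine ih h2.fderiv fun j hj y => ?_
    rw [norm_iteratedFDeriv_fderiv]
    exact hc _ (by omega) y

end SmoothingKernel

end LevyTriplet

end

/-! ### The heat flow as a family of operators between Hölder spaces -/

section

variable {d : ℕ}

namespace LevyTriplet.SmoothingKernel

variable {L : LevyTriplet d} {K : ℝ → E d → ℝ} {α T t r : ℝ} {n : ℕ}

/-- A common bound of the derivatives of order at most `n` of the heat kernel at time `t`. -/
def sumCoeff (hK : L.SmoothingKernel K α T) (n : ℕ) (t : ℝ) : ℝ :=
  ∑ j ∈ Finset.range (n + 1), hK.coeff j * t ^ (-(j / α))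

lemma coeff_mul_le_sumCoeff (hK : L.SmoothingKernel K α T) (ht : 0 < t) {j : ℕ} (hj : j ≤ n) :
    hK.coeff j * t ^ (-(j / α)) ≤ hK.sumCoeff n t :=
  Finset.single_le_sum (f := fun j : ℕ => hK.coeff j * t ^ (-(j / α)))
    (fun i _ => mul_nonneg (hK.coeff_nonneg i) (Real.rpow_nonneg ht.le _))
    (Finset.mem_range.2 (Nat.lt_succ_of_le hj))

lemma norm_iteratedFDeriv_le_sumCoeff (hK : L.SmoothingKernel K α T) (ht : t ∈ Ioc 0 T)
    (u : HolderSpace d r) {j : ℕ} (hj : j ≤ n) (x : E d) :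
    ‖iteratedFDeriv ℝ j (avg (heatMeasure K t) (u : E d → ℝ)) x‖ ≤ hK.sumCoeff n t * ‖u‖ :=
  (hK.norm_iteratedFDeriv_le ht u.continuous u.abs_le_norm j x).trans
    (mul_le_mul_of_nonneg_right (hK.coeff_mul_le_sumCoeff ht.1 hj) (norm_nonneg _))

/-- The heat flow at time `t ∈ (0,T]` as an operator from `C^r_b` to `C^n_b`. -/
def heat (hK : L.SmoothingKernel K α T) (n : ℕ) (r t : ℝ) : HolderSpace d r →L[ℝ] HolderSpace d n :=
  if ht : t ∈ Ioc 0 T then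
    LinearMap.mkContinuousOfExistsBound
      { toFun := fun u => HolderSpace.ofBounds rfl (avg (heatMeasure K t) (u : E d → ℝ))
          (hK.contDiff_avg ht u.continuous u.abs_le_norm n) _
          (fun _ hj => hK.norm_iteratedFDeriv_le_sumCoeff ht u hj)
        map_add' := fun u v => by
          have hp := hK.isProbabilityMeasure t
          refine HolderSpace.ext (funext fun x => ?_)
          simp only [HolderSpace.coe_add, Pi.add_apply, HolderSpace.ofBounds_apply]
          exact integral_add (integrable_avg u.continuous u.abs_le_norm x)
            (integrable_avg v.continuous v.abs_le_norm x)
        map_smul' := fun c u => by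
          refine HolderSpace.ext (funext fun x => ?_)
          simp only [RingHom.id_apply, HolderSpace.coe_smul, Pi.smul_apply,
            HolderSpace.ofBounds_apply]
          exact integral_smul c _ }
      ⟨(n + 1) * hK.sumCoeff n t, fun u => by
        rw [mul_assoc]
        refine HolderSpace.norm_le_of_bounds rfl _ fun j hj x => ?_
        rw [LinearMap.coe_mk, AddHom.coe_mk, HolderSpace.coe_ofBounds]
        exact hK.norm_iteratedFDeriv_le_sumCoeff ht u hj x⟩
  -- A value that does not depend on `r` makes `heat_congr` valid for all `t`.
  else 0

lemma coe_heat (hK : L.SmoothingKernel K α T) (ht : t ∈ Ioc 0 T) (u : HolderSpace d r) :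
    (hK.heat n r t u : E d → ℝ) = avg (heatMeasure K t) (u : E d → ℝ) := by
  rw [heat, dif_pos ht]
  exact HolderSpace.coe_ofBounds (k := n) rfl _
    (hK.contDiff_avg ht u.continuous u.abs_le_norm n) _
    (fun _ hj => hK.norm_iteratedFDeriv_le_sumCoeff ht u hj)

lemma heat_congr (hK : L.SmoothingKernel K α T) {s : ℝ} {u : HolderSpace d r} {v : HolderSpace d s}
    (h : (u : E d → ℝ) = v) : hK.heat n r t u = hK.heat n s t v := by
  by_cases ht : t ∈ Ioc 0 T
  · refine HolderSpace.ext ?_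
    rw [hK.coe_heat ht, hK.coe_heat ht, h]
  · rw [heat, heat, dif_neg ht, dif_neg ht]
    rfl

lemma norm_heat_le_of_forall (hK : L.SmoothingKernel K α T) (ht : t ∈ Ioc 0 T) {b : ℝ} (hb : 0 ≤ b)
    (h : ∀ u : HolderSpace d r, ∀ j ≤ n, ∀ x,
      ‖iteratedFDeriv ℝ j (avg (heatMeasure K t) (u : E d → ℝ)) x‖ ≤ b * ‖u‖) :
    ‖hK.heat n r t‖ ≤ (n + 1) * b := by
  refine ContinuousLinearMap.opNorm_le_bound _ (by positivity) fun u => ?_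
  rw [mul_assoc]
  refine HolderSpace.norm_le_of_bounds rfl _ fun j hj x => ?_
  rw [hK.coe_heat ht]
  exact h u j hj x

/-- On a bounded time interval a weaker singularity is absorbed by a stronger one, so that one power
of `t` serves for all orders of derivatives. -/
lemma rpow_neg_div_le (hα : 0 < α) (ht : t ∈ Ioc 0 T) {e γ : ℝ} (he : 0 ≤ e) (heγ : e ≤ γ) :
    t ^ (-(e / α)) ≤ (max 1 T) ^ (γ / α) * t ^ (-(γ / α)) := by
  have h1 : t ^ (-(e / α)) = t ^ ((γ - e) / α) * t ^ (-(γ / α)) := by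
    rw [← Real.rpow_add ht.1]
    congr 1
    ring
  have ht0 := ht.1.le
  rw [h1]
  refine mul_le_mul_of_nonneg_right ?_ (Real.rpow_nonneg ht0 _)
  calc t ^ ((γ - e) / α) ≤ (max 1 T) ^ ((γ - e) / α) :=
        Real.rpow_le_rpow ht0 (ht.2.trans (le_max_right _ _)) (by
          have := sub_nonneg.2 heγ
          positivity)
    _ ≤ _ := Real.rpow_le_rpow_of_exponent_le (le_max_left _ _) (by gcongr; linarith)

/-- The derivative of order `j` costs `t^{-(j-r)/α}` when `j > r`, and `j - r ≤ n - r = γ`;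
derivatives of order at most `⌊r⌋` cost nothing. -/
lemma norm_iteratedFDeriv_avg_le_of_sub (hK : L.SmoothingKernel K α T) (hα : 0 < α)
    {γ : ℝ} (hγ0 : 0 ≤ γ) (hγ : γ < n) (hr : r = n - γ) (ht : t ∈ Ioc 0 T) (u : HolderSpace d r) {j : ℕ}
    (hj : j ≤ n) (x : E d) :
    ‖iteratedFDeriv ℝ j (avg (heatMeasure K t) (u : E d → ℝ)) x‖ ≤
      (1 + 2 * ∑ i ∈ Finset.range (n + 1), hK.coeff i) * ((max 1 T) ^ (γ / α) * t ^ (-(γ / α))) *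
        ‖u‖ := by
  have hp := hK.isProbabilityMeasure t
  set k := ⌊r⌋₊ with hk
  set M : ℝ := (max 1 T) ^ (γ / α) * t ^ (-(γ / α)) with hM
  set S := ∑ i ∈ Finset.range (n + 1), hK.coeff i with hS
  have hr0 : 0 ≤ r := by rw [hr]; linarith
  have hkr : (k : ℝ) ≤ r := Nat.floor_le hr0
  have hrk : r < k + 1 := Nat.lt_floor_add_one r
  have hcoeff : ∀ i ≤ n, hK.coeff i ≤ S := fun i hi =>
    Finset.single_le_sum (f := hK.coeff) (fun i _ => hK.coeff_nonneg i)
      (Finset.mem_range.2 (Nat.lt_succ_of_le hi))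
  have hS0 : 0 ≤ S := Finset.sum_nonneg fun i _ => hK.coeff_nonneg i
  have hMe : ∀ e, 0 ≤ e → e ≤ γ → t ^ (-(e / α)) ≤ M := fun e he heγ =>
    rpow_neg_div_le hα ht he heγ
  have hM1 : 1 ≤ M := by simpa using hMe 0 le_rfl hγ0
  -- For `j > k` the excess derivatives fall on the kernel, with the Hölder gain `σ = r - k` when
  -- `r` is not an integer; for `j ≤ k` the flow is a contraction.
  rcases Nat.lt_or_ge k j with hjk | hjk
  · obtain ⟨i, rfl⟩ : ∃ i, j = k + (i + 1) := ⟨j - k - 1, by omega⟩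
    have hjn : (k : ℝ) + (i + 1) ≤ n := by exact_mod_cast hj
    have hcb : CB k (u : E d → ℝ) := u.cb
    by_cases hrk' : r = k
    · have h := hK.norm_iteratedFDeriv_add_le ht (i + 1) k hcb
        (fun y => u.norm_iteratedFDeriv_le le_rfl y) x
      refine h.trans (mul_le_mul_of_nonneg_right ?_ (norm_nonneg _))
      refine (mul_le_mul (hcoeff _ (by omega)) (hMe _ (by positivity) (by push_cast; linarith))
        (Real.rpow_nonneg ht.1.le _) hS0).trans ?_
      gcongr
      linarith
    · have hσ : 0 < r - k := sub_pos.2 (lt_of_le_of_ne hkr (Ne.symm hrk'))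
      have hcoe : ((Real.toNNReal (r - k) : ℝ≥0) : ℝ) = r - k := Real.coe_toNNReal _ hσ.le
      have hh := u.norm_sub_le_rpow hrk'
      rw [← hk, hcoe] at hh
      have h := hK.norm_iteratedFDeriv_add_le_of_holder ht i k hσ (norm_nonneg u) hcb hh x
      refine h.trans (mul_le_mul_of_nonneg_right ?_ (norm_nonneg _))
      have h2 : hK.coeff (i + 1) + hK.coeff i ≤ 1 + 2 * S := by
        linarith [hcoeff (i + 1) (by omega), hcoeff i (by omega)]
      refine mul_le_mul h2 (hMe _ ?_ ?_) (Real.rpow_nonneg ht.1.le _) (by positivity)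
      · have : (0 : ℝ) ≤ i := Nat.cast_nonneg i
        linarith
      · linarith
  · have h := norm_iteratedFDeriv_avg_le (μ := heatMeasure K t) (u.cb.of_le hjk)
      (fun y => u.norm_iteratedFDeriv_le hjk y) x
    refine h.trans (le_mul_of_one_le_left (norm_nonneg _) ?_)
    nlinarith

lemma exists_norm_heat_le (hK : L.SmoothingKernel K α T) (hα : 0 < α) {γ : ℝ} (hγ0 : 0 ≤ γ)
    (hγ : γ < n) :
    ∃ c : ℝ, 0 ≤ c ∧ ∀ t ∈ Ioc 0 T, ‖hK.heat n (n - γ) t‖ ≤ c * t ^ (-(γ / α)) := by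
  have hS0 : 0 ≤ ∑ i ∈ Finset.range (n + 1), hK.coeff i :=
    Finset.sum_nonneg fun i _ => hK.coeff_nonneg i
  refine ⟨(n + 1) * ((1 + 2 * ∑ i ∈ Finset.range (n + 1), hK.coeff i) * (max 1 T) ^ (γ / α)),
    by positivity, fun t ht => ?_⟩
  have ht0 := ht.1
  refine (hK.norm_heat_le_of_forall ht ?_ fun u j hj x =>
    hK.norm_iteratedFDeriv_avg_le_of_sub hα hγ0 hγ rfl ht u hj x).trans_eq (by ring)
  positivity

/-- `P_t - P_s = (P_{t-s} - 1) P_s`, and `P_s u` has `n + 2` bounded derivatives, uniformly for `s ≥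
δ`. The Kolmogorov equation then gives a factor `t - s`, in operator norm. -/
lemma norm_heat_sub_le (hK : L.SmoothingKernel K α T) (hα : 0 < α) {δ s : ℝ} (hδ : 0 < δ)
    (hs : s ∈ Icc δ T) (ht : t ∈ Icc δ T) (hst : s ≤ t) :
    ‖hK.heat n r t - hK.heat n r s‖ ≤
      (n + 1) * ((t - s) * (L.opBound * hK.sumCoeff (n + 2) δ)) := by
  have hs' : s ∈ Ioc 0 T := ⟨hδ.trans_le hs.1, hs.2⟩
  have ht' : t ∈ Ioc 0 T := ⟨hδ.trans_le ht.1, ht.2⟩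
  have hT : 0 < T := hs'.1.trans_le hs'.2
  have hd0 : 0 ≤ hK.sumCoeff (n + 2) δ := Finset.sum_nonneg fun i _ =>
    mul_nonneg (hK.coeff_nonneg i) (Real.rpow_nonneg hδ.le _)
  have hts := sub_nonneg.2 hst
  have hmono : hK.sumCoeff (n + 2) s ≤ hK.sumCoeff (n + 2) δ := by
    refine Finset.sum_le_sum fun j _ => mul_le_mul_of_nonneg_left ?_ (hK.coeff_nonneg j)
    exact Real.rpow_le_rpow_of_nonpos hδ hs.1 (by
      have : (0 : ℝ) ≤ j / α := by positivity
      linarith)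
  have hop := L.opBound_nonneg
  refine ContinuousLinearMap.opNorm_le_bound _ (by positivity) fun u => ?_
  rw [sub_apply, mul_assoc]
  refine HolderSpace.norm_le_of_bounds rfl _ fun j hj x => ?_
  rw [HolderSpace.coe_sub, hK.coe_heat ht', hK.coe_heat hs']
  have hsg : avg (heatMeasure K t) (u : E d → ℝ) =
      avg (heatMeasure K (t - s)) (avg (heatMeasure K s) (u : E d → ℝ)) := by
    rw [hK.isSmoothHeatKernel.avg_avg hts hs'.1.le u.continuous u.abs_le_norm, sub_add_cancel]
  rw [hsg]
  refine (hK.norm_iteratedFDeriv_avg_sub_le hT j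
    (hK.cb_avg hs' u.continuous u.abs_le_norm (j + 2)) (c := hK.sumCoeff (n + 2) δ * ‖u‖)
    (fun i hi y => ?_) hts x).trans_eq (by ring)
  exact (hK.norm_iteratedFDeriv_le_sumCoeff hs' u (by omega : i ≤ n + 2) y).trans
    (mul_le_mul_of_nonneg_right hmono (norm_nonneg _))

lemma continuousOn_heat (hK : L.SmoothingKernel K α T) (hα : 0 < α) (n : ℕ) (r : ℝ) :
    ContinuousOn (hK.heat n r) (Ioc 0 T) := by
  have key : ∀ δ, 0 < δ → ContinuousOn (hK.heat n r) (Icc δ T) := fun δ hδ => by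
    have hd0 : 0 ≤ hK.sumCoeff (n + 2) δ := Finset.sum_nonneg fun i _ =>
      mul_nonneg (hK.coeff_nonneg i) (Real.rpow_nonneg hδ.le _)
    have hop := L.opBound_nonneg
    refine (LipschitzOnWith.of_dist_le_mul
      (K := Real.toNNReal ((n + 1) * (L.opBound * hK.sumCoeff (n + 2) δ)))
      fun t ht s hs => ?_).continuousOn
    rw [Real.coe_toNNReal _ (by positivity)]
    rcases le_total s t with h | h
    · rw [dist_eq_norm, Real.dist_eq, abs_of_nonneg (sub_nonneg.2 h)]
      exact (hK.norm_heat_sub_le hα hδ hs ht h).trans_eq (by ring)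
    · rw [dist_comm, dist_comm t, dist_eq_norm, Real.dist_eq, abs_of_nonneg (sub_nonneg.2 h)]
      exact (hK.norm_heat_sub_le hα hδ ht hs h).trans_eq (by ring)
  intro t ht
  have ht0 := ht.1
  refine (key (t / 2) (by positivity) t ⟨by linarith, ht.2⟩).mono_of_mem_nhdsWithin ?_
  have : Ioi (t / 2) ∈ 𝓝[Ioc 0 T] t := mem_nhdsWithin_of_mem_nhds (Ioi_mem_nhds (by linarith))
  filter_upwards [this, self_mem_nhdsWithin] with s h1 h2
  exact ⟨le_of_lt h1, h2.2⟩

end LevyTriplet.SmoothingKernel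

end

/-! ### Beta integrals and Volterra integrals with weakly singular kernels -/

section

section kernel

variable {a b t : ℝ}

lemma integrableOn_rpow_neg (ha : a < 1) (ht : 0 < t) :
    IntegrableOn (fun s : ℝ => s ^ (-a)) (Ioo 0 t) := by
  have h := (intervalIntegral.intervalIntegrable_rpow' (r := -a) (a := 0) (b := t) (by linarith))
  exact (((intervalIntegrable_iff_integrableOn_Ioc_of_le ht.le).1 h).mono_set Ioo_subset_Ioc_self)

lemma integral_rpow_neg (ha : a < 1) (ht : 0 < t) :
    ∫ s in Ioo 0 t, s ^ (-a) = t ^ (1 - a) / (1 - a) := by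
  rw [← integral_Ioc_eq_integral_Ioo, ← intervalIntegral.integral_of_le ht.le,
    integral_rpow (Or.inl (by linarith)), Real.zero_rpow (by linarith), sub_zero]
  ring_nf

lemma integrableOn_sub_rpow_neg (ha : a < 1) (ht : 0 < t) :
    IntegrableOn (fun s : ℝ => (t - s) ^ (-a)) (Ioo 0 t) := by
  have h := (intervalIntegral.intervalIntegrable_rpow' (r := -a) (a := 0) (b := t)
    (by linarith)).comp_sub_left t
  rw [sub_zero, sub_self] at h
  exact (((intervalIntegrable_iff_integrableOn_Ioc_of_le ht.le).1 h.symm).mono_set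
    Ioo_subset_Ioc_self)

lemma integral_sub_rpow_neg (ha : a < 1) (ht : 0 < t) :
    ∫ s in Ioo 0 t, (t - s) ^ (-a) = t ^ (1 - a) / (1 - a) := by
  rw [← integral_rpow_neg ha ht, ← integral_Ioc_eq_integral_Ioo, ← integral_Ioc_eq_integral_Ioo,
    ← intervalIntegral.integral_of_le ht.le, ← intervalIntegral.integral_of_le ht.le,
    intervalIntegral.integral_comp_sub_left (fun s => s ^ (-a)) t, sub_zero, sub_self]

/-- On either side of `t / 2` only one of the two factors is singular; the other is at most its
value at `t / 2`. -/
lemma sub_rpow_mul_rpow_le (ha0 : 0 ≤ a) (hb0 : 0 ≤ b) {s : ℝ} (hs : s ∈ Ioo 0 t) :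
    (t - s) ^ (-a) * s ^ (-b) ≤ (t / 2) ^ (-a) * s ^ (-b) + (t / 2) ^ (-b) * (t - s) ^ (-a) := by
  obtain ⟨hs0, hst⟩ := hs
  have h1 : 0 ≤ (t - s) ^ (-a) := Real.rpow_nonneg (by linarith) _
  have h2 : 0 ≤ s ^ (-b) := Real.rpow_nonneg hs0.le _
  have h3 : 0 ≤ (t / 2) ^ (-a) := Real.rpow_nonneg (by linarith) _
  have h4 : 0 ≤ (t / 2) ^ (-b) := Real.rpow_nonneg (by linarith) _
  rcases le_total s (t / 2) with h | h
  · have : (t - s) ^ (-a) ≤ (t / 2) ^ (-a) :=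
      Real.rpow_le_rpow_of_nonpos (by linarith) (by linarith) (by linarith)
    nlinarith [mul_nonneg h4 h1, mul_le_mul_of_nonneg_right this h2]
  · have : s ^ (-b) ≤ (t / 2) ^ (-b) :=
      Real.rpow_le_rpow_of_nonpos (by linarith) (by linarith) (by linarith)
    nlinarith [mul_nonneg h3 h2, mul_le_mul_of_nonneg_right this h1]

lemma integrableOn_sub_rpow_mul_rpow (ha0 : 0 ≤ a) (ha : a < 1) (hb0 : 0 ≤ b) (hb : b < 1)
    (ht : 0 < t) : IntegrableOn (fun s : ℝ => (t - s) ^ (-a) * s ^ (-b)) (Ioo 0 t) := by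
  refine (((integrableOn_rpow_neg hb ht).const_mul ((t / 2) ^ (-a))).add
    ((integrableOn_sub_rpow_neg ha ht).const_mul ((t / 2) ^ (-b)))).mono' ?_ ?_
  · exact Measurable.aestronglyMeasurable (by fun_prop)
  · refine (ae_restrict_mem measurableSet_Ioo).mono fun s hs => ?_
    rw [Real.norm_of_nonneg (mul_nonneg (Real.rpow_nonneg (by linarith [hs.2]) _)
      (Real.rpow_nonneg hs.1.le _))]
    exact sub_rpow_mul_rpow_le ha0 hb0 hs

/-- A bound of the Beta function at `(1 - a, 1 - b)`. -/
def betaBound (a b : ℝ) : ℝ := 2 ^ a / (1 - b) + 2 ^ b / (1 - a)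

lemma betaBound_nonneg (ha : a < 1) (hb : b < 1) : 0 ≤ betaBound a b := by
  have h1 : 0 < 1 - a := by linarith
  have h2 : 0 < 1 - b := by linarith
  unfold betaBound
  positivity

lemma integral_sub_rpow_mul_rpow_le (ha0 : 0 ≤ a) (ha : a < 1) (hb0 : 0 ≤ b) (hb : b < 1)
    (ht : 0 < t) :
    ∫ s in Ioo 0 t, (t - s) ^ (-a) * s ^ (-b) ≤ betaBound a b * t ^ (1 - a - b) := by
  have h1 := (integrableOn_rpow_neg hb ht).const_mul ((t / 2) ^ (-a))
  have h2 := (integrableOn_sub_rpow_neg ha ht).const_mul ((t / 2) ^ (-b))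
  refine (setIntegral_mono_on (integrableOn_sub_rpow_mul_rpow ha0 ha hb0 hb ht) (h1.add h2)
    measurableSet_Ioo fun s hs => sub_rpow_mul_rpow_le ha0 hb0 hs).trans_eq ?_
  simp only [Pi.add_apply]
  rw [integral_add h1 h2, integral_const_mul, integral_const_mul, integral_rpow_neg hb ht,
    integral_sub_rpow_neg ha ht, Real.div_rpow ht.le zero_le_two, Real.div_rpow ht.le zero_le_two,
    Real.rpow_neg zero_le_two, Real.rpow_neg zero_le_two, betaBound]
  have e1 : t ^ (-a) * t ^ (1 - b) = t ^ (1 - a - b) := by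
    rw [← Real.rpow_add ht]; ring_nf
  have e2 : t ^ (-b) * t ^ (1 - a) = t ^ (1 - a - b) := by
    rw [← Real.rpow_add ht]; ring_nf
  rw [div_inv_eq_mul, div_inv_eq_mul, add_mul, ← e1]
  nth_rewrite 2 [e1]
  rw [← e2]
  ring

/-- Used with `x = λ(t - s)`: part of the exponential decay is traded for a slightly stronger
singularity and the small factor `λ^{-ε}`. -/
lemma rpow_mul_exp_neg_le {ε x : ℝ} (hε0 : 0 ≤ ε) (hε : ε ≤ 1) (hx : 0 < x) :
    Real.exp (-x) ≤ x ^ (-ε) := by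
  rw [Real.exp_neg, Real.rpow_neg hx.le]
  refine inv_anti₀ (Real.rpow_pos_of_pos hx _) ?_
  rcases le_total x 1 with h | h
  · exact (Real.rpow_le_one hx.le h hε0).trans (Real.one_le_exp hx.le)
  · calc x ^ ε ≤ x ^ (1 : ℝ) := Real.rpow_le_rpow_of_exponent_le h hε
      _ = x := Real.rpow_one x
      _ ≤ _ := by linarith [Real.add_one_le_exp x]

end kernel

section volterra

variable {X Y : Type} [NormedAddCommGroup X] [NormedSpace ℝ X]
  [NormedAddCommGroup Y] [NormedSpace ℝ Y] {S : ℝ → Y →L[ℝ] X} {q : ℝ → Y} {T a b c M t : ℝ}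

/-- The Volterra integral `∫_0^t S(t-s) q(s) ds`. -/
def volterra (S : ℝ → Y →L[ℝ] X) (q : ℝ → Y) (t : ℝ) : X :=
  ∫ s in Ioo 0 t, S (t - s) (q s)

lemma continuousOn_volterra_integrand (hS : ContinuousOn S (Ioc 0 T))
    (hq : ContinuousOn q (Ioc 0 T)) (ht : t ∈ Ioc 0 T) :
    ContinuousOn (fun s => S (t - s) (q s)) (Ioo 0 t) := by
  refine ContinuousOn.clm_apply (hS.comp (by fun_prop) fun s hs => ?_)
    (hq.mono fun s hs => ⟨hs.1, hs.2.le.trans ht.2⟩)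
  exact ⟨by linarith [hs.2], by linarith [hs.1, ht.2]⟩

lemma norm_volterra_integrand_le (hSb : ∀ t ∈ Ioc 0 T, ‖S t‖ ≤ c * t ^ (-a))
    {k : ℝ → ℝ} (hqb : ∀ t ∈ Ioc 0 T, ‖q t‖ ≤ k t) (ht : t ∈ Ioc 0 T) {s : ℝ} (hs : s ∈ Ioo 0 t) :
    ‖S (t - s) (q s)‖ ≤ c * (t - s) ^ (-a) * k s := by
  have h1 := hSb (t - s) ⟨by linarith [hs.2], by linarith [hs.1, ht.2]⟩
  have h2 := hqb s ⟨hs.1, hs.2.le.trans ht.2⟩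
  exact (ContinuousLinearMap.le_opNorm _ _).trans
    (mul_le_mul h1 h2 (norm_nonneg _) ((norm_nonneg _).trans h1))

lemma integrableOn_volterra (ha0 : 0 ≤ a) (ha : a < 1) (hb0 : 0 ≤ b) (hb : b < 1)
    (hS : ContinuousOn S (Ioc 0 T)) (hSb : ∀ t ∈ Ioc 0 T, ‖S t‖ ≤ c * t ^ (-a))
    (hq : ContinuousOn q (Ioc 0 T)) (hqb : ∀ t ∈ Ioc 0 T, ‖q t‖ ≤ M * t ^ (-b))
    (ht : t ∈ Ioc 0 T) : IntegrableOn (fun s => S (t - s) (q s)) (Ioo 0 t) := by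
  refine ((integrableOn_sub_rpow_mul_rpow ha0 ha hb0 hb ht.1).const_mul (c * M)).mono'
    ((continuousOn_volterra_integrand hS hq ht).aestronglyMeasurable measurableSet_Ioo) ?_
  refine (ae_restrict_mem measurableSet_Ioo).mono fun s hs => ?_
  exact (norm_volterra_integrand_le hSb hqb ht hs).trans_eq (by ring)

lemma norm_volterra_le (ha0 : 0 ≤ a) (ha : a < 1) (hb0 : 0 ≤ b) (hb : b < 1)
    (hcM : 0 ≤ c * M) (hSb : ∀ t ∈ Ioc 0 T, ‖S t‖ ≤ c * t ^ (-a))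
    (hqb : ∀ t ∈ Ioc 0 T, ‖q t‖ ≤ M * t ^ (-b)) (ht : t ∈ Ioc 0 T) :
    ‖volterra S q t‖ ≤ c * M * (betaBound a b * t ^ (1 - a - b)) := by
  have hi := (integrableOn_sub_rpow_mul_rpow ha0 ha hb0 hb ht.1).const_mul (c * M)
  refine (norm_integral_le_of_norm_le hi ?_).trans ?_
  · refine (ae_restrict_mem measurableSet_Ioo).mono fun s hs => ?_
    exact (norm_volterra_integrand_le hSb hqb ht hs).trans_eq (by ring)
  · rw [integral_const_mul]
    exact mul_le_mul_of_nonneg_left (integral_sub_rpow_mul_rpow_le ha0 ha hb0 hb ht.1) hcM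

/-- Rescaling to a fixed interval of integration, so that continuity in `t` follows from dominated
convergence. -/
lemma volterra_eq (ht : 0 < t) :
    volterra S q t = t • ∫ θ in Ioo (0 : ℝ) 1, S (t * (1 - θ)) (q (t * θ)) := by
  have h := intervalIntegral.smul_integral_comp_mul_left (a := 0) (b := 1)
    (fun s => S (t - s) (q s)) t
  rw [mul_zero, mul_one, intervalIntegral.integral_of_le zero_le_one,
    intervalIntegral.integral_of_le ht.le, integral_Ioc_eq_integral_Ioo,
    integral_Ioc_eq_integral_Ioo] at h
  rw [volterra, ← h]
  simp_rw [mul_sub, mul_one]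

lemma continuousOn_volterra (ha0 : 0 ≤ a) (ha : a < 1) (hb0 : 0 ≤ b) (hb : b < 1)
    (hcM : 0 ≤ c) (hM : 0 ≤ M)
    (hS : ContinuousOn S (Ioc 0 T)) (hSb : ∀ t ∈ Ioc 0 T, ‖S t‖ ≤ c * t ^ (-a))
    (hq : ContinuousOn q (Ioc 0 T)) (hqb : ∀ t ∈ Ioc 0 T, ‖q t‖ ≤ M * t ^ (-b)) :
    ContinuousOn (volterra S q) (Ioc 0 T) := by
  refine ContinuousOn.congr (f := fun t => t • ∫ θ in Ioo (0 : ℝ) 1, S (t * (1 - θ)) (q (t * θ)))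
    (continuousOn_id.smul fun t ht => ?_) fun t ht => volterra_eq ht.1
  have ht0 := ht.1
  have h1 : ∀ t ∈ Ioc 0 T, ∀ θ ∈ Ioo (0 : ℝ) 1, t * (1 - θ) ∈ Ioc 0 T := fun t ht θ hθ =>
    ⟨mul_pos ht.1 (by linarith [hθ.2]), by nlinarith [hθ.1, ht.1, ht.2]⟩
  have h2 : ∀ t ∈ Ioc 0 T, ∀ θ ∈ Ioo (0 : ℝ) 1, t * θ ∈ Ioc 0 T := fun t ht θ hθ =>
    ⟨mul_pos ht.1 hθ.1, by nlinarith [hθ.2, ht.1, ht.2]⟩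
  have hcont : ContinuousOn (fun p : ℝ × ℝ => S (p.1 * (1 - p.2)) (q (p.1 * p.2)))
      (Ioc 0 T ×ˢ Ioo 0 1) :=
    (hS.comp (f := fun p : ℝ × ℝ => p.1 * (1 - p.2)) (by fun_prop)
      fun p hp => h1 _ hp.1 _ hp.2).clm_apply
      (hq.comp (f := fun p : ℝ × ℝ => p.1 * p.2) (by fun_prop) fun p hp => h2 _ hp.1 _ hp.2)
  -- Only times `s > t / 2` matter near `t`; there the negative powers of `s` are at most those of
  -- `t / 2`, which makes the bound independent of `s`.
  refine continuousWithinAt_of_dominated (bound := fun θ =>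
    c * M * (t / 2) ^ (-a) * (t / 2) ^ (-b) * ((1 - θ) ^ (-a) * θ ^ (-b))) ?_ ?_ ?_ ?_
  · filter_upwards [self_mem_nhdsWithin] with s hs
    refine ContinuousOn.aestronglyMeasurable ?_ measurableSet_Ioo
    exact hcont.comp (f := fun θ : ℝ => (s, θ)) (by fun_prop) fun θ hθ => ⟨hs, hθ⟩
  · have hI : Ioi (t / 2) ∈ 𝓝[Ioc 0 T] t := mem_nhdsWithin_of_mem_nhds (Ioi_mem_nhds (by linarith))
    filter_upwards [hI, self_mem_nhdsWithin] with s hs hsT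
    refine (ae_restrict_mem measurableSet_Ioo).mono fun θ hθ => ?_
    have hθ' : 0 < 1 - θ := by linarith [hθ.2]
    have hs2 : t / 2 ≤ s := le_of_lt hs
    have b1 := hSb _ (h1 s hsT θ hθ)
    have b2 := hqb _ (h2 s hsT θ hθ)
    have e1 : (s * (1 - θ)) ^ (-a) ≤ (t / 2) ^ (-a) * (1 - θ) ^ (-a) := by
      rw [Real.mul_rpow hsT.1.le hθ'.le]
      exact mul_le_mul_of_nonneg_right
        (Real.rpow_le_rpow_of_nonpos (by positivity) hs2 (by linarith))
        (Real.rpow_nonneg hθ'.le _)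
    have e2 : (s * θ) ^ (-b) ≤ (t / 2) ^ (-b) * θ ^ (-b) := by
      rw [Real.mul_rpow hsT.1.le hθ.1.le]
      exact mul_le_mul_of_nonneg_right
        (Real.rpow_le_rpow_of_nonpos (by positivity) hs2 (by linarith))
        (Real.rpow_nonneg hθ.1.le _)
    calc _ ≤ ‖S (s * (1 - θ))‖ * ‖q (s * θ)‖ := ContinuousLinearMap.le_opNorm _ _
      _ ≤ (c * ((t / 2) ^ (-a) * (1 - θ) ^ (-a))) * (M * ((t / 2) ^ (-b) * θ ^ (-b))) := by
          refine mul_le_mul (b1.trans ?_) (b2.trans ?_) (norm_nonneg _) ?_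
          · gcongr
          · gcongr
          · have := Real.rpow_nonneg hθ'.le (-a)
            positivity
      _ = _ := by ring
  · exact (integrableOn_sub_rpow_mul_rpow ha0 ha hb0 hb one_pos).const_mul _
  · refine (ae_restrict_mem measurableSet_Ioo).mono fun θ hθ => ?_
    exact (hcont.comp (f := fun s : ℝ => (s, θ)) (by fun_prop) fun s hs => ⟨hs, hθ⟩) t ht

/-- The integral vanishes in the quotient by the closed subspace. Without integrability the integral
is `0` by convention, which also lies in the subspace. -/
lemma volterra_mem [CompleteSpace X] (P : Submodule ℝ X) (hP : IsClosed (P : Set X))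
    (h : ∀ s ∈ Ioo 0 t, S (t - s) (q s) ∈ P) : volterra S q t ∈ P := by
  by_cases hi : IntegrableOn (fun s => S (t - s) (q s)) (Ioo 0 t)
  · have hc : IsClosed (P : Set X) := hP
    have hmk : P.mkQL (volterra S q t) = 0 := by
      rw [volterra, ← ContinuousLinearMap.integral_comp_comm _ hi]
      refine setIntegral_eq_zero_of_forall_eq_zero fun s hs => ?_
      exact (Submodule.Quotient.mk_eq_zero P).2 (h s hs)
    exact (Submodule.Quotient.mk_eq_zero P).1 hmk
  · rw [volterra, integral_undef hi]
    exact P.zero_mem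

end volterra

end

/-! ### Mild equations: contraction in a weighted norm -/

section

section fixedPoint

open scoped BoundedContinuousFunction

variable {X Y : Type} [NormedAddCommGroup X] [NormedSpace ℝ X]
  [NormedAddCommGroup Y] [NormedSpace ℝ Y] {S : ℝ → Y →L[ℝ] X} {q : ℝ → Y}
  {T a c M t lam ε β F : ℝ}

lemma volterra_sub {q' : ℝ → Y} (h : IntegrableOn (fun s => S (t - s) (q s)) (Ioo 0 t))
    (h' : IntegrableOn (fun s => S (t - s) (q' s)) (Ioo 0 t)) :
    volterra S q t - volterra S q' t = volterra S (fun s => q s - q' s) t := by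
  unfold volterra
  rw [← integral_sub h h']
  simp_rw [map_sub]

/-- The kernel can afford a singularity stronger by `ε` because `a + ε < 1`. In exchange the
exponential weight provides `λ^{-ε}`, so for large `λ` the operator is a contraction on the whole of
`(0,T]` and no iteration over short time intervals is needed. -/
lemma weighted_volterra_le (ha0 : 0 ≤ a) (hε : 0 < ε) (hε1 : a + ε < 1) (hlam : 0 < lam)
    (hc : 0 ≤ c) (hM : 0 ≤ M) (hSb : ∀ t ∈ Ioc 0 T, ‖S t‖ ≤ c * t ^ (-a))
    (hqb : ∀ t ∈ Ioc 0 T, ‖q t‖ ≤ M * (t ^ (-a) * Real.exp (lam * t))) (ht : t ∈ Ioc 0 T) :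
    t ^ a * Real.exp (-(lam * t)) * ‖volterra S q t‖ ≤
      c * M * lam ^ (-ε) * betaBound (a + ε) a * T ^ (1 - a - ε) := by
  have ht0 := ht.1
  have hi := (integrableOn_sub_rpow_mul_rpow (a := a + ε) (b := a) (by linarith) hε1 ha0
    (by linarith) ht.1).const_mul (c * M * lam ^ (-ε) * Real.exp (lam * t))
  have h1 : ‖volterra S q t‖ ≤ c * M * lam ^ (-ε) * Real.exp (lam * t) *
      (betaBound (a + ε) a * t ^ (1 - (a + ε) - a)) := by
    refine (norm_integral_le_of_norm_le hi ?_).trans ?_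
    · refine (ae_restrict_mem measurableSet_Ioo).mono fun s hs => ?_
      have hts : 0 < t - s := by linarith [hs.2]
      refine (norm_volterra_integrand_le hSb hqb ht hs).trans ?_
      have e1 : Real.exp (lam * s) ≤ Real.exp (lam * t) * (lam ^ (-ε) * (t - s) ^ (-ε)) := by
        have := rpow_mul_exp_neg_le hε.le (by linarith) (mul_pos hlam hts)
        rw [Real.mul_rpow hlam.le hts.le] at this
        calc Real.exp (lam * s) = Real.exp (lam * t) * Real.exp (-(lam * (t - s))) := by
              rw [← Real.exp_add]; ring_nf
          _ ≤ _ := by gcongr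
      have e2 : (t - s) ^ (-(a + ε)) = (t - s) ^ (-a) * (t - s) ^ (-ε) := by
        rw [← Real.rpow_add hts]; ring_nf
      have p1 : 0 ≤ (t - s) ^ (-a) := Real.rpow_nonneg hts.le _
      have p2 : 0 ≤ s ^ (-a) := Real.rpow_nonneg hs.1.le _
      rw [e2]
      calc c * (t - s) ^ (-a) * (M * (s ^ (-a) * Real.exp (lam * s)))
          ≤ c * (t - s) ^ (-a) * (M * (s ^ (-a) *
            (Real.exp (lam * t) * (lam ^ (-ε) * (t - s) ^ (-ε))))) := by gcongr
        _ = _ := by ring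
    · rw [integral_const_mul]
      exact mul_le_mul_of_nonneg_left (integral_sub_rpow_mul_rpow_le (by linarith) hε1 ha0
        (by linarith) ht.1) (by positivity)
  have hbb : 0 ≤ betaBound (a + ε) a := betaBound_nonneg hε1 (by linarith)
  have e3 : t ^ a * t ^ (1 - (a + ε) - a) = t ^ (1 - a - ε) := by
    rw [← Real.rpow_add ht0]; ring_nf
  have e4 : Real.exp (-(lam * t)) * Real.exp (lam * t) = 1 := by
    rw [← Real.exp_add]; simp
  calc _ ≤ t ^ a * Real.exp (-(lam * t)) * (c * M * lam ^ (-ε) * Real.exp (lam * t) *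
      (betaBound (a + ε) a * t ^ (1 - (a + ε) - a))) := by gcongr
    _ = c * M * lam ^ (-ε) * betaBound (a + ε) a * (t ^ a * t ^ (1 - (a + ε) - a)) *
        (Real.exp (-(lam * t)) * Real.exp (lam * t)) := by ring
    _ = c * M * lam ^ (-ε) * betaBound (a + ε) a * t ^ (1 - a - ε) := by rw [e3, e4, mul_one]
    _ ≤ _ := mul_le_mul_of_nonneg_left
        (Real.rpow_le_rpow ht0.le ht.2 (by linarith)) (by positivity)

/-- The function on `(0,T]` with weighted form `g`. -/
def unweight (a lam : ℝ) (g : Ioc 0 T →ᵇ X) (t : ℝ) : X :=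
  if ht : t ∈ Ioc 0 T then (t ^ (-a) * Real.exp (lam * t)) • g ⟨t, ht⟩ else 0

lemma unweight_of_mem (g : Ioc 0 T →ᵇ X) (ht : t ∈ Ioc 0 T) :
    unweight a lam g t = (t ^ (-a) * Real.exp (lam * t)) • g ⟨t, ht⟩ := dif_pos ht

lemma continuousOn_unweight (g : Ioc 0 T →ᵇ X) : ContinuousOn (unweight a lam g) (Ioc 0 T) := by
  rw [continuousOn_iff_continuous_domRestrict]
  have h : (Ioc 0 T).domRestrict (unweight a lam g) =
      fun t : Ioc 0 T => ((t : ℝ) ^ (-a) * Real.exp (lam * t)) • g t := by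
    funext t
    exact unweight_of_mem g t.2
  rw [h]
  refine Continuous.smul (Continuous.mul ?_ (by fun_prop)) g.continuous
  exact continuous_subtype_val.rpow_const fun t => Or.inl t.2.1.ne'

lemma norm_unweight_le (g : Ioc 0 T →ᵇ X) (ht : t ∈ Ioc 0 T) :
    ‖unweight a lam g t‖ ≤ ‖g‖ * (t ^ (-a) * Real.exp (lam * t)) := by
  have ht0 := ht.1
  rw [unweight_of_mem g ht, norm_smul, Real.norm_of_nonneg (by positivity), mul_comm]
  gcongr
  exact g.norm_coe_le_norm _

lemma norm_unweight_le' (hlam : 0 ≤ lam) (g : Ioc 0 T →ᵇ X) (ht : t ∈ Ioc 0 T) :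
    ‖unweight a lam g t‖ ≤ ‖g‖ * Real.exp (lam * T) * t ^ (-a) := by
  have ht0 := ht.1
  refine (norm_unweight_le g ht).trans ?_
  calc _ = ‖g‖ * Real.exp (lam * t) * t ^ (-a) := by ring
    _ ≤ _ := by
      gcongr
      exact ht.2

lemma unweight_sub (g g' : Ioc 0 T →ᵇ X) (t : ℝ) :
    unweight a lam g t - unweight a lam g' t = unweight a lam (g - g') t := by
  by_cases ht : t ∈ Ioc 0 T
  · simp only [unweight_of_mem _ ht]
    rw [← smul_sub]
    rfl
  · simp [unweight, ht]

variable {B : ℝ → X →L[ℝ] Y} {W : ℝ → Y}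

/-- The right-hand side `S(t) y₀ - ∫_0^t S(t-s) (B(s) ρ(s) + W(s)) ds` of the mild equation. -/
def mildMap (S : ℝ → Y →L[ℝ] X) (B : ℝ → X →L[ℝ] Y) (W : ℝ → Y) (y0 : Y) (ρ : ℝ → X) (t : ℝ) : X :=
  S t y0 - volterra S (fun s => B s (ρ s) + W s) t

lemma norm_source_le (ha0 : 0 ≤ a) (hβ : 0 ≤ β) (hBb : ∀ t ∈ Ioc 0 T, ‖B t‖ ≤ β) (hF : 0 ≤ F)
    (hWb : ∀ t ∈ Ioc 0 T, ‖W t‖ ≤ F) {ρ : ℝ → X} (hρ : ∀ t ∈ Ioc 0 T, ‖ρ t‖ ≤ M * t ^ (-a))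
    (ht : t ∈ Ioc 0 T) : ‖B t (ρ t) + W t‖ ≤ (β * M + F * T ^ a) * t ^ (-a) := by
  have ht0 := ht.1
  -- The bounded source `W` is absorbed into the singular bound.
  have h1 : 1 ≤ T ^ a * t ^ (-a) := by
    rw [Real.rpow_neg ht0.le, ← div_eq_mul_inv, one_le_div (Real.rpow_pos_of_pos ht0 _)]
    exact Real.rpow_le_rpow ht0.le ht.2 ha0
  calc ‖B t (ρ t) + W t‖ ≤ ‖B t‖ * ‖ρ t‖ + ‖W t‖ :=
        (norm_add_le _ _).trans (by gcongr; exact ContinuousLinearMap.le_opNorm _ _)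
    _ ≤ β * (M * t ^ (-a)) + F * (T ^ a * t ^ (-a)) := by
        gcongr
        · exact hBb t ht
        · exact hρ t ht
        · exact (hWb t ht).trans (le_mul_of_one_le_right hF h1)
    _ = _ := by ring

lemma continuousOn_source (hB : ContinuousOn B (Ioc 0 T)) (hW : ContinuousOn W (Ioc 0 T))
    {ρ : ℝ → X} (hρ : ContinuousOn ρ (Ioc 0 T)) :
    ContinuousOn (fun s => B s (ρ s) + W s) (Ioc 0 T) :=
  (hB.clm_apply hρ).add hW

lemma continuousOn_mildMap (ha0 : 0 ≤ a) (ha : a < 1) (hT : 0 ≤ T) (hc : 0 ≤ c) (hβ : 0 ≤ β)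
    (hM : 0 ≤ M) (hF : 0 ≤ F)
    (hS : ContinuousOn S (Ioc 0 T)) (hSb : ∀ t ∈ Ioc 0 T, ‖S t‖ ≤ c * t ^ (-a))
    (hB : ContinuousOn B (Ioc 0 T)) (hBb : ∀ t ∈ Ioc 0 T, ‖B t‖ ≤ β)
    (hW : ContinuousOn W (Ioc 0 T)) (hWb : ∀ t ∈ Ioc 0 T, ‖W t‖ ≤ F) (y0 : Y) {ρ : ℝ → X}
    (hρ : ContinuousOn ρ (Ioc 0 T)) (hρb : ∀ t ∈ Ioc 0 T, ‖ρ t‖ ≤ M * t ^ (-a)) :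
    ContinuousOn (mildMap S B W y0 ρ) (Ioc 0 T) :=
  (hS.clm_apply continuousOn_const).sub
    (continuousOn_volterra ha0 ha ha0 ha hc (by positivity) hS hSb (continuousOn_source hB hW hρ)
      fun _ ht => norm_source_le ha0 hβ hBb hF hWb hρb ht)

lemma weighted_mildMap_le (ha0 : 0 ≤ a) (hε : 0 < ε) (hε1 : a + ε < 1) (hlam : 0 < lam) (hT : 0 ≤ T)
    (hc : 0 ≤ c) (hβ : 0 ≤ β) (hM : 0 ≤ M) (hF : 0 ≤ F)
    (hSb : ∀ t ∈ Ioc 0 T, ‖S t‖ ≤ c * t ^ (-a)) (hBb : ∀ t ∈ Ioc 0 T, ‖B t‖ ≤ β)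
    (hWb : ∀ t ∈ Ioc 0 T, ‖W t‖ ≤ F) (y0 : Y) {ρ : ℝ → X}
    (hρb : ∀ t ∈ Ioc 0 T, ‖ρ t‖ ≤ M * t ^ (-a)) (ht : t ∈ Ioc 0 T) :
    t ^ a * Real.exp (-(lam * t)) * ‖mildMap S B W y0 ρ t‖ ≤
      c * ‖y0‖ + c * (β * M + F * T ^ a) * lam ^ (-ε) * betaBound (a + ε) a * T ^ (1 - a - ε) := by
  have ht0 := ht.1
  have h1 := weighted_volterra_le (q := fun s => B s (ρ s) + W s) (M := β * M + F * T ^ a)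
    ha0 hε hε1 hlam hc (by positivity) hSb (fun s hs => ?_) ht
  · have he : Real.exp (-(lam * t)) ≤ 1 := Real.exp_le_one_iff.2 (by
      have := mul_pos hlam ht0
      linarith)
    have h2 : t ^ a * Real.exp (-(lam * t)) * ‖S t y0‖ ≤ c * ‖y0‖ := by
      calc _ ≤ t ^ a * 1 * (c * t ^ (-a) * ‖y0‖) := by
            gcongr
            exact (ContinuousLinearMap.le_opNorm _ _).trans (by gcongr; exact hSb t ht)
        _ = c * ‖y0‖ * (t ^ a * t ^ (-a)) := by ring
        _ = _ := by rw [← Real.rpow_add ht0, add_neg_cancel, Real.rpow_zero, mul_one]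
    calc _ ≤ t ^ a * Real.exp (-(lam * t)) * (‖S t y0‖ +
          ‖volterra S (fun s => B s (ρ s) + W s) t‖) := by
          gcongr
          exact norm_sub_le _ _
      _ ≤ _ := by rw [mul_add]; exact add_le_add h2 h1
  · have hs0 := hs.1
    refine (norm_source_le ha0 hβ hBb hF hWb hρb hs).trans ?_
    gcongr
    refine le_mul_of_one_le_right (by positivity) (Real.one_le_exp (by positivity))

lemma weighted_mildMap_sub_le (ha0 : 0 ≤ a) (hε : 0 < ε) (hε1 : a + ε < 1) (hlam : 0 < lam)
    (hc : 0 ≤ c) (hβ : 0 ≤ β) (hF : 0 ≤ F)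
    (hS : ContinuousOn S (Ioc 0 T)) (hSb : ∀ t ∈ Ioc 0 T, ‖S t‖ ≤ c * t ^ (-a))
    (hB : ContinuousOn B (Ioc 0 T)) (hBb : ∀ t ∈ Ioc 0 T, ‖B t‖ ≤ β)
    (hW : ContinuousOn W (Ioc 0 T)) (hWb : ∀ t ∈ Ioc 0 T, ‖W t‖ ≤ F) (y0 : Y)
    (g g' : Ioc 0 T →ᵇ X) (ht : t ∈ Ioc 0 T) :
    t ^ a * Real.exp (-(lam * t)) * ‖mildMap S B W y0 (unweight a lam g) t -
        mildMap S B W y0 (unweight a lam g') t‖ ≤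
      c * (β * ‖g - g'‖) * lam ^ (-ε) * betaBound (a + ε) a * T ^ (1 - a - ε) := by
  have ha : a < 1 := by linarith
  have hi : ∀ g : Ioc 0 T →ᵇ X, IntegrableOn (fun s => S (t - s)
      (B s (unweight a lam g s) + W s)) (Ioo 0 t) := fun g =>
    integrableOn_volterra ha0 ha ha0 ha hS hSb (continuousOn_source hB hW (continuousOn_unweight g))
      (fun s hs => norm_source_le ha0 hβ hBb hF hWb
        (fun r hr => norm_unweight_le' hlam.le g hr) hs) ht
  have h1 : mildMap S B W y0 (unweight a lam g) t - mildMap S B W y0 (unweight a lam g') t =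
      -volterra S (fun s => B s (unweight a lam (g - g') s)) t := by
    have h2 : ∀ s, B s (unweight a lam (g - g') s) =
        (B s (unweight a lam g s) + W s) - (B s (unweight a lam g' s) + W s) := fun s => by
      rw [← unweight_sub, map_sub]
      abel
    simp_rw [h2]
    rw [← volterra_sub (hi g) (hi g'), mildMap, mildMap]
    abel
  rw [h1, norm_neg]
  refine weighted_volterra_le ha0 hε hε1 hlam hc (by positivity) hSb (fun s hs => ?_) ht
  calc _ ≤ ‖B s‖ * ‖unweight a lam (g - g') s‖ := ContinuousLinearMap.le_opNorm _ _
    _ ≤ β * (‖g - g'‖ * (s ^ (-a) * Real.exp (lam * s))) :=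
        mul_le_mul (hBb s hs) (norm_unweight_le _ hs) (norm_nonneg _) hβ
    _ = _ := by ring

lemma exists_contraction_rate {A : ℝ} (hA : 0 ≤ A) (hε : 0 < ε) :
    ∃ lam : ℝ, 0 < lam ∧ A * lam ^ (-ε) ≤ 1 / 2 := by
  refine ⟨(2 * A + 1) ^ (1 / ε), by positivity, ?_⟩
  rw [← Real.rpow_mul (by positivity)]
  have : 1 / ε * -ε = -1 := by field_simp
  rw [this, Real.rpow_neg_one, ← div_eq_mul_inv, div_le_iff₀ (by positivity)]
  linarith

/-- Existence for mild equations with a singular kernel, with a bound which is uniform in the data,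
and invariance of closed subspaces. -/
theorem exists_mild_solution [CompleteSpace X] (hT : 0 < T) (ha0 : 0 ≤ a) (ha : a < 1) (hc : 0 ≤ c)
    (hβ : 0 ≤ β) (hS : ContinuousOn S (Ioc 0 T)) (hSb : ∀ t ∈ Ioc 0 T, ‖S t‖ ≤ c * t ^ (-a))
    (hB : ContinuousOn B (Ioc 0 T)) (hBb : ∀ t ∈ Ioc 0 T, ‖B t‖ ≤ β) :
    ∃ C : ℝ, 0 ≤ C ∧ ∀ (y0 : Y) (W : ℝ → Y) (F : ℝ), 0 ≤ F → ContinuousOn W (Ioc 0 T) →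
      (∀ t ∈ Ioc 0 T, ‖W t‖ ≤ F) → ∃ ρ : ℝ → X, ContinuousOn ρ (Ioc 0 T) ∧
        (∀ t ∈ Ioc 0 T, ‖ρ t‖ ≤ C * (F + ‖y0‖) * t ^ (-a)) ∧
        (∀ t ∈ Ioc 0 T, ρ t = mildMap S B W y0 ρ t) ∧
        ∀ P : Submodule ℝ X, IsClosed (P : Set X) → (∀ t ∈ Ioc 0 T, S t y0 ∈ P) →
          (∀ t ∈ Ioc 0 T, ∀ s ∈ Ioc 0 T, S t (W s) ∈ P) →
          (∀ t ∈ Ioc 0 T, ∀ s ∈ Ioc 0 T, ∀ x ∈ P, S t (B s x) ∈ P) → ∀ t ∈ Ioc 0 T, ρ t ∈ P := by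
  obtain ⟨ε, hε, hε1⟩ : ∃ ε : ℝ, 0 < ε ∧ a + ε < 1 := ⟨(1 - a) / 2, by linarith, by linarith⟩
  have hbb : 0 ≤ betaBound (a + ε) a := betaBound_nonneg hε1 ha
  obtain ⟨lam, hlam, hrate⟩ := exists_contraction_rate
    (A := c * β * betaBound (a + ε) a * T ^ (1 - a - ε)) (ε := ε) (by positivity) hε
  set D : ℝ := lam ^ (-ε) * betaBound (a + ε) a * T ^ (1 - a - ε) with hD
  have hD0 : 0 ≤ D := by positivity
  -- The image of `0` is bounded by `(c + c T^a D)(F + ‖y0‖)`, the factor `2` comes from the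
  -- contraction rate `1/2`, and `exp (lam * T)` undoes the exponential weight. None of these
  -- depends on the data.
  refine ⟨2 * (c + c * T ^ a * D) * Real.exp (lam * T), by positivity,
    fun y0 W F hF hW hWb => ?_⟩
  have hwpos : ∀ t : Ioc 0 T, 0 ≤ (t : ℝ) ^ a * Real.exp (-(lam * t)) := fun t => by
    have := t.2.1
    positivity
  have hcont : ∀ g : Ioc 0 T →ᵇ X, Continuous fun t : Ioc 0 T =>
      ((t : ℝ) ^ a * Real.exp (-(lam * t))) • mildMap S B W y0 (unweight a lam g) t := fun g => by
    refine Continuous.smul (Continuous.mul ?_ (by fun_prop)) ?_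
    · exact continuous_subtype_val.rpow_const fun t => Or.inl t.2.1.ne'
    · exact continuousOn_iff_continuous_domRestrict.1 (continuousOn_mildMap (M :=
        ‖g‖ * Real.exp (lam * T)) ha0 ha hT.le hc hβ (by positivity) hF hS hSb hB hBb hW hWb y0
        (continuousOn_unweight g) fun t ht => norm_unweight_le' hlam.le g ht)
  have hbd : ∀ (g : Ioc 0 T →ᵇ X) (t : Ioc 0 T),
      ‖((t : ℝ) ^ a * Real.exp (-(lam * t))) • mildMap S B W y0 (unweight a lam g) t‖ ≤
        c * ‖y0‖ + c * (β * (‖g‖ * Real.exp (lam * T)) + F * T ^ a) * lam ^ (-ε) *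
          betaBound (a + ε) a * T ^ (1 - a - ε) := fun g t => by
    rw [norm_smul, Real.norm_of_nonneg (hwpos t)]
    exact weighted_mildMap_le ha0 hε hε1 hlam hT.le hc hβ (by positivity) hF hSb hBb hWb y0
      (fun s hs => norm_unweight_le' hlam.le g hs) t.2
  let Ψ : (Ioc 0 T →ᵇ X) → (Ioc 0 T →ᵇ X) := fun g =>
    BoundedContinuousFunction.ofNormedAddCommGroup _ (hcont g) _ (hbd g)
  have hΨ : ∀ g t, Ψ g t = ((t : ℝ) ^ a * Real.exp (-(lam * t))) •
      mildMap S B W y0 (unweight a lam g) t := fun g t => rfl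
  have hlip : ContractingWith (1 / 2) Ψ := by
    refine ⟨by norm_num, LipschitzWith.of_dist_le_mul fun g g' => ?_⟩
    rw [dist_eq_norm, dist_eq_norm]
    have hk : (((1 / 2 : ℝ≥0)) : ℝ) = 1 / 2 := by simp
    rw [hk]
    refine (BoundedContinuousFunction.norm_le (by positivity)).2 fun t => ?_
    rw [BoundedContinuousFunction.sub_apply, hΨ, hΨ, ← smul_sub, norm_smul,
      Real.norm_of_nonneg (hwpos t)]
    refine (weighted_mildMap_sub_le ha0 hε hε1 hlam hc hβ hF hS hSb hB hBb hW hWb y0 g g'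
      t.2).trans ?_
    calc _ = c * β * betaBound (a + ε) a * T ^ (1 - a - ε) * lam ^ (-ε) * ‖g - g'‖ := by ring
      _ ≤ _ := by gcongr
  set g := hlip.fixedPoint Ψ with hg
  have hfix : Ψ g = g := hlip.fixedPoint_isFixedPt
  have hmild : ∀ t ∈ Ioc 0 T, unweight a lam g t = mildMap S B W y0 (unweight a lam g) t := by
    intro t ht
    have ht0 := ht.1
    have h1 : g ⟨t, ht⟩ = (t ^ a * Real.exp (-(lam * t))) •
        mildMap S B W y0 (unweight a lam g) t := by
      conv_lhs => rw [← hfix]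
      exact hΨ g ⟨t, ht⟩
    have h2 : t ^ (-a) * Real.exp (lam * t) * (t ^ a * Real.exp (-(lam * t))) = 1 := by
      have e1 : t ^ (-a) * t ^ a = 1 := by rw [← Real.rpow_add ht0]; simp
      have e2 : Real.exp (lam * t) * Real.exp (-(lam * t)) = 1 := by rw [← Real.exp_add]; simp
      calc _ = (t ^ (-a) * t ^ a) * (Real.exp (lam * t) * Real.exp (-(lam * t))) := by ring
        _ = 1 := by rw [e1, e2, one_mul]
    rw [unweight_of_mem g ht, h1, smul_smul, h2, one_smul]
  have hgn : ‖g‖ ≤ 2 * (c + c * T ^ a * D) * (F + ‖y0‖) := by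
    have h0 : ‖Ψ 0‖ ≤ c * ‖y0‖ + c * (F * T ^ a) * D := by
      refine (BoundedContinuousFunction.norm_le (by positivity)).2 fun t => ?_
      refine (hbd 0 t).trans_eq ?_
      rw [norm_zero, hD]
      ring
    have h1 : ‖g‖ ≤ ‖Ψ 0‖ + 1 / 2 * ‖g‖ := by
      have h2 : ‖Ψ g - Ψ 0‖ ≤ 1 / 2 * ‖g - 0‖ := by
        have := hlip.toLipschitzWith.dist_le_mul g 0
        rw [dist_eq_norm, dist_eq_norm] at this
        simpa using this
      rw [hfix, sub_zero] at h2
      have h3 := norm_sub_norm_le g (Ψ 0)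
      linarith
    have h4 : c * ‖y0‖ + c * (F * T ^ a) * D ≤ (c + c * T ^ a * D) * (F + ‖y0‖) := by
      have e1 : 0 ≤ c * F := by positivity
      have e2 : 0 ≤ c * T ^ a * D * ‖y0‖ := by positivity
      nlinarith
    linarith
  refine ⟨unweight a lam g, continuousOn_unweight g, fun t ht => ?_, hmild, ?_⟩
  · have ht0 := ht.1
    refine (norm_unweight_le' hlam.le g ht).trans ?_
    calc _ ≤ 2 * (c + c * T ^ a * D) * (F + ‖y0‖) * Real.exp (lam * T) * t ^ (-a) := by gcongr
      _ = _ := by ring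
  · intro P hP h1 h2 h3
    -- The Picard iterates that start from `0` stay in `P` pointwise; this condition is closed under
    -- uniform convergence and so holds for the fixed point.
    have hclosed : IsClosed {g : Ioc 0 T →ᵇ X | ∀ t, g t ∈ P} := by
      simp only [ofPred_forall]
      exact isClosed_iInter fun t => hP.preimage (continuous_eval_const t)
    have hiter : ∀ k, ∀ t, (Ψ^[k] 0) t ∈ P := by
      intro k
      induction k with
      | zero => exact fun t => P.zero_mem
      | succ k ih =>
        intro t
        rw [Function.iterate_succ_apply', hΨ]
        refine P.smul_mem _ (P.sub_mem (h1 t t.2) (volterra_mem P hP fun s hs => ?_))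
        have hs' : s ∈ Ioc 0 T := ⟨hs.1, hs.2.le.trans t.2.2⟩
        have hts : (t : ℝ) - s ∈ Ioc 0 T := ⟨by linarith [hs.2], by linarith [hs.1, t.2.2]⟩
        rw [map_add]
        refine P.add_mem (h3 _ hts _ hs' _ ?_) (h2 _ hts _ hs')
        rw [unweight_of_mem _ hs']
        exact P.smul_mem _ (ih _)
    have hgP := hclosed.mem_of_tendsto (hlip.tendsto_iterate_fixedPoint 0)
      (Eventually.of_forall hiter)
    intro t ht
    rw [unweight_of_mem g ht]
    exact P.smul_mem _ (hgP ⟨t, ht⟩)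

end fixedPoint

end

/-! ### Signed measures, the transport operator and the source functional -/

section

section signed

variable {Ω : Type} [MeasurableSpace Ω] {f : Ω → ℝ}

lemma lsmul_flip_eq : (ContinuousLinearMap.lsmul ℝ ℝ : ℝ →L[ℝ] ℝ →L[ℝ] ℝ).flip =
    ContinuousLinearMap.lsmul ℝ ℝ := by
  ext
  simp

lemma vectorIntegral_toSignedMeasure (m : Measure Ω) [IsFiniteMeasure m] (f : Ω → ℝ) :
    ∫ᵛ x, f x ∂•m.toSignedMeasure = ∫ x, f x ∂m := by
  rw [← lsmul_flip_eq]
  exact VectorMeasure.integral_toSignedMeasure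

lemma norm_vectorIntegral_le (μ : SignedMeasure Ω) (f : Ω → ℝ) :
    |∫ᵛ x, f x ∂•μ| ≤ ∫ x, |f x| ∂μ.totalVariation := by
  rw [SignedMeasure.totalVariation_eq_variation, ← Real.norm_eq_abs]
  refine VectorMeasure.norm_integral_le_integral_norm.trans ?_
  exact mul_le_of_le_one_left (integral_nonneg fun _ => norm_nonneg _)
    ContinuousLinearMap.opNorm_lsmul_le

lemma norm_vectorIntegral_le_of_bound (μ : SignedMeasure Ω) {C : ℝ} (hC : ∀ x, |f x| ≤ C) :
    |∫ᵛ x, f x ∂•μ| ≤ C * (μ.totalVariation univ).toReal := by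
  refine (norm_vectorIntegral_le μ f).trans ((integral_mono_of_nonneg
    (ae_of_all _ fun _ => abs_nonneg _) (integrable_const C) (ae_of_all _ hC)).trans_eq ?_)
  rw [integral_const, smul_eq_mul, mul_comm]
  rfl

end signed

variable {d n : ℕ}

lemma integrable_of_continuous_bounded {m : Measure (E d)} [IsFiniteMeasure m] {f : E d → ℝ}
    (hf : Continuous f) {C : ℝ} (hC : ∀ x, |f x| ≤ C) : Integrable f m :=
  Integrable.of_bound hf.aestronglyMeasurable C (ae_of_all _ hC)

lemma norm_iteratedFDeriv_pd_le {j : ℕ} {u : E d → ℝ} (hu : ContDiff ℝ (j + 1 : ℕ) u) (i : Fin d)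
    (x : E d) : ‖iteratedFDeriv ℝ j (pd i u) x‖ ≤ ‖iteratedFDeriv ℝ (j + 1) u x‖ := by
  have hfd : ContDiff ℝ j (fderiv ℝ u) := hu.fderiv_right (by push_cast; exact le_rfl)
  refine (norm_iteratedFDeriv_clm_apply_const (c := (EuclideanSpace.single i 1 : E d))
    (f := fderiv ℝ u) (N := j) (n := j) hfd.contDiffAt le_rfl).trans ?_
  rw [norm_iteratedFDeriv_fderiv, PiLp.norm_single, norm_one, one_mul]

lemma contDiff_pd {j : ℕ} {u : E d → ℝ} (hu : ContDiff ℝ (j + 1 : ℕ) u) (i : Fin d) :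
    ContDiff ℝ j (pd i u) := by
  have hfd : ContDiff ℝ j (fderiv ℝ u) := hu.fderiv_right (by push_cast; exact le_rfl)
  exact hfd.clm_apply contDiff_const

namespace HolderSpace

lemma norm_iteratedFDeriv_pd_le (u : HolderSpace d n) {j : ℕ} (hj : j + 1 ≤ n) (i : Fin d)
    (x : E d) : ‖iteratedFDeriv ℝ j (pd i (u : E d → ℝ)) x‖ ≤ ‖u‖ :=
  (LevyFP.norm_iteratedFDeriv_pd_le (u.contDiff_nat.of_le (by exact_mod_cast hj)) i x).trans
    (u.norm_iteratedFDeriv_le_nat hj x)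

lemma abs_pd_le (hn : 1 ≤ n) (u : HolderSpace d n) (i : Fin d) (x : E d) :
    |pd i (u : E d → ℝ) x| ≤ ‖u‖ := by
  have := u.norm_iteratedFDeriv_pd_le (j := 0) (by omega) i x
  rwa [norm_iteratedFDeriv_zero] at this

lemma continuous_pd (hn : 1 ≤ n) (u : HolderSpace d n) (i : Fin d) :
    Continuous (pd i (u : E d → ℝ)) :=
  (contDiff_pd (j := 0) (u.contDiff_nat.of_le (by exact_mod_cast hn)) i).continuous

lemma differentiable (hn : 1 ≤ n) (u : HolderSpace d n) : Differentiable ℝ (u : E d → ℝ) :=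
  u.contDiff_nat.differentiable (by
    have : n ≠ 0 := by omega
    exact_mod_cast this)

lemma pd_add (hn : 1 ≤ n) (u v : HolderSpace d n) (i : Fin d) (x : E d) :
    pd i ((u + v : HolderSpace d n) : E d → ℝ) x =
      pd i (u : E d → ℝ) x + pd i (v : E d → ℝ) x := by
  unfold pd
  rw [coe_add, fderiv_add (u.differentiable hn x) (v.differentiable hn x)]
  rfl

lemma pd_smul (hn : 1 ≤ n) (c : ℝ) (u : HolderSpace d n) (i : Fin d) (x : E d) :
    pd i ((c • u : HolderSpace d n) : E d → ℝ) x = c * pd i (u : E d → ℝ) x := by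
  unfold pd
  rw [coe_smul, fderiv_const_smul (u.differentiable hn x)]
  rfl

end HolderSpace

/-- The transport operator `u ↦ b · Du` from `C^n_b` to `C^{n-1}_b`, linear in `u`. -/
def transportLin (hn : 1 ≤ n) (b : Fin d → HolderSpace d n) :
    HolderSpace d n →ₗ[ℝ] HolderSpace d ((n : ℝ) - 1) where
  toFun := transport hn b
  map_add' u v := by
    refine HolderSpace.ext (funext fun x => ?_)
    rw [HolderSpace.coe_add, Pi.add_apply]
    unfold transport
    simp only [HolderSpace.pd_add hn, mul_add, Finset.sum_add_distrib]
  map_smul' c u := by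
    refine HolderSpace.ext (funext fun x => ?_)
    rw [RingHom.id_apply, HolderSpace.coe_smul, Pi.smul_apply]
    unfold transport
    simp only [HolderSpace.pd_smul hn, smul_eq_mul, Finset.mul_sum]
    exact Finset.sum_congr rfl fun i _ => by ring

lemma norm_iteratedFDeriv_mul_pd_le (b u : HolderSpace d n) (i : Fin d) {j : ℕ} (hj : j + 1 ≤ n)
    (x : E d) : ‖iteratedFDeriv ℝ j (fun x => b x * pd i (u : E d → ℝ) x) x‖ ≤
      2 ^ n * ‖b‖ * ‖u‖ := by
  have hb : ContDiff ℝ j (b : E d → ℝ) := b.contDiff_nat.of_le (by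
    have : j ≤ n := by omega
    exact_mod_cast this)
  have hp : ContDiff ℝ j (pd i (u : E d → ℝ)) :=
    contDiff_pd (u.contDiff_nat.of_le (by exact_mod_cast hj)) i
  refine (norm_iteratedFDeriv_mul_le hb hp x le_rfl).trans ?_
  calc _ ≤ ∑ l ∈ Finset.range (j + 1), (j.choose l : ℝ) * (‖b‖ * ‖u‖) := by
        refine Finset.sum_le_sum fun l hl => ?_
        have hl' : l ≤ j := Nat.le_of_lt_succ (Finset.mem_range.1 hl)
        rw [mul_assoc]
        gcongr
        · exact b.norm_iteratedFDeriv_le_nat (by omega) x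
        · exact u.norm_iteratedFDeriv_pd_le (by omega) i x
    _ = 2 ^ j * (‖b‖ * ‖u‖) := by
        rw [← Finset.sum_mul]
        congr 1
        exact_mod_cast Nat.sum_range_choose j
    _ ≤ 2 ^ n * (‖b‖ * ‖u‖) := by
        gcongr
        · norm_num
        · omega
    _ = _ := by ring

lemma norm_transport_le (hn : 1 ≤ n) (b : Fin d → HolderSpace d n) (u : HolderSpace d n) :
    ‖transport hn b u‖ ≤ n * 2 ^ n * (∑ i, ‖b i‖) * ‖u‖ := by
  obtain ⟨k, rfl⟩ : ∃ k, n = k + 1 := ⟨n - 1, by omega⟩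
  have hk : ((k + 1 : ℕ) : ℝ) - 1 = (k : ℝ) := by push_cast; ring
  refine (HolderSpace.norm_le_of_bounds (k := k) hk _
    (C := 2 ^ (k + 1) * (∑ i, ‖b i‖) * ‖u‖) fun j hj x => ?_).trans_eq (by push_cast; ring)
  have hcd : ∀ i, ContDiff ℝ j fun x => b i x * pd i (u : E d → ℝ) x := fun i =>
    ((b i).contDiff_nat.of_le (by
      have : j ≤ k + 1 := by omega
      exact_mod_cast this)).mul
      (contDiff_pd (u.contDiff_nat.of_le (by exact_mod_cast Nat.succ_le_succ hj)) i)
  have h1 : ((transport hn b u : HolderSpace d (((k + 1 : ℕ) : ℝ) - 1)) : E d → ℝ) =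
      fun x => ∑ i, b i x * pd i (u : E d → ℝ) x := rfl
  rw [h1, iteratedFDeriv_fun_sum_apply fun i _ => (hcd i).contDiffAt, Finset.mul_sum,
    Finset.sum_mul]
  refine (norm_sum_le _ _).trans (Finset.sum_le_sum fun i _ => ?_)
  exact norm_iteratedFDeriv_mul_pd_le (b i) u i (by omega) x

/-- The transport operator `u ↦ b · Du` from `C^n_b` to `C^{n-1}_b`. -/
def transportL (hn : 1 ≤ n) (b : Fin d → HolderSpace d n) :
    HolderSpace d n →L[ℝ] HolderSpace d ((n : ℝ) - 1) :=
  (transportLin hn b).mkContinuous (n * 2 ^ n * ∑ i, ‖b i‖) (norm_transport_le hn b)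

lemma transportL_apply (hn : 1 ≤ n) (b : Fin d → HolderSpace d n) (u : HolderSpace d n) :
    transportL hn b u = transport hn b u := rfl

lemma norm_transportL_le (hn : 1 ≤ n) (b : Fin d → HolderSpace d n) :
    ‖transportL hn b‖ ≤ n * 2 ^ n * ∑ i, ‖b i‖ :=
  LinearMap.mkContinuous_norm_le _ (by positivity) _

lemma transportL_sub (hn : 1 ≤ n) (b b' : Fin d → HolderSpace d n) :
    transportL hn b - transportL hn b' = transportL hn (fun i => b i - b' i) := by
  ext u : 1
  refine HolderSpace.ext (funext fun x => ?_)
  rw [sub_apply, HolderSpace.coe_sub, Pi.sub_apply, transportL_apply, transportL_apply,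
    transportL_apply]
  unfold transport
  simp only [HolderSpace.coe_sub, Pi.sub_apply, sub_mul, Finset.sum_sub_distrib]

lemma continuousOn_transportL (hn : 1 ≤ n) {b : ℝ → Fin d → HolderSpace d n} {s : Set ℝ}
    (hb : ∀ i, ContinuousOn (fun t => b t i) s) : ContinuousOn (fun t => transportL hn (b t)) s := by
  intro t ht
  rw [ContinuousWithinAt, tendsto_iff_norm_sub_tendsto_zero]
  have h0 : Tendsto (fun r => (n : ℝ) * 2 ^ n * ∑ i, ‖b r i - b t i‖) (𝓝[s] t) (𝓝 0) := by
    have h1 : ∀ i, Tendsto (fun r => ‖b r i - b t i‖) (𝓝[s] t) (𝓝 0) := fun i =>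
      tendsto_iff_norm_sub_tendsto_zero.1 (hb i t ht)
    have h2 := (tendsto_finsetSum Finset.univ fun i _ => h1 i).const_mul ((n : ℝ) * 2 ^ n)
    simpa using h2
  refine squeeze_zero (fun _ => norm_nonneg _) (fun r => ?_) h0
  rw [transportL_sub]
  exact norm_transportL_le hn _

lemma exists_norm_transportL_le (hn : 1 ≤ n) {b : ℝ → Fin d → HolderSpace d n} {T : ℝ}
    (hb : ∀ i, ContinuousOn (fun t => b t i) (Icc 0 T)) :
    ∃ β : ℝ, 0 ≤ β ∧ ∀ t ∈ Icc 0 T, ‖transportL hn (b t)‖ ≤ β := by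
  obtain ⟨β, hβ⟩ := isCompact_Icc.exists_bound_of_continuousOn (continuousOn_transportL hn hb)
  exact ⟨max β 0, le_max_right _ _, fun t ht => (hβ t ht).trans (le_max_left _ _)⟩

/-- The functional `u ↦ ∑ i, ∫ ∂_i u dV_i` on `C^n_b`. -/
def gradFunctional (hn : 1 ≤ n) (V : Fin d → SignedMeasure (E d)) : NegHolder d n :=
  LinearMap.mkContinuous
    { toFun := fun u => ∑ i, ∫ᵛ y, pd i (u : E d → ℝ) y ∂•(V i)
      map_add' := fun u v => by
        rw [← Finset.sum_add_distrib]
        refine Finset.sum_congr rfl fun i _ => ?_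
        simp only [HolderSpace.pd_add hn]
        refine VectorMeasure.integral_fun_add ?_ ?_
        all_goals
          rw [VectorMeasure.Integrable, ← SignedMeasure.totalVariation_eq_variation]
          exact integrable_of_continuous_bounded (HolderSpace.continuous_pd hn _ i)
            (HolderSpace.abs_pd_le hn _ i)
      map_smul' := fun c u => by
        rw [RingHom.id_apply, Finset.smul_sum]
        refine Finset.sum_congr rfl fun i _ => ?_
        simp only [HolderSpace.pd_smul hn]
        exact VectorMeasure.integral_fun_smul _ _ c _ }
    (tvNorm V) fun u => by
      rw [LinearMap.coe_mk, AddHom.coe_mk, Real.norm_eq_abs, tvNorm, Finset.sum_mul]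
      refine (Finset.abs_sum_le_sum_abs _ _).trans (Finset.sum_le_sum fun i _ => ?_)
      rw [mul_comm]
      exact norm_vectorIntegral_le_of_bound (V i) (u.abs_pd_le hn i)

lemma gradFunctional_apply (hn : 1 ≤ n) (V : Fin d → SignedMeasure (E d)) (u : HolderSpace d n) :
    gradFunctional hn V u = ∑ i, ∫ᵛ y, pd i (u : E d → ℝ) y ∂•(V i) := rfl

lemma tvNorm_nonneg (V : Fin d → SignedMeasure (E d)) : 0 ≤ tvNorm V :=
  Finset.sum_nonneg fun _ _ => ENNReal.toReal_nonneg

lemma norm_gradFunctional_le (hn : 1 ≤ n) (V : Fin d → SignedMeasure (E d)) :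
    ‖gradFunctional hn V‖ ≤ tvNorm V :=
  LinearMap.mkContinuous_norm_le _ (tvNorm_nonneg V) _

lemma abs_integral_le_bLipDist (μ ν : SignedMeasure (E d)) {φ : E d → ℝ} (h1 : ∀ x, |φ x| ≤ 1)
    (h2 : LipschitzWith 1 φ) : |∫ᵛ x, φ x ∂•(μ - ν)| ≤ bLipDist μ ν := by
  refine le_ciSup (f := fun φ : {φ : E d → ℝ // (∀ x, |φ x| ≤ 1) ∧ LipschitzWith 1 φ} =>
    |∫ᵛ x, φ.1 x ∂•(μ - ν)|) ⟨1 * ((μ - ν).totalVariation univ).toReal, ?_⟩ ⟨φ, h1, h2⟩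
  rintro _ ⟨ψ, rfl⟩
  exact norm_vectorIntegral_le_of_bound _ ψ.2.1

/-- If `‖u‖ = 1` in `C^n_b` with `n ≥ 2`, each `∂_i u` is bounded by `1` and `1`-Lipschitz, hence
admissible in the bounded-Lipschitz distance. So continuity of `V₂` for that distance becomes
continuity of the functional in norm. -/
lemma norm_gradFunctional_sub_le (hn : 2 ≤ n) (V V' : Fin d → SignedMeasure (E d)) :
    ‖gradFunctional (one_le_two.trans hn) V - gradFunctional (one_le_two.trans hn) V'‖ ≤
      ∑ i, bLipDist (V i) (V' i) := by
  have hn1 : 1 ≤ n := one_le_two.trans hn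
  refine ContinuousLinearMap.opNorm_le_of_unit_norm (Finset.sum_nonneg fun i _ =>
    Real.iSup_nonneg fun _ => abs_nonneg _) fun u hu => ?_
  rw [sub_apply, gradFunctional_apply, gradFunctional_apply, ← Finset.sum_sub_distrib]
  refine (norm_sum_le _ _).trans (Finset.sum_le_sum fun i _ => ?_)
  have hi : ∀ μ : SignedMeasure (E d), VectorMeasure.Integrable μ (pd i (u : E d → ℝ)) := fun μ => by
    rw [VectorMeasure.Integrable, ← SignedMeasure.totalVariation_eq_variation]
    exact integrable_of_continuous_bounded (u.continuous_pd hn1 i) (u.abs_pd_le hn1 i)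
  rw [← VectorMeasure.integral_sub_vectorMeasure (hi _) (hi _)]
  refine abs_integral_le_bLipDist _ _ (fun x => (u.abs_pd_le hn1 i x).trans hu.le) ?_
  have hcd : ContDiff ℝ (1 : ℕ) (pd i (u : E d → ℝ)) :=
    contDiff_pd (u.contDiff_nat.of_le (by exact_mod_cast hn)) i
  refine lipschitzWith_of_nnnorm_fderiv_le (𝕜 := ℝ) (hcd.differentiable (by simp)) fun x => ?_
  rw [← NNReal.coe_le_coe, coe_nnnorm, NNReal.coe_one, ← norm_iteratedFDeriv_one]
  exact (u.norm_iteratedFDeriv_pd_le hn i x).trans hu.le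

lemma continuousOn_gradFunctional (hn : 2 ≤ n) {V : ℝ → Fin d → SignedMeasure (E d)} {s : Set ℝ}
    (hV : ∀ i, ∀ t ∈ s, Tendsto (fun r => bLipDist (V r i) (V t i)) (𝓝[s] t) (𝓝 0)) :
    ContinuousOn (fun t => gradFunctional (one_le_two.trans hn) (V t)) s := by
  intro t ht
  rw [ContinuousWithinAt, tendsto_iff_norm_sub_tendsto_zero]
  have h2 := tendsto_finsetSum Finset.univ fun i _ => hV i t ht
  rw [Finset.sum_const_zero] at h2
  exact squeeze_zero (fun _ => norm_nonneg _) (fun r => norm_gradFunctional_sub_le hn _ _) h2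

section precomp

variable {U V : Type} [NormedAddCommGroup U] [NormedSpace ℝ U] [NormedAddCommGroup V]
  [NormedSpace ℝ V]

/-- The adjoint of a bounded operator, depending linearly and continuously on the operator. -/
def dualMapL (U V : Type) [NormedAddCommGroup U] [NormedSpace ℝ U] [NormedAddCommGroup V]
    [NormedSpace ℝ V] : (U →L[ℝ] V) →L[ℝ] StrongDual ℝ V →L[ℝ] StrongDual ℝ U :=
  (ContinuousLinearMap.compL ℝ U V ℝ).flip

lemma dualMapL_apply (A : U →L[ℝ] V) (y : StrongDual ℝ V) (u : U) :
    dualMapL U V A y u = y (A u) := rfl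

lemma norm_dualMapL_le (A : U →L[ℝ] V) : ‖dualMapL U V A‖ ≤ ‖A‖ := by
  refine ContinuousLinearMap.opNorm_le_bound _ (norm_nonneg _) fun y => ?_
  refine ContinuousLinearMap.opNorm_le_bound _ (by positivity) fun u => ?_
  rw [dualMapL_apply]
  calc ‖y (A u)‖ ≤ ‖y‖ * (‖A‖ * ‖u‖) :=
        (y.le_opNorm _).trans (mul_le_mul_of_nonneg_left (A.le_opNorm u) (norm_nonneg _))
    _ = _ := by ring

end precomp

end

/-! ### Mild solutions in negative order Hölder spaces -/

section

variable {d : ℕ}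

namespace LevyTriplet.SmoothingKernel

variable {L : LevyTriplet d} {K : ℝ → E d → ℝ} {α T t r a M γ : ℝ} {n : ℕ}
  {q : ℝ → NegHolder d n} {y0 : NegHolder d n}

/-- The adjoint of the heat flow at time `t`, from `C^{-n}_b` to `C^{-r}_b`. -/
def dualHeat (hK : L.SmoothingKernel K α T) (n : ℕ) (r t : ℝ) : NegHolder d n →L[ℝ] NegHolder d r :=
  dualMapL _ _ (hK.heat n r t)

lemma dualHeat_apply (hK : L.SmoothingKernel K α T) (y : NegHolder d n) (u : HolderSpace d r) :
    hK.dualHeat n r t y u = y (hK.heat n r t u) := rfl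

lemma continuousOn_dualHeat (hK : L.SmoothingKernel K α T) (hα : 0 < α) (n : ℕ) (r : ℝ) :
    ContinuousOn (hK.dualHeat n r) (Ioc 0 T) :=
  (dualMapL _ _).continuous.comp_continuousOn (hK.continuousOn_heat hα n r)

lemma exists_norm_dualHeat_le (hK : L.SmoothingKernel K α T) (hα : 0 < α) (hγ0 : 0 ≤ γ)
    (hγ : γ < n) :
    ∃ c : ℝ, 0 ≤ c ∧ ∀ t ∈ Ioc 0 T, ‖hK.dualHeat n (n - γ) t‖ ≤ c * t ^ (-(γ / α)) := by
  obtain ⟨c, hc0, hc⟩ := hK.exists_norm_heat_le hα hγ0 hγ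
  exact ⟨c, hc0, fun t ht => (norm_dualMapL_le _).trans (hc t ht)⟩

/-- The mild solution with source `q` and initial value `y0`, as a functional on `C^r_b`. -/
def mildSol (hK : L.SmoothingKernel K α T) (q : ℝ → NegHolder d n) (y0 : NegHolder d n)
    (r t : ℝ) : NegHolder d r :=
  if 0 < t then hK.dualHeat n r t y0 - volterra (hK.dualHeat n r) q t
  -- At time `0` only the value in `C^{-n}_b` is meaningful; for other `r` the value is arbitrary.
  else if h : r = n then h ▸ y0 else 0

lemma mildSol_of_pos (hK : L.SmoothingKernel K α T) (ht : 0 < t) : hK.mildSol q y0 r t =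
    hK.dualHeat n r t y0 - volterra (hK.dualHeat n r) q t := if_pos ht

lemma mildSol_zero (hK : L.SmoothingKernel K α T) : hK.mildSol q y0 n 0 = y0 := by
  rw [mildSol, if_neg (lt_irrefl _), dif_pos rfl]

lemma integrableOn_dualHeat (hK : L.SmoothingKernel K α T) (hα : 0 < α) (hγ0 : 0 ≤ γ)
    (hγα : γ < α) (hγ : γ < n) (hr : r = n - γ) (ha0 : 0 ≤ a) (ha : a < 1)
    (hq : ContinuousOn q (Ioc 0 T)) (hqb : ∀ t ∈ Ioc 0 T, ‖q t‖ ≤ M * t ^ (-a))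
    (ht : t ∈ Ioc 0 T) : IntegrableOn (fun s => hK.dualHeat n r (t - s) (q s)) (Ioo 0 t) := by
  subst hr
  obtain ⟨c, hc0, hc⟩ := hK.exists_norm_dualHeat_le hα hγ0 hγ
  exact integrableOn_volterra (div_nonneg hγ0 hα.le) ((div_lt_one hα).2 hγα) ha0 ha
    (hK.continuousOn_dualHeat hα n _) hc hq hqb ht

lemma volterra_dualHeat_apply (hK : L.SmoothingKernel K α T)
    (hi : IntegrableOn (fun s => hK.dualHeat n r (t - s) (q s)) (Ioo 0 t)) (u : HolderSpace d r) :
    volterra (hK.dualHeat n r) q t u = ∫ s in Ioo 0 t, q s (hK.heat n r (t - s) u) := by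
  rw [volterra, ContinuousLinearMap.integral_apply hi]
  rfl

lemma mildSol_apply (hK : L.SmoothingKernel K α T) (ht : 0 < t)
    (hi : IntegrableOn (fun s => hK.dualHeat n r (t - s) (q s)) (Ioo 0 t)) (u : HolderSpace d r) :
    hK.mildSol q y0 r t u =
      y0 (hK.heat n r t u) - ∫ s in Ioo 0 t, q s (hK.heat n r (t - s) u) := by
  rw [hK.mildSol_of_pos ht, sub_apply, hK.volterra_dualHeat_apply hi, dualHeat_apply]

/-- The mild formula sees `u` only through its images under the heat flow, and these depend on the
function alone, not on the Hölder space in which it is placed. -/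
lemma mildSol_congr (hK : L.SmoothingKernel K α T) {r' : ℝ} (ht : 0 < t)
    (hi : IntegrableOn (fun s => hK.dualHeat n r (t - s) (q s)) (Ioo 0 t))
    (hi' : IntegrableOn (fun s => hK.dualHeat n r' (t - s) (q s)) (Ioo 0 t))
    {u : HolderSpace d r} {v : HolderSpace d r'} (h : (u : E d → ℝ) = v) :
    hK.mildSol q y0 r t u = hK.mildSol q y0 r' t v := by
  rw [hK.mildSol_apply ht hi, hK.mildSol_apply ht hi']
  simp_rw [fun t => hK.heat_congr (n := n) (t := t) h]

lemma continuousOn_mildSol (hK : L.SmoothingKernel K α T) (hα : 0 < α) (hγ0 : 0 ≤ γ)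
    (hγα : γ < α) (hγ : γ < n) (hr : r = n - γ) (ha0 : 0 ≤ a) (ha : a < 1) (hM : 0 ≤ M)
    (hq : ContinuousOn q (Ioc 0 T)) (hqb : ∀ t ∈ Ioc 0 T, ‖q t‖ ≤ M * t ^ (-a)) :
    ContinuousOn (hK.mildSol q y0 r) (Ioc 0 T) := by
  subst hr
  obtain ⟨c, hc0, hc⟩ := hK.exists_norm_dualHeat_le hα hγ0 hγ
  refine ContinuousOn.congr (f := fun t => hK.dualHeat n (n - γ) t y0 -
    volterra (hK.dualHeat n (n - γ)) q t) ?_ fun t ht => hK.mildSol_of_pos ht.1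
  refine ((hK.continuousOn_dualHeat hα n _).clm_apply continuousOn_const).sub ?_
  exact continuousOn_volterra (div_nonneg hγ0 hα.le) ((div_lt_one hα).2 hγα) ha0 ha hc0 hM
    (hK.continuousOn_dualHeat hα n _) hc hq hqb

/-- The weight cancels the singularity of the initial term exactly, and the Beta integral
contributes `t^{1-γ/α-a}`, so the weighted integral is of order `t^{1-a}`, which is bounded. With
`r` fixed by `γ`, the bound is linear in `‖y0‖` and `M`. -/
lemma norm_mildSol_le (hK : L.SmoothingKernel K α T) (hα : 0 < α) (hγ0 : 0 ≤ γ) (hγα : γ < α)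
    (hr : r = n - γ) (ha0 : 0 ≤ a) (ha : a < 1) (hM : 0 ≤ M) {c : ℝ} (hc0 : 0 ≤ c)
    (hc : ∀ t ∈ Ioc 0 T, ‖hK.dualHeat n (n - γ) t‖ ≤ c * t ^ (-(γ / α)))
    (hqb : ∀ t ∈ Ioc 0 T, ‖q t‖ ≤ M * t ^ (-a)) (ht : t ∈ Ioc 0 T) :
    ‖t ^ (γ / α) • hK.mildSol q y0 r t‖ ≤
      c * (‖y0‖ + M * (betaBound (γ / α) a * T ^ (1 - a))) := by
  subst hr
  have ht0 := ht.1
  have hγ1 := (div_lt_one hα).2 hγα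
  have h1 := norm_volterra_le (div_nonneg hγ0 hα.le) hγ1 ha0 ha
    (mul_nonneg hc0 hM) hc hqb ht
  have h2 : ‖hK.dualHeat n (n - γ) t y0‖ ≤ c * t ^ (-(γ / α)) * ‖y0‖ :=
    (ContinuousLinearMap.le_opNorm _ _).trans (by gcongr; exact hc t ht)
  have e1 : t ^ (γ / α) * t ^ (-(γ / α)) = 1 := by
    rw [← Real.rpow_add ht0, add_neg_cancel, Real.rpow_zero]
  have e2 : t ^ (γ / α) * t ^ (1 - γ / α - a) = t ^ (1 - a) := by
    rw [← Real.rpow_add ht0]; ring_nf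
  have e3 : t ^ (1 - a) ≤ T ^ (1 - a) := Real.rpow_le_rpow ht0.le ht.2 (by linarith)
  have hbb := betaBound_nonneg hγ1 ha
  rw [hK.mildSol_of_pos ht0, norm_smul, Real.norm_of_nonneg (Real.rpow_nonneg ht0.le _)]
  calc _ ≤ t ^ (γ / α) * (c * t ^ (-(γ / α)) * ‖y0‖ +
        c * M * (betaBound (γ / α) a * t ^ (1 - γ / α - a))) := by
        gcongr
        exact (norm_sub_le _ _).trans (add_le_add h2 h1)
    _ = c * ((t ^ (γ / α) * t ^ (-(γ / α))) * ‖y0‖ +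
        M * (betaBound (γ / α) a * (t ^ (γ / α) * t ^ (1 - γ / α - a)))) := by ring
    _ ≤ _ := by
        rw [e1, e2, one_mul]
        gcongr

end LevyTriplet.SmoothingKernel

end

/-! ### Functionals continuous for bounded pointwise convergence -/

section

variable {d n : ℕ} {r : ℝ}

/-- Bounded pointwise convergence to `0` in `C^r_b`, with all derivatives of order at most `⌊r⌋`. -/
structure BPZero (u : ℕ → HolderSpace d r) : Prop where
  bounded : ∃ c : ℝ, ∀ m, ‖u m‖ ≤ c
  tendsto : ∀ j ≤ ⌊r⌋₊, ∀ x,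
    Tendsto (fun m => ‖iteratedFDeriv ℝ j (u m : E d → ℝ) x‖) atTop (𝓝 0)

lemma BPZero.tendsto_nat {u : ℕ → HolderSpace d n} (h : BPZero u) {j : ℕ} (hj : j ≤ n) (x : E d) :
    Tendsto (fun m => ‖iteratedFDeriv ℝ j (u m : E d → ℝ) x‖) atTop (𝓝 0) :=
  h.tendsto j (by rwa [Nat.floor_natCast]) x

/-- The functionals on `C^r_b` which are continuous for bounded pointwise convergence. -/
def bpContinuous (d : ℕ) (r : ℝ) : Submodule ℝ (NegHolder d r) where
  carrier := {ρ | ∀ u : ℕ → HolderSpace d r, BPZero u → Tendsto (fun m => ρ (u m)) atTop (𝓝 0)}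
  add_mem' h h' u hu := by simpa using (h u hu).add (h' u hu)
  zero_mem' u hu := by simp
  smul_mem' c ρ h u hu := by simpa using (h u hu).const_mul c

/-- The sequences tested are bounded in norm, so a small perturbation of the functional changes its
values uniformly little along them. -/
lemma isClosed_bpContinuous (d : ℕ) (r : ℝ) : IsClosed (bpContinuous d r : Set (NegHolder d r)) := by
  refine isClosed_of_closure_subset fun ρ hρ u hu => ?_
  obtain ⟨c, hc⟩ := hu.bounded
  have hc0 : 0 ≤ c := (norm_nonneg _).trans (hc 0)
  rw [Metric.tendsto_atTop]
  intro ε hε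
  obtain ⟨ρ', hρ', hd⟩ := Metric.mem_closure_iff.1 hρ (ε / (2 * (c + 1))) (by positivity)
  obtain ⟨N, hN⟩ := Metric.tendsto_atTop.1 (hρ' u hu) (ε / 2) (by positivity)
  refine ⟨N, fun m hm => ?_⟩
  have h1 := hN m hm
  rw [dist_zero_right] at h1 ⊢
  rw [dist_eq_norm] at hd
  have h2 : ‖(ρ - ρ') (u m)‖ ≤ ε / (2 * (c + 1)) * c :=
    ((ρ - ρ').le_opNorm _).trans (mul_le_mul hd.le (hc m) (norm_nonneg _) (by positivity))
  have h3 : ε / (2 * (c + 1)) * c ≤ ε / 2 := by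
    rw [div_mul_eq_mul_div, div_le_div_iff₀ (by positivity) (by positivity)]
    nlinarith
  calc ‖ρ (u m)‖ = ‖(ρ - ρ') (u m) + ρ' (u m)‖ := by rw [sub_apply, sub_add_cancel]
    _ ≤ ‖(ρ - ρ') (u m)‖ + ‖ρ' (u m)‖ := norm_add_le _ _
    _ < ε := by linarith

section convolution

variable {F : Type} [NormedAddCommGroup F] [NormedSpace ℝ F] [CompleteSpace F]

/-- All derivatives are put on the kernel, so bounded pointwise convergence of the functions alone
is enough. Thus the heat flow produces convergence of derivatives that the original functions need
not possess. -/
lemma tendsto_iteratedFDeriv_convolution {u : ℕ → E d → F} (hu : ∀ m, Continuous (u m)) {C : ℝ}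
    (hC : ∀ m x, ‖u m x‖ ≤ C) (h0 : ∀ x, Tendsto (fun m => u m x) atTop (𝓝 0)) (j : ℕ)
    {G H : Type} [NormedAddCommGroup G] [NormedSpace ℝ G] [NormedAddCommGroup H] [NormedSpace ℝ H]
    {κ : E d → G} (B : G →L[ℝ] F →L[ℝ] H) (hκ : ContDiff ℝ j κ)
    (hi : ∀ i ≤ j, Integrable (iteratedFDeriv ℝ i κ)) (x : E d) :
    Tendsto (fun m => ‖iteratedFDeriv ℝ j (convolution κ (u m) B volume) x‖) atTop (𝓝 0) := by
  induction j generalizing G H with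
  | zero =>
    simp only [norm_iteratedFDeriv_zero]
    have hκi := integrable_of_iteratedFDeriv_zero (hi 0 le_rfl) hκ.continuous
    rw [← norm_zero (E := H)]
    refine Tendsto.norm ?_
    have h := tendsto_integral_of_dominated_convergence (μ := volume)
      (F := fun m y => B (κ y) (u m (x - y))) (f := fun _ => (0 : H))
      (fun y => ‖B‖ * ‖κ y‖ * C)
      (fun m => (integrable_convolution_integrand hκi (hu m) (hC m) x).aestronglyMeasurable)
      ((hκi.norm.const_mul _).mul_const _)
      (fun m => ae_of_all _ fun y => (B.le_opNorm₂ _ _).trans (by gcongr; exact hC m _))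
      (ae_of_all _ fun y => by
        have := ((B (κ y)).continuous.tendsto 0).comp (h0 (x - y))
        rwa [map_zero] at this)
    rwa [integral_zero] at h
  | succ j ih =>
    have h1 : ContDiff ℝ 1 κ := hκ.of_le (by exact_mod_cast Nat.le_add_left 1 j)
    have hκi := integrable_of_iteratedFDeriv_zero (hi 0 (by omega)) hκ.continuous
    have hκi' := integrable_fderiv_of_iteratedFDeriv_one (hi 1 (by omega)) h1
    simp only [← norm_iteratedFDeriv_fderiv]
    simp_rw [fun m => fderiv_convolution (B := B) h1 hκi hκi' (hu m) (hC m)]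
    exact ih (B.precompL (E d)) (hκ.fderiv_right (by push_cast; exact le_rfl))
      (integrable_fderiv_of_iteratedFDeriv hi hκ)

end convolution

lemma LevyTriplet.SmoothingKernel.bpZero_heat {L : LevyTriplet d} {K : ℝ → E d → ℝ} {α T t : ℝ}
    (hK : L.SmoothingKernel K α T) (ht : t ∈ Ioc 0 T) {u : ℕ → HolderSpace d r} (hu : BPZero u) :
    BPZero fun m => hK.heat n r t (u m) := by
  obtain ⟨c, hc⟩ := hu.bounded
  refine ⟨⟨‖hK.heat n r t‖ * c, fun m => ?_⟩, fun j hj x => ?_⟩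
  · exact (ContinuousLinearMap.le_opNorm _ _).trans
      (mul_le_mul_of_nonneg_left (hc m) (norm_nonneg _))
  · simp_rw [hK.coe_heat ht, hK.isSmoothHeatKernel.avg_eq_convolution ht.1]
    refine tendsto_iteratedFDeriv_convolution (C := c) (fun m => (u m).continuous)
      (fun m x => ((u m).abs_le_norm x).trans (hc m)) (fun x => ?_) j _ (hK.contDiff_kernel ht j)
      (fun i _ => hK.integrable ht i) x
    have h := hu.tendsto 0 (Nat.zero_le _) x
    simp only [norm_iteratedFDeriv_zero] at h
    exact tendsto_zero_iff_norm_tendsto_zero.2 h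

lemma LevyTriplet.SmoothingKernel.dualHeat_mem_bpContinuous {L : LevyTriplet d}
    {K : ℝ → E d → ℝ} {α T t : ℝ} (hK : L.SmoothingKernel K α T) (ht : t ∈ Ioc 0 T)
    {y : NegHolder d n} (hy : y ∈ bpContinuous d n) : hK.dualHeat n r t y ∈ bpContinuous d r :=
  fun _ hu => hy _ (hK.bpZero_heat ht hu)

lemma BPZero.tendsto_pd {u : ℕ → HolderSpace d n} (h : BPZero u) {j : ℕ} (hj : j + 1 ≤ n)
    (i : Fin d) (x : E d) :
    Tendsto (fun m => ‖iteratedFDeriv ℝ j (pd i (u m : E d → ℝ)) x‖) atTop (𝓝 0) :=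
  squeeze_zero (fun _ => norm_nonneg _) (fun m => norm_iteratedFDeriv_pd_le
    ((u m).contDiff_nat.of_le (by exact_mod_cast hj)) i x) (h.tendsto_nat hj x)

lemma BPZero.transport (hn : 1 ≤ n) (b : Fin d → HolderSpace d n) {u : ℕ → HolderSpace d n}
    (hu : BPZero u) : BPZero fun m => transportL hn b (u m) := by
  obtain ⟨c, hc⟩ := hu.bounded
  refine ⟨⟨‖transportL hn b‖ * c, fun m => ?_⟩, fun j hj x => ?_⟩
  · exact (ContinuousLinearMap.le_opNorm _ _).trans
      (mul_le_mul_of_nonneg_left (hc m) (norm_nonneg _))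
  obtain ⟨k, rfl⟩ : ∃ k, n = k + 1 := ⟨n - 1, by omega⟩
  have hfl : ⌊((k + 1 : ℕ) : ℝ) - 1⌋₊ = k := by
    rw [show ((k + 1 : ℕ) : ℝ) - 1 = (k : ℝ) by push_cast; ring, Nat.floor_natCast]
  rw [hfl] at hj
  have h1 : ∀ m, ((transportL hn b (u m) : HolderSpace d (((k + 1 : ℕ) : ℝ) - 1)) : E d → ℝ) =
      fun x => ∑ i, b i x * pd i (u m : E d → ℝ) x := fun m => rfl
  have hb : ∀ i, ContDiff ℝ j (b i : E d → ℝ) := fun i => (b i).contDiff_nat.of_le (by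
    have : j ≤ k + 1 := by omega
    exact_mod_cast this)
  have hp : ∀ m i, ContDiff ℝ j (pd i (u m : E d → ℝ)) := fun m i =>
    contDiff_pd ((u m).contDiff_nat.of_le (by exact_mod_cast Nat.succ_le_succ hj)) i
  have h2 : ∀ m, ‖iteratedFDeriv ℝ j
      ((transportL hn b (u m) : HolderSpace d (((k + 1 : ℕ) : ℝ) - 1)) : E d → ℝ) x‖ ≤
      ∑ i, ∑ l ∈ Finset.range (j + 1), (j.choose l : ℝ) * ‖iteratedFDeriv ℝ l (b i : E d → ℝ) x‖ *
        ‖iteratedFDeriv ℝ (j - l) (pd i (u m : E d → ℝ)) x‖ := fun m => by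
    rw [h1, iteratedFDeriv_fun_sum_apply fun i _ => ((hb i).mul (hp m i)).contDiffAt]
    refine (norm_sum_le _ _).trans (Finset.sum_le_sum fun i _ => ?_)
    exact norm_iteratedFDeriv_mul_le (hb i) (hp m i) x le_rfl
  refine squeeze_zero (fun _ => norm_nonneg _) h2 ?_
  have h3 := tendsto_finsetSum (Finset.univ (α := Fin d)) fun i _ =>
    tendsto_finsetSum (Finset.range (j + 1)) fun l _ =>
      (hu.tendsto_pd (j := j - l) (by omega) i x).const_mul
        ((j.choose l : ℝ) * ‖iteratedFDeriv ℝ l (b i : E d → ℝ) x‖)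
  simpa using h3

lemma dualTransport_mem_bpContinuous (hn : 1 ≤ n) (b : Fin d → HolderSpace d n)
    {y : NegHolder d ((n : ℝ) - 1)} (hy : y ∈ bpContinuous d ((n : ℝ) - 1)) :
    dualMapL _ _ (transportL hn b) y ∈ bpContinuous d n :=
  fun _ hu => hy _ (hu.transport hn b)

lemma tendsto_vectorIntegral {Ω : Type} [MeasurableSpace Ω] (μ : SignedMeasure Ω) {f : ℕ → Ω → ℝ}
    (hf : ∀ m, Measurable (f m)) {c : ℝ} (hc : ∀ m x, |f m x| ≤ c)
    (h0 : ∀ x, Tendsto (fun m => |f m x|) atTop (𝓝 0)) :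
    Tendsto (fun m => ∫ᵛ x, f m x ∂•μ) atTop (𝓝 0) := by
  have h := tendsto_integral_of_dominated_convergence (μ := μ.totalVariation)
    (F := fun m x => |f m x|) (f := fun _ => (0 : ℝ)) (fun _ => c)
    (fun m => (hf m).abs.aestronglyMeasurable) (integrable_const c)
    (fun m => ae_of_all _ fun x => by
      rw [Real.norm_eq_abs, abs_abs]
      exact hc m x) (ae_of_all _ h0)
  rw [integral_zero] at h
  exact squeeze_zero_norm (fun m => norm_vectorIntegral_le μ (f m)) h

lemma gradFunctional_mem_bpContinuous (hn : 1 ≤ n) (V : Fin d → SignedMeasure (E d)) :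
    gradFunctional hn V ∈ bpContinuous d n := by
  intro u hu
  obtain ⟨c, hc⟩ := hu.bounded
  simp_rw [gradFunctional_apply]
  rw [show (0 : ℝ) = ∑ _i : Fin d, 0 by simp]
  refine tendsto_finsetSum _ fun i _ => tendsto_vectorIntegral (V i) (c := c)
    (fun m => ((u m).continuous_pd hn i).measurable)
    (fun m x => ((u m).abs_pd_le hn i x).trans (hc m)) fun x => ?_
  have h := hu.tendsto_pd (j := 0) hn i x
  simpa only [norm_iteratedFDeriv_zero, Real.norm_eq_abs] using h

lemma abs_iteratedFDeriv_single_le {k : ℕ} (u : E d → ℝ) (x : E d) (I : Fin k → Fin d) :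
    |iteratedFDeriv ℝ k u x (fun j => EuclideanSpace.single (I j) 1)| ≤
      ‖iteratedFDeriv ℝ k u x‖ := by
  refine ((iteratedFDeriv ℝ k u x).le_opNorm _).trans_eq ?_
  simp

lemma continuous_iteratedFDeriv_single {k : ℕ} {u : E d → ℝ} (hu : ContDiff ℝ k u)
    (I : Fin k → Fin d) :
    Continuous fun x => iteratedFDeriv ℝ k u x (fun j => EuclideanSpace.single (I j) 1) :=
  ContinuousEval.continuous_eval.comp
    ((hu.continuous_iteratedFDeriv le_rfl).prodMk continuous_const)

/-- The easy half of the characterisation: dominated convergence with respect to the total variation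
of each measure. -/
lemma MeasureRepresentable.mem_bpContinuous {ρ : NegHolder d n} (h : MeasureRepresentable ρ) :
    ρ ∈ bpContinuous d n := by
  obtain ⟨μ, hμ⟩ := h
  intro u hu
  obtain ⟨c, hc⟩ := hu.bounded
  simp_rw [hμ]
  rw [show (0 : ℝ) = ∑ k ∈ Finset.range (n + 1), ∑ _I : Fin k → Fin d, 0 by simp]
  refine tendsto_finsetSum _ fun k hk => tendsto_finsetSum _ fun I _ => ?_
  have hk' : k ≤ n := Nat.le_of_lt_succ (Finset.mem_range.1 hk)
  refine tendsto_vectorIntegral (μ k I) (c := c) (fun m => ?_) (fun m x => ?_) fun x => ?_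
  · exact (continuous_iteratedFDeriv_single ((u m).contDiff_nat.of_le (by exact_mod_cast hk'))
      I).measurable
  · exact (abs_iteratedFDeriv_single_le _ _ _).trans
      (((u m).norm_iteratedFDeriv_le_nat hk' x).trans (hc m))
  · exact squeeze_zero (fun _ => abs_nonneg _) (fun m => abs_iteratedFDeriv_single_le _ _ _)
      (hu.tendsto_nat hk' x)

end

/-! ### Riesz representation of bounded functionals by finite signed measures -/

section

section riesz

open scoped CompactlySupported BoundedContinuousFunction

variable {d : ℕ} {lin : C_c(E d, ℝ) →ₗ[ℝ] ℝ} {C : ℝ}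

/-- The positive part of a bounded functional on `C_c`, on nonnegative functions. -/
def posFun (lin : C_c(E d, ℝ) →ₗ[ℝ] ℝ) (f : C_c(E d, ℝ≥0)) : ℝ :=
  ⨆ g : Iic f, lin g.1.toReal

lemma exists_bound_nnreal (f : C_c(E d, ℝ≥0)) : ∃ b : ℝ, ∀ x, (f x : ℝ) ≤ b := by
  obtain ⟨b, hb⟩ := f.toReal.hasCompactSupport.exists_bound_of_continuous f.toReal.continuous
  exact ⟨b, fun x => (le_abs_self _).trans (by simpa using hb x)⟩

lemma bddAbove_posFun (hC : ∀ f : C_c(E d, ℝ), ∀ b, (∀ x, |f x| ≤ b) → |lin f| ≤ C * b)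
    (f : C_c(E d, ℝ≥0)) : BddAbove (range fun g : Iic f => lin g.1.toReal) := by
  obtain ⟨b, hb⟩ := exists_bound_nnreal f
  refine ⟨C * b, ?_⟩
  rintro _ ⟨g, rfl⟩
  refine (le_abs_self _).trans (hC _ _ fun x => ?_)
  have : (g.1 x : ℝ) ≤ f x := by exact_mod_cast g.2 x
  simpa using this.trans (hb x)

lemma le_posFun (hC : ∀ f : C_c(E d, ℝ), ∀ b, (∀ x, |f x| ≤ b) → |lin f| ≤ C * b)
    {f g : C_c(E d, ℝ≥0)} (h : g ≤ f) : lin g.toReal ≤ posFun lin f :=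
  le_ciSup (f := fun g : Iic f => lin g.1.toReal) (bddAbove_posFun hC f) ⟨g, h⟩

lemma posFun_le {f : C_c(E d, ℝ≥0)} {b : ℝ} (h : ∀ g ≤ f, lin g.toReal ≤ b) : posFun lin f ≤ b := by
  have : Nonempty (Iic f) := ⟨⟨f, mem_Iic.2 le_rfl⟩⟩
  exact ciSup_le fun g => h g.1 g.2

lemma toReal_zero : (0 : C_c(E d, ℝ≥0)).toReal = 0 := by
  ext
  simp

lemma posFun_nonneg (hC : ∀ f : C_c(E d, ℝ), ∀ b, (∀ x, |f x| ≤ b) → |lin f| ≤ C * b)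
    (f : C_c(E d, ℝ≥0)) : 0 ≤ posFun lin f := by
  have h := le_posFun hC (f := f) (g := 0) fun x => by simp
  rwa [toReal_zero, map_zero] at h

lemma posFun_le_of_bound (hC : ∀ f : C_c(E d, ℝ), ∀ b, (∀ x, |f x| ≤ b) → |lin f| ≤ C * b)
    {f : C_c(E d, ℝ≥0)} {b : ℝ} (hb : ∀ x, (f x : ℝ) ≤ b) : posFun lin f ≤ C * b :=
  posFun_le fun g hg => (le_abs_self _).trans (hC _ _ fun x => by
    have : (g x : ℝ) ≤ f x := by exact_mod_cast hg x
    simpa using this.trans (hb x))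

/-- Riesz decomposition: any `h ≤ f + g` is the sum of `h ⊓ f ≤ f` and a remainder which is at most
`g`. This gives subadditivity; the reverse inequality comes from adding competitors. -/
lemma posFun_add (hC : ∀ f : C_c(E d, ℝ), ∀ b, (∀ x, |f x| ≤ b) → |lin f| ≤ C * b)
    (f g : C_c(E d, ℝ≥0)) : posFun lin (f + g) = posFun lin f + posFun lin g := by
  refine le_antisymm (posFun_le fun h hh => ?_) ?_
  · obtain ⟨k, hk⟩ := CompactlySupportedContinuousMap.exists_add_of_le (inf_le_left : h ⊓ f ≤ h)
    have hkg : k ≤ g := fun x => by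
      have h1 := DFunLike.congr_fun hk x
      have h2 := hh x
      simp only [CompactlySupportedContinuousMap.add_apply,
        CompactlySupportedContinuousMap.inf_apply] at h1 h2
      rcases le_total (h x) (f x) with h3 | h3
      · rw [min_eq_left h3] at h1
        have : k x = 0 := by simpa using h1
        rw [this]
        exact zero_le
      · rw [min_eq_right h3] at h1
        rw [← h1] at h2
        exact le_of_add_le_add_left h2
    rw [← hk, CompactlySupportedContinuousMap.toReal_add, map_add]
    exact add_le_add (le_posFun hC inf_le_right) (le_posFun hC hkg)
  · rw [← le_sub_iff_add_le]
    refine posFun_le fun h hh => ?_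
    rw [le_sub_iff_add_le, ← le_sub_iff_add_le']
    refine posFun_le fun k hk => ?_
    rw [le_sub_iff_add_le', ← map_add, ← CompactlySupportedContinuousMap.toReal_add]
    exact le_posFun hC (add_le_add hh hk)

lemma posFun_smul_le (hC : ∀ f : C_c(E d, ℝ), ∀ b, (∀ x, |f x| ≤ b) → |lin f| ≤ C * b)
    (c : ℝ≥0) (f : C_c(E d, ℝ≥0)) : c * posFun lin f ≤ posFun lin (c • f) := by
  rcases eq_or_ne c 0 with rfl | hc
  · simpa using posFun_nonneg hC _
  have hc' : (0 : ℝ) < c := by positivity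
  rw [mul_comm, ← le_div_iff₀ hc']
  refine posFun_le fun g hg => ?_
  rw [le_div_iff₀ hc', mul_comm]
  have h := le_posFun hC (f := c • f) (g := c • g) fun x => by
    simpa using mul_le_mul_right (hg x) c
  rw [CompactlySupportedContinuousMap.toReal_smul] at h
  have h1 : lin (c • g.toReal) = c * lin g.toReal := by
    rw [NNReal.smul_def, map_smul, smul_eq_mul]
  rwa [h1] at h

/-- The missing inequality is the known one applied to `c⁻¹`; the case `c = 0` is separate. -/
lemma posFun_smul (hC : ∀ f : C_c(E d, ℝ), ∀ b, (∀ x, |f x| ≤ b) → |lin f| ≤ C * b)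
    (c : ℝ≥0) (f : C_c(E d, ℝ≥0)) : posFun lin (c • f) = c * posFun lin f := by
  refine le_antisymm ?_ (posFun_smul_le hC c f)
  rcases eq_or_ne c 0 with rfl | hc
  · refine (posFun_le_of_bound hC (b := 0) fun x => ?_).trans_eq (by simp)
    simp
  have hc' : (0 : ℝ) < c := by positivity
  have h := posFun_smul_le hC c⁻¹ (c • f)
  rw [smul_smul, inv_mul_cancel₀ hc, one_smul, NNReal.coe_inv, inv_mul_le_iff₀ hc'] at h
  exact h

/-- The positive part of a bounded functional on `C_c`. -/
def posPartLin (hC : ∀ f : C_c(E d, ℝ), ∀ b, (∀ x, |f x| ≤ b) → |lin f| ≤ C * b) :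
    C_c(E d, ℝ≥0) →ₗ[ℝ≥0] ℝ≥0 where
  toFun f := ⟨posFun lin f, posFun_nonneg hC f⟩
  map_add' f g := NNReal.eq (posFun_add hC f g)
  map_smul' c f := NNReal.eq (posFun_smul hC c f)

/-- The negative part of a bounded functional on `C_c`. -/
def negPartLin (hC : ∀ f : C_c(E d, ℝ), ∀ b, (∀ x, |f x| ≤ b) → |lin f| ≤ C * b) :
    C_c(E d, ℝ≥0) →ₗ[ℝ≥0] ℝ≥0 where
  toFun f := ⟨posFun lin f - lin f.toReal, sub_nonneg.2 (le_posFun hC le_rfl)⟩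
  map_add' f g := NNReal.eq (by
    change posFun lin (f + g) - lin (f + g).toReal =
      (posFun lin f - lin f.toReal) + (posFun lin g - lin g.toReal)
    rw [posFun_add hC, CompactlySupportedContinuousMap.toReal_add, map_add]
    ring)
  map_smul' c f := NNReal.eq (by
    change posFun lin (c • f) - lin (c • f).toReal = c * (posFun lin f - lin f.toReal)
    rw [posFun_smul hC, CompactlySupportedContinuousMap.toReal_smul, NNReal.smul_def, map_smul,
      smul_eq_mul]
    ring)

/-- A smooth cutoff function as an element of `C_c`. -/
def cutoffCc (d : ℕ) (R : ℝ) (hR : 0 < R) : C_c(E d, ℝ≥0) :=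
  CompactlySupportedContinuousMap.nnrealPart
    ⟨⟨cutoff R, (contDiff_cutoff R).continuous⟩, hasCompactSupport_cutoff hR⟩

lemma cutoffCc_apply {R : ℝ} (hR : 0 < R) (x : E d) : (cutoffCc d R hR x : ℝ) = cutoff R x := by
  unfold cutoffCc
  rw [CompactlySupportedContinuousMap.nnrealPart_apply]
  exact Real.coe_toNNReal _ (cutoff_nonneg R x)

/-- The mass of a ball is at most the integral of a cut-off function equal to one on it, hence at
most `b`. The balls exhaust the space. -/
lemma isFiniteMeasure_rieszMeasure {Λ : C_c(E d, ℝ≥0) →ₗ[ℝ≥0] ℝ≥0} {b : ℝ≥0}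
    (hΛ : ∀ f : C_c(E d, ℝ≥0), (∀ x, (f x : ℝ) ≤ 1) → Λ f ≤ b) :
    IsFiniteMeasure (NNRealRMK.rieszMeasure Λ) := by
  have h : ∀ k : ℕ, NNRealRMK.rieszMeasure Λ (Metric.closedBall (0 : E d) (k + 1)) ≤ b := by
    intro k
    have hk : (0 : ℝ) < k + 1 := by positivity
    have h1 := NNRealRMK.lintegral_rieszMeasure Λ (cutoffCc d (k + 1) hk)
    have h2 : Λ (cutoffCc d (k + 1) hk) ≤ b := hΛ _ fun x => by
      rw [cutoffCc_apply]
      exact cutoff_le_one _ _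
    calc NNRealRMK.rieszMeasure Λ (Metric.closedBall (0 : E d) (k + 1))
        = ∫⁻ x, (Metric.closedBall (0 : E d) (k + 1)).indicator 1 x ∂NNRealRMK.rieszMeasure Λ := by
          rw [lintegral_indicator_one Metric.isClosed_closedBall.measurableSet]
      _ ≤ ∫⁻ x, (cutoffCc d (k + 1) hk x : ℝ≥0∞) ∂NNRealRMK.rieszMeasure Λ := by
          refine lintegral_mono fun x => ?_
          by_cases hx : x ∈ Metric.closedBall (0 : E d) (k + 1)
          · have : cutoffCc d (k + 1) hk x = 1 := by
              refine NNReal.eq ?_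
              rw [cutoffCc_apply, cutoff_eq_one hk (by simpa using hx), NNReal.coe_one]
            rw [this, indicator_of_mem hx]
            simp
          · rw [indicator_of_notMem hx]
            exact zero_le
      _ ≤ b := by
          rw [h1]
          exact_mod_cast h2
  refine ⟨lt_of_le_of_lt ?_ (ENNReal.coe_lt_top (r := b))⟩
  have hU : (univ : Set (E d)) = ⋃ k : ℕ, Metric.closedBall 0 ((k : ℝ) + 1) := by
    refine (eq_univ_of_forall fun x => ?_).symm
    obtain ⟨k, hk⟩ := exists_nat_ge ‖x‖
    exact mem_iUnion.2 ⟨k, by simp only [mem_closedBall_zero_iff]; linarith⟩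
  have hmono : Monotone fun k : ℕ => Metric.closedBall (0 : E d) ((k : ℝ) + 1) := fun i j hij =>
    Metric.closedBall_subset_closedBall (by gcongr)
  rw [hU, hmono.measure_iUnion]
  exact iSup_le h

/-- **Riesz representation**: a bounded functional on bounded continuous functions is represented
by a finite signed measure on the functions of compact support. -/
theorem exists_signedMeasure_of_functional (Λ : (E d →ᵇ ℝ) →L[ℝ] ℝ) :
    ∃ μ : SignedMeasure (E d), ∀ f : E d →ᵇ ℝ, HasCompactSupport f → Λ f = ∫ᵛ x, f x ∂•μ := by
  let lin : C_c(E d, ℝ) →ₗ[ℝ] ℝ :=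
    { toFun := fun f => Λ f.toBoundedContinuousFunction
      map_add' := fun f g => by rw [← map_add]; rfl
      map_smul' := fun c f => by rw [RingHom.id_apply, ← map_smul]; rfl }
  have hC : ∀ f : C_c(E d, ℝ), ∀ b, (∀ x, |f x| ≤ b) → |lin f| ≤ ‖Λ‖ * b := fun f b hb => by
    refine (Λ.le_opNorm _).trans (mul_le_mul_of_nonneg_left ?_ (norm_nonneg _))
    exact (BoundedContinuousFunction.norm_le ((abs_nonneg _).trans (hb 0))).2 hb
  -- The functional is the difference of its positive part and of (positive part minus functional),
  -- both positive. Their total masses are at most `‖Λ‖` and `2‖Λ‖`.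
  set P := NNRealRMK.rieszMeasure (posPartLin hC) with hP
  set N := NNRealRMK.rieszMeasure (negPartLin hC) with hN
  have hPf : IsFiniteMeasure P := isFiniteMeasure_rieszMeasure (b := ‖Λ‖₊) fun f hf => by
    rw [← NNReal.coe_le_coe]
    exact (posFun_le_of_bound hC hf).trans_eq (by simp)
  have hNf : IsFiniteMeasure N := isFiniteMeasure_rieszMeasure (b := ‖Λ‖₊ + ‖Λ‖₊) fun f hf => by
    rw [← NNReal.coe_le_coe]
    change posFun lin f - lin f.toReal ≤ _
    have h1 := posFun_le_of_bound hC hf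
    have h2 := hC f.toReal 1 fun x => by simpa using hf x
    have h3 := neg_abs_le (lin f.toReal)
    push_cast
    linarith
  have key : ∀ g : C_c(E d, ℝ≥0), lin g.toReal = ∫ x, (g x : ℝ) ∂P - ∫ x, (g x : ℝ) ∂N := by
    intro g
    rw [hP, hN, NNRealRMK.integral_rieszMeasure, NNRealRMK.integral_rieszMeasure]
    change _ = posFun lin g - (posFun lin g - lin g.toReal)
    ring
  refine ⟨P.toSignedMeasure - N.toSignedMeasure, fun f hf => ?_⟩
  let F : C_c(E d, ℝ) := ⟨f.toContinuousMap, hf⟩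
  have hF : Λ f = lin F := by
    change Λ f = Λ F.toBoundedContinuousFunction
    congr 1
  have hint : ∀ (m : Measure (E d)) [IsFiniteMeasure m] (g : C_c(E d, ℝ≥0)),
      Integrable (fun x => (g x : ℝ)) m := fun m _ g => by
    obtain ⟨b, hb⟩ := exists_bound_nnreal g
    exact integrable_of_continuous_bounded (by fun_prop) (C := b) fun x => by simpa using hb x
  have hfx : ∀ x, f x = (F.nnrealPart x : ℝ) - ((-F).nnrealPart x : ℝ) := fun x => by
    have := DFunLike.congr_fun (CompactlySupportedContinuousMap.nnrealPart_sub_nnrealPart_neg F) x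
    rw [CompactlySupportedContinuousMap.sub_apply, CompactlySupportedContinuousMap.toReal_apply,
      CompactlySupportedContinuousMap.toReal_apply] at this
    exact this.symm
  have hfi : ∀ (m : Measure (E d)) [IsFiniteMeasure m], Integrable f m := fun m _ => by
    have : (f : E d → ℝ) = fun x => (F.nnrealPart x : ℝ) - ((-F).nnrealPart x : ℝ) := funext hfx
    rw [this]
    exact (hint m _).sub (hint m _)
  rw [VectorMeasure.integral_sub_vectorMeasure, vectorIntegral_toSignedMeasure,
    vectorIntegral_toSignedMeasure, hF]
  · rw [← CompactlySupportedContinuousMap.nnrealPart_sub_nnrealPart_neg F, map_sub, key, key]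
    simp_rw [hfx]
    rw [integral_sub (hint P _) (hint P _), integral_sub (hint N _) (hint N _)]
    ring
  · rw [VectorMeasure.Integrable, Measure.variation_toSignedMeasure]
    exact hfi P
  · rw [VectorMeasure.Integrable, Measure.variation_toSignedMeasure]
    exact hfi N

end riesz

end

/-! ### From bounded pointwise continuity to measure representability -/

section

open scoped BoundedContinuousFunction

variable {d n : ℕ}

lemma norm_multilinear_le_sum {k : ℕ} (A : ContinuousMultilinearMap ℝ (fun _ : Fin k => E d) ℝ) :
    ‖A‖ ≤ ∑ I : Fin k → Fin d, |A fun j => EuclideanSpace.single (I j) 1| := by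
  refine A.opNorm_le_bound (Finset.sum_nonneg fun _ _ => abs_nonneg _) fun m => ?_
  have hm : m = fun i => ∑ j, m i j • (EuclideanSpace.single j (1 : ℝ) : E d) := by
    funext i
    have h := (EuclideanSpace.basisFun (Fin d) ℝ).sum_repr (m i)
    simpa using h.symm
  have hA : A m = ∑ I : Fin k → Fin d,
      (∏ i, m i (I i)) • A fun j => EuclideanSpace.single (I j) 1 := by
    conv_lhs => rw [hm]
    rw [A.map_sum]
    exact Finset.sum_congr rfl fun I _ => A.map_smul_univ _ _
  rw [hA, Finset.sum_mul]
  refine (norm_sum_le _ _).trans (Finset.sum_le_sum fun I _ => ?_)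
  rw [norm_smul, mul_comm, norm_prod]
  refine mul_le_mul_of_nonneg_left ?_ (abs_nonneg _)
  exact Finset.prod_le_prod (fun _ _ => norm_nonneg _) fun i _ => PiLp.norm_apply_le (m i) (I i)

/-- The indices of the partial derivatives of order at most `n`. -/
abbrev JetIndex (d n : ℕ) : Type := Σ k : Fin (n + 1), (Fin k → Fin d)

/-- The partial derivatives of order at most `n` of `u ∈ C^n_b`. -/
def jet (d n : ℕ) : HolderSpace d n →ₗ[ℝ] (JetIndex d n → E d →ᵇ ℝ) where
  toFun u I := BoundedContinuousFunction.ofNormedAddCommGroup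
    (fun x => iteratedFDeriv ℝ I.1 (u : E d → ℝ) x (fun j => EuclideanSpace.single (I.2 j) 1))
    (continuous_iteratedFDeriv_single (u.contDiff_nat.of_le
      (by exact_mod_cast Nat.le_of_lt_succ I.1.2)) I.2) ‖u‖
    (fun x => (abs_iteratedFDeriv_single_le _ _ _).trans
      (u.norm_iteratedFDeriv_le_nat (Nat.le_of_lt_succ I.1.2) x))
  map_add' u v := by
    ext I x
    have h : ((I.1 : ℕ) : ℕ∞ω) ≤ n := by exact_mod_cast Nat.le_of_lt_succ I.1.2
    have := iteratedFDeriv_add_apply (x := x) (u.contDiff_nat.of_le h).contDiffAt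
      (v.contDiff_nat.of_le h).contDiffAt
    simp [HolderSpace.coe_add, this]
  map_smul' c u := by
    ext I x
    have h : ((I.1 : ℕ) : ℕ∞ω) ≤ n := by exact_mod_cast Nat.le_of_lt_succ I.1.2
    have := iteratedFDeriv_const_smul_apply (x := x) (a := c) (u.contDiff_nat.of_le h).contDiffAt
    simp [HolderSpace.coe_smul, this]

lemma jet_apply (u : HolderSpace d n) (I : JetIndex d n) (x : E d) : jet d n u I x =
    iteratedFDeriv ℝ I.1 (u : E d → ℝ) x (fun j => EuclideanSpace.single (I.2 j) 1) := rfl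

/-- The jet map is bounded below: the `(d + 1)^n` dominates the number of index tuples of length at
most `n`, the sum over which controls the operator norm of each derivative. A functional on `C^n_b`
thus becomes a bounded functional of the jet. -/
lemma norm_le_jet (u : HolderSpace d n) : ‖u‖ ≤ (n + 1) * ((d + 1) ^ n * ‖jet d n u‖) := by
  refine u.norm_le_of_bounds rfl fun j hj x => ?_
  refine (norm_multilinear_le_sum _).trans ?_
  have h : ∀ I : Fin j → Fin d,
      |iteratedFDeriv ℝ j (u : E d → ℝ) x fun i => EuclideanSpace.single (I i) 1| ≤ ‖jet d n u‖ :=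
    fun I => ((jet d n u ⟨⟨j, Nat.lt_succ_of_le hj⟩, I⟩).norm_coe_le_norm x).trans
      (norm_le_pi_norm (jet d n u) _)
  refine (Finset.sum_le_sum fun I _ => h I).trans ?_
  rw [Finset.sum_const, nsmul_eq_mul]
  refine mul_le_mul_of_nonneg_right ?_ (norm_nonneg _)
  rw [Finset.card_univ, Fintype.card_fun, Fintype.card_fin, Fintype.card_fin]
  push_cast
  exact (pow_le_pow_left₀ (by positivity) (by linarith) j).trans
    (pow_le_pow_right₀ (by linarith [(Nat.cast_nonneg d : (0 : ℝ) ≤ d)]) hj)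

/-- A map bounded below is injective with bounded inverse on its range; the functional is
transported to the range and extended by Hahn–Banach. -/
lemma exists_functional_comp_eq {V W : Type*} [NormedAddCommGroup V] [NormedSpace ℝ V]
    [NormedAddCommGroup W] [NormedSpace ℝ W] (J : V →ₗ[ℝ] W) {c : ℝ} (hJ : ∀ v, ‖v‖ ≤ c * ‖J v‖)
    (ρ : StrongDual ℝ V) : ∃ Λ : StrongDual ℝ W, ∀ v, ρ v = Λ (J v) := by
  have hinj : Function.Injective J := by
    rw [← LinearMap.ker_eq_bot, LinearMap.ker_eq_bot']
    intro v hv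
    have h := hJ v
    rw [hv, norm_zero, mul_zero] at h
    exact norm_le_zero_iff.1 h
  let e := LinearEquiv.ofInjective J hinj
  let f₀ : LinearMap.range J →ₗ[ℝ] ℝ := ρ.toLinearMap ∘ₗ e.symm.toLinearMap
  have hf₀ : ∀ y, ‖f₀ y‖ ≤ ‖ρ‖ * c * ‖y‖ := by
    intro y
    obtain ⟨v, rfl⟩ := e.surjective y
    have h1 : f₀ (e v) = ρ v := by simp [f₀]
    rw [h1, mul_assoc]
    exact (ρ.le_opNorm v).trans (mul_le_mul_of_nonneg_left (hJ v) (norm_nonneg _))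
  obtain ⟨Λ, hΛ, -⟩ := exists_extension_norm_eq (LinearMap.range J) (f₀.mkContinuous _ hf₀)
  refine ⟨Λ, fun v => ?_⟩
  have h := hΛ (e v)
  rw [LinearMap.mkContinuous_apply] at h
  have h2 : f₀ (e v) = ρ v := by simp [f₀]
  rw [← h2, ← h]
  rfl

/-- A uniform bound for the derivatives of the truncations of a function in `C^n_b`. -/
lemma exists_bound_cutoff_mul (u : HolderSpace d n) : ∃ C : ℝ, ∀ m : ℕ, ∀ j ≤ n, ∀ x,
    ‖iteratedFDeriv ℝ j (fun y => cutoff ((m : ℝ) + 1) y * u y) x‖ ≤ C := by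
  choose c hc using exists_iteratedFDeriv_cutoff_le d
  have hcb : ∀ (m l : ℕ) (x : E d), ‖iteratedFDeriv ℝ l (cutoff ((m : ℝ) + 1)) x‖ ≤ |c l| := by
    intro m l x
    have hm : (1 : ℝ) ≤ (m : ℝ) + 1 := by linarith [(Nat.cast_nonneg m : (0 : ℝ) ≤ m)]
    refine (hc l _ hm x).trans ((div_le_div_of_nonneg_right (le_abs_self _) (by positivity)).trans
      (div_le_self (abs_nonneg _) (one_le_pow₀ hm)))
  refine ⟨∑ j ∈ Finset.range (n + 1), ∑ l ∈ Finset.range (j + 1), (j.choose l : ℝ) * |c l| * ‖u‖,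
    fun m j hj x => ?_⟩
  refine (norm_iteratedFDeriv_mul_le (n := j) ((contDiff_cutoff _).of_le (m := (n : ℕ∞ω))
    (by exact_mod_cast le_top)) u.contDiff_nat x (by exact_mod_cast hj)).trans ?_
  refine le_trans ?_ (Finset.single_le_sum
    (f := fun j => ∑ l ∈ Finset.range (j + 1), (j.choose l : ℝ) * |c l| * ‖u‖)
    (fun j _ => Finset.sum_nonneg fun l _ => by positivity)
    (Finset.mem_range.2 (Nat.lt_succ_of_le hj)))
  refine Finset.sum_le_sum fun l _ => ?_
  gcongr
  · exact hcb m l x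
  · exact u.norm_iteratedFDeriv_le_nat (by omega) x

/-- The truncations of a function in `C^n_b`. -/
lemma exists_compactlySupported_approx (u : HolderSpace d n) :
    ∃ v : ℕ → HolderSpace d n, (∀ m, HasCompactSupport (v m : E d → ℝ)) ∧
      BPZero fun m => u - v m := by
  obtain ⟨C, hC⟩ := exists_bound_cutoff_mul u
  have hs : ∀ m : ℕ, ContDiff ℝ n (fun y => cutoff ((m : ℝ) + 1) y * u y) := fun m =>
    ((contDiff_cutoff _).of_le (by exact_mod_cast le_top)).mul u.contDiff_nat
  refine ⟨fun m => HolderSpace.ofBounds rfl _ (hs m) C (hC m), fun m => ?_, ⟨?_, fun j hj x => ?_⟩⟩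
  · rw [HolderSpace.coe_ofBounds]
    exact (hasCompactSupport_cutoff (by positivity)).mul_right
  · exact ⟨‖u‖ + (n + 1) * C, fun m => (norm_sub_le _ _).trans
      (add_le_add le_rfl (HolderSpace.norm_le_of_bounds rfl _ (hC m)))⟩
  · refine tendsto_const_nhds.congr' ?_
    filter_upwards [(tendsto_add_atTop_nat 1).eventually (cutoff_eventuallyEq_one x)] with m hm
    have h : ((u - HolderSpace.ofBounds rfl _ (hs m) C (hC m) : HolderSpace d n) : E d → ℝ) =ᶠ[𝓝 x]
        fun _ => (0 : ℝ) := by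
      filter_upwards [hm] with y hy
      rw [HolderSpace.coe_sub, Pi.sub_apply, HolderSpace.ofBounds_apply]
      push_cast at hy
      rw [hy, one_mul, sub_self]
    rw [(h.iteratedFDeriv ℝ j).self_of_nhds]
    simp

/-- A functional on `C^n_b` which is continuous for bounded pointwise convergence of the derivatives
is measure representable. -/
theorem measureRepresentable_of_mem_bpContinuous {ρ : NegHolder d n} (h : ρ ∈ bpContinuous d n) :
    MeasureRepresentable ρ := by
  -- The functional is extended from jets to all tuples of bounded continuous functions. Each
  -- component then has a Riesz measure, which represents it on compactly supported functions only:
  -- the extension may also charge infinity.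
  obtain ⟨Λ, hΛ⟩ := exists_functional_comp_eq (jet d n) (c := (n + 1) * (d + 1) ^ n)
    (fun u => (norm_le_jet u).trans_eq (mul_assoc _ _ _).symm) ρ
  choose μ hμ using fun I : JetIndex d n => exists_signedMeasure_of_functional
    (Λ.comp (ContinuousLinearMap.single ℝ (fun _ : JetIndex d n => E d →ᵇ ℝ) I))
  have hsum : ∀ u : HolderSpace d n, HasCompactSupport (u : E d → ℝ) →
      ρ u = ∑ I : JetIndex d n, ∫ᵛ x, jet d n u I x ∂•(μ I) := by
    intro u hu
    rw [hΛ, ← Finset.univ_sum_single (jet d n u), map_sum]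
    refine Finset.sum_congr rfl fun I _ => ?_
    have hs : HasCompactSupport (jet d n u I) := by
      refine (hu.iteratedFDeriv (𝕜 := ℝ) I.1).mono' fun x hx => subset_closure ?_
      rw [Function.mem_support] at hx ⊢
      contrapose! hx
      rw [jet_apply, hx]
      rfl
    rw [Finset.univ_sum_single]
    exact hμ I _ hs
  have hmeas : ∀ (u : HolderSpace d n) I, (μ I).Integrable (jet d n u I) := fun u I => by
    rw [VectorMeasure.Integrable, ← SignedMeasure.totalVariation_eq_variation]
    exact integrable_of_continuous_bounded (jet d n u I).continuous (jet d n u I).norm_coe_le_norm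
  have hall : ∀ u : HolderSpace d n, ρ u = ∑ I : JetIndex d n, ∫ᵛ x, jet d n u I x ∂•(μ I) := by
    intro u
    obtain ⟨v, hv, hbp⟩ := exists_compactlySupported_approx u
    obtain ⟨c, hc⟩ := hbp.bounded
    have h1 : Tendsto (fun m => ρ (u - v m)) atTop (𝓝 0) := h _ hbp
    have h2 : Tendsto (fun m => ∑ I : JetIndex d n, ∫ᵛ x, jet d n (u - v m) I x ∂•(μ I)) atTop
        (𝓝 0) := by
      rw [show (0 : ℝ) = ∑ _I : JetIndex d n, 0 by simp]
      refine tendsto_finsetSum _ fun I _ => ?_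
      have hI : (I.1 : ℕ) ≤ n := Nat.le_of_lt_succ I.1.2
      refine tendsto_vectorIntegral (μ I) (c := c)
        (fun m => (jet d n (u - v m) I).continuous.measurable) (fun m x => ?_) fun x => ?_
      · exact (abs_iteratedFDeriv_single_le _ _ _).trans
          (((u - v m).norm_iteratedFDeriv_le_nat hI x).trans (hc m))
      · exact squeeze_zero (fun _ => abs_nonneg _) (fun m => abs_iteratedFDeriv_single_le _ _ _)
          (hbp.tendsto_nat hI x)
    -- The representation holds for the compactly supported `v m`, so the discrepancy at `u - v m`
    -- equals the discrepancy at `u`. It is constant in `m` and tends to zero, since both sides are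
    -- continuous for bounded pointwise convergence; this excludes a part at infinity.
    have h3 : ∀ m, ρ (u - v m) - ∑ I : JetIndex d n, ∫ᵛ x, jet d n (u - v m) I x ∂•(μ I) =
        ρ u - ∑ I : JetIndex d n, ∫ᵛ x, jet d n u I x ∂•(μ I) := by
      intro m
      have h4 : ∀ I, ∫ᵛ x, jet d n (u - v m) I x ∂•(μ I) =
          ∫ᵛ x, jet d n u I x ∂•(μ I) - ∫ᵛ x, jet d n (v m) I x ∂•(μ I) := fun I => by
        rw [map_sub]
        exact VectorMeasure.integral_fun_sub (hmeas u I) (hmeas (v m) I)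
      simp_rw [h4]
      rw [Finset.sum_sub_distrib, map_sub, hsum (v m) (hv m)]
      ring
    have h5 := h1.sub h2
    simp_rw [h3, sub_zero] at h5
    exact sub_eq_zero.1 (tendsto_nhds_unique tendsto_const_nhds h5)
  refine ⟨fun k I => if hk : k < n + 1 then μ ⟨⟨k, hk⟩, I⟩ else 0, fun u => ?_⟩
  rw [hall, Fintype.sum_sigma, Finset.sum_range]
  refine Finset.sum_congr rfl fun k _ => Finset.sum_congr rfl fun I _ => ?_
  simp only [k.2, dif_pos]
  rfl

end

/-! ### Duhamel's formula for test functions -/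

section

variable {d : ℕ}

namespace HolderSpace

variable {r C : ℝ}

/-- An element of `C^r_b` as an element of `C_b`. -/
def toBounded (u : HolderSpace d r) : HolderSpace d 0 :=
  ofBounds (k := 0) (by simp) u (u.contDiff.of_le (by exact_mod_cast Nat.zero_le _)) ‖u‖
    fun j hj x => by
      obtain rfl : j = 0 := by omega
      rw [norm_iteratedFDeriv_zero]
      exact u.abs_le_norm x

lemma coe_toBounded (u : HolderSpace d r) : (u.toBounded : E d → ℝ) = u := rfl

lemma norm_le_of_abs_le (u : HolderSpace d 0) (h : ∀ x, |u x| ≤ C) : ‖u‖ ≤ C := by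
  have h1 := norm_le_of_bounds (k := 0) (by simp) u (C := C) fun j hj x => by
    obtain rfl : j = 0 := by omega
    rw [norm_iteratedFDeriv_zero]
    exact h x
  simpa using h1

end HolderSpace

namespace LevyTriplet.SmoothingKernel

variable {L : LevyTriplet d} {K : ℝ → E d → ℝ} {α T s τ C : ℝ}

lemma abs_avg_sub_avg_le (hK : L.SmoothingKernel K α T) {u v : E d → ℝ} (hu : Continuous u)
    (huC : ∃ C, ∀ x, ‖u x‖ ≤ C) (hv : Continuous v) (hvC : ∃ C, ∀ x, ‖v x‖ ≤ C)
    (h : ∀ x, |u x - v x| ≤ C) (t : ℝ) (x : E d) :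
    |avg (heatMeasure K t) u x - avg (heatMeasure K t) v x| ≤ C := by
  have hp := hK.isProbabilityMeasure t
  obtain ⟨b, hb⟩ := huC
  obtain ⟨c, hc⟩ := hvC
  have h1 : avg (heatMeasure K t) u x - avg (heatMeasure K t) v x =
      avg (heatMeasure K t) (fun y => u y - v y) x :=
    (integral_sub (integrable_avg hu hb x) (integrable_avg hv hc x)).symm
  rw [h1]
  exact norm_avg_le (u := fun y => u y - v y) h x

lemma continuousOn_avg_comp (hK : L.SmoothingKernel K α T) {r : ℝ} {φ : ℝ → HolderSpace d r}
    {S : Set ℝ} (hφ : ContinuousOn φ S) (hS : ∀ σ ∈ S, s ≤ σ) (x : E d) :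
    ContinuousOn (fun σ => avg (heatMeasure K (σ - s)) (φ σ : E d → ℝ) x) S := by
  intro τ hτ
  have h1 : Tendsto (fun σ => avg (heatMeasure K (σ - s)) (φ τ : E d → ℝ) x) (𝓝[S] τ)
      (𝓝 (avg (heatMeasure K (τ - s)) (φ τ : E d → ℝ) x)) := by
    have h := hK.isSmoothHeatKernel.continuousOn_avg (φ τ).continuous (φ τ).abs_le_norm x
    exact (h.comp (f := fun σ => σ - s) (s := S) (by fun_prop)
      fun σ hσ => sub_nonneg.2 (hS σ hσ)) τ hτ
  have h2 : Tendsto (fun σ => avg (heatMeasure K (σ - s)) (φ σ : E d → ℝ) x -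
      avg (heatMeasure K (σ - s)) (φ τ : E d → ℝ) x) (𝓝[S] τ) (𝓝 0) := by
    refine squeeze_zero_norm (fun σ => ?_) (tendsto_iff_norm_sub_tendsto_zero.1 (hφ τ hτ))
    exact hK.abs_avg_sub_avg_le (φ σ).continuous ⟨_, (φ σ).abs_le_norm⟩ (φ τ).continuous
      ⟨_, (φ τ).abs_le_norm⟩ (φ σ - φ τ).abs_le_norm _ x
  have h3 := h1.add h2
  simp only [add_sub_cancel, add_zero] at h3
  exact h3

/-- The integrand of the Kolmogorov equation is continuous in time, so the fundamental theorem of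
calculus applies at the positive time `τ - s`. -/
lemma hasDerivAt_avg (hK : L.SmoothingKernel K α T) (hT : 0 < T) (hs : s < τ) {u : E d → ℝ}
    (hu : CB 2 u) (x : E d) : HasDerivAt (fun σ => avg (heatMeasure K (σ - s)) u x)
      (avg (heatMeasure K (τ - s)) (L.op u) x) τ := by
  have hc := continuousOn_avg_op hK.isSmoothHeatKernel hu x
  have hpos : 0 < τ - s := sub_pos.2 hs
  have h1 := intervalIntegral.integral_hasDerivAt_right (a := 0) (b := τ - s)
    ((hc.mono fun r hr => by rw [uIcc_of_le hpos.le] at hr; exact hr.1).intervalIntegrable)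
    ((hc.mono Ioi_subset_Ici_self).stronglyMeasurableAtFilter isOpen_Ioi _ hpos)
    (hc.continuousAt (Ici_mem_nhds hpos))
  have h2 : HasDerivAt (fun r => avg (heatMeasure K r) u x)
      (avg (heatMeasure K (τ - s)) (L.op u) x) (τ - s) := by
    refine (h1.const_add (u x)).congr_of_eventuallyEq ?_
    filter_upwards [lt_mem_nhds hpos] with r hr
    rw [← hK.kolmogorov hT hu r hr.le x]
    ring
  exact h2.comp_sub_const τ s

/-- The product rule for a moving function under a moving average. The first-order remainder of `φ`
at `τ` is small uniformly in space, and averaging does not increase sup norms. -/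
lemma hasDerivAt_avg_comp (hK : L.SmoothingKernel K α T) (hT : 0 < T) (hs : s < τ)
    {φ : ℝ → E d → ℝ} {ψ : E d → ℝ} (hφ : ∀ σ, Continuous (φ σ))
    (hφC : ∀ σ, ∃ C, ∀ x, ‖φ σ x‖ ≤ C) (hφτ : CB 2 (φ τ)) (hψ : Continuous ψ)
    (hψC : ∀ x, ‖ψ x‖ ≤ C)
    (hd : ∀ ε > 0, ∀ᶠ σ in 𝓝 τ, ∀ x, |φ σ x - φ τ x - (σ - τ) * ψ x| ≤ ε * |σ - τ|) (x : E d) :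
    HasDerivAt (fun σ => avg (heatMeasure K (σ - s)) (φ σ) x)
      (avg (heatMeasure K (τ - s)) (L.op (φ τ)) x + avg (heatMeasure K (τ - s)) ψ x) τ := by
  have hp := hK.isProbabilityMeasure
  have hpos : 0 < τ - s := sub_pos.2 hs
  have h1 := hK.hasDerivAt_avg hT hs hφτ x
  -- The factor `σ - τ` vanishes at `τ`, so continuity of the average of `ψ` is enough; it need not
  -- be differentiable.
  have h2 : HasDerivAt (fun σ => (σ - τ) * avg (heatMeasure K (σ - s)) ψ x)
      (avg (heatMeasure K (τ - s)) ψ x) τ := by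
    rw [hasDerivAt_iff_tendsto_slope]
    have hc : ContinuousAt (fun σ => avg (heatMeasure K (σ - s)) ψ x) τ :=
      ContinuousAt.comp (f := fun σ => σ - s)
        ((hK.isSmoothHeatKernel.continuousOn_avg hψ hψC x).continuousAt (Ici_mem_nhds hpos))
        (by fun_prop)
    refine (hc.tendsto.mono_left nhdsWithin_le_nhds).congr' ?_
    filter_upwards [self_mem_nhdsWithin] with σ hσ
    have : σ - τ ≠ 0 := sub_ne_zero.2 hσ
    rw [slope_def_field, sub_self, zero_mul, sub_zero]
    field_simp
  have h3 : HasDerivAt (fun σ => avg (heatMeasure K (σ - s))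
      (fun y => φ σ y - φ τ y - (σ - τ) * ψ y) x) 0 τ := by
    rw [hasDerivAt_iff_isLittleO, Asymptotics.isLittleO_iff]
    intro ε hε
    filter_upwards [hd ε hε] with σ hσ
    have h0 : avg (heatMeasure K (τ - s)) (fun y => φ τ y - φ τ y - (τ - τ) * ψ y) x = 0 := by
      simp [avg]
    rw [h0, sub_zero, smul_zero, sub_zero]
    exact norm_avg_le hσ x
  have h4 := (h1.add h2).add h3
  rw [add_zero] at h4
  refine h4.congr_of_eventuallyEq (Eventually.of_forall fun σ => ?_)
  obtain ⟨b, hb⟩ := hφC σ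
  obtain ⟨c, hc⟩ := hφC τ
  have i1 := integrable_avg (μ := heatMeasure K (σ - s)) (hφ σ) hb x
  have i2 := integrable_avg (μ := heatMeasure K (σ - s)) (hφ τ) hc x
  have i3 := integrable_avg (μ := heatMeasure K (σ - s)) hψ hψC x
  simp only [Pi.add_apply]
  unfold avg
  have e : ∫ y, (φ σ (x - y) - φ τ (x - y) - (σ - τ) * ψ (x - y)) ∂(heatMeasure K (σ - s)) =
      ∫ y, φ σ (x - y) ∂(heatMeasure K (σ - s)) - ∫ y, φ τ (x - y) ∂(heatMeasure K (σ - s)) -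
        (σ - τ) * ∫ y, ψ (x - y) ∂(heatMeasure K (σ - s)) := by
    rw [integral_sub (f := fun y => φ σ (x - y) - φ τ (x - y)) (i1.sub i2) (i3.const_mul _),
      integral_sub i1 i2, integral_const_mul]
  rw [e]
  ring

end LevyTriplet.SmoothingKernel

namespace TestFunction

variable {L : LevyTriplet d} {T : ℝ} {n : ℕ} {K : ℝ → E d → ℝ} {α s t τ : ℝ}

/-- The time derivative is continuous in the uniform norm, and the mean value inequality turns the
pointwise derivative into one that is uniform in space. -/
lemma eventually_abs_sub_le (Φ : TestFunction L T n) (hτ : τ ∈ Ioo 0 T) {ε : ℝ} (hε : 0 < ε) :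
    ∀ᶠ σ in 𝓝 τ, ∀ x, |Φ.φ σ x - Φ.φ τ x - (σ - τ) * Φ.dtφ τ x| ≤ ε * |σ - τ| := by
  have h1 : ∀ᶠ σ in 𝓝 τ, dist (Φ.dtφ σ) (Φ.dtφ τ) < ε ∧ σ ∈ Ioo 0 T :=
    (Metric.tendsto_nhds.1 (Φ.dtφ_continuousOn.continuousAt (isOpen_Ioo.mem_nhds hτ)) ε hε).and
      (isOpen_Ioo.mem_nhds hτ)
  obtain ⟨δ, hδ, hb⟩ := Metric.eventually_nhds_iff_ball.1 h1
  filter_upwards [Metric.ball_mem_nhds τ hδ] with σ hσ x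
  have h2 := Convex.norm_image_sub_le_of_norm_hasDerivWithin_le (𝕜 := ℝ)
    (f := fun σ => Φ.φ σ x - σ * Φ.dtφ τ x) (f' := fun σ => Φ.dtφ σ x - 1 * Φ.dtφ τ x)
    (s := Metric.ball τ δ) (C := ε) (x := τ) (y := σ)
    (fun y hy => ((Φ.hasDerivAt y (hb y hy).2 x).sub
      ((hasDerivAt_id y).mul_const _)).hasDerivWithinAt)
    (fun y hy => by
      rw [one_mul]
      have h3 := (Φ.dtφ y - Φ.dtφ τ).abs_le_norm x
      have h4 := (hb y hy).1.le
      rw [dist_eq_norm] at h4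
      exact h3.trans h4) (convex_ball τ δ) (Metric.mem_ball_self hδ) hσ
  rw [Real.norm_eq_abs, Real.norm_eq_abs] at h2
  refine le_of_eq_of_le ?_ h2
  congr 1
  ring

lemma cb_two (Φ : TestFunction L T n) (hn : 2 ≤ n) (t : ℝ) : CB 2 (Φ.φ t : E d → ℝ) :=
  (Φ.φ t).cb_nat.of_le hn

/-- The source `∂_t φ + 𝓛*φ` is continuous in the uniform norm. -/
lemma continuousOn_toBounded_g (Φ : TestFunction L T n) (hn : 2 ≤ n) :
    ContinuousOn (fun τ => (Φ.g τ).toBounded) (Ioo 0 T) := by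
  intro τ hτ
  have h1 := tendsto_iff_norm_sub_tendsto_zero.1 (Φ.dtφ_continuousOn τ hτ)
  have h2 := tendsto_iff_norm_sub_tendsto_zero.1
    (((Φ.continuousOn τ ⟨hτ.1.le, hτ.2.le⟩)).mono Ioo_subset_Icc_self)
  have h3 := h1.add (h2.const_mul L.adjoint.opBound)
  rw [mul_zero, add_zero] at h3
  refine tendsto_iff_norm_sub_tendsto_zero.2 (squeeze_zero' (Eventually.of_forall fun _ =>
    norm_nonneg _) ?_ h3)
  filter_upwards [self_mem_nhdsWithin] with σ hσ
  refine HolderSpace.norm_le_of_abs_le _ fun x => ?_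
  rw [HolderSpace.coe_sub, Pi.sub_apply, HolderSpace.coe_toBounded, HolderSpace.coe_toBounded,
    Φ.g_eq σ hσ, Φ.g_eq τ hτ, add_sub_add_comm, ← L.adjoint.op_sub (Φ.cb_two hn σ) (Φ.cb_two hn τ)]
  refine (abs_add_le _ _).trans (add_le_add ((Φ.dtφ σ - Φ.dtφ τ).abs_le_norm x) ?_)
  rw [← HolderSpace.coe_sub]
  exact L.adjoint.abs_op_le ((Φ.φ σ - Φ.φ τ).cb_nat.of_le hn)
    (fun j hj y => (Φ.φ σ - Φ.φ τ).norm_iteratedFDeriv_le_nat (hj.trans hn) y) x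

/-- The source is bounded in `C^{n-1}_b` but known to be continuous in time only in the uniform
norm. For positive times the heat flow maps `C_b` to `C^n_b` with norm continuity, which restores
continuity with values in `C^n_b`. -/
lemma continuousOn_heat_g (hK : L.adjoint.SmoothingKernel K α T) (hα : 0 < α) (hn : 2 ≤ n)
    (Φ : TestFunction L T n) :
    ContinuousOn (fun p : ℝ × ℝ => hK.heat n ((n : ℝ) - 1) (p.1 - p.2) (Φ.g p.1))
      {p | 0 ≤ p.2 ∧ p.2 < p.1 ∧ p.1 < T} := by
  have h : (fun p : ℝ × ℝ => hK.heat n ((n : ℝ) - 1) (p.1 - p.2) (Φ.g p.1)) =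
      fun p => hK.heat n 0 (p.1 - p.2) (Φ.g p.1).toBounded :=
    funext fun p => hK.heat_congr (HolderSpace.coe_toBounded _).symm
  rw [h]
  refine ContinuousOn.clm_apply ?_ ?_
  · refine (hK.continuousOn_heat hα n 0).comp (f := fun p : ℝ × ℝ => p.1 - p.2) (by fun_prop)
      fun p hp => ⟨sub_pos.2 hp.2.1, by linarith [hp.1, hp.2.2]⟩
  · exact (Φ.continuousOn_toBounded_g hn).comp (f := fun p : ℝ × ℝ => p.1) (by fun_prop)
      fun p hp => ⟨hp.1.trans_lt hp.2.1, hp.2.2⟩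

lemma exists_norm_heat_g_le (hK : L.adjoint.SmoothingKernel K α T) (hα : 0 < α) (hn : 2 ≤ n)
    (Φ : TestFunction L T n) : ∃ c : ℝ, 0 ≤ c ∧ ∀ s τ, 0 ≤ s → s < τ → τ < T →
      ‖hK.heat n ((n : ℝ) - 1) (τ - s) (Φ.g τ)‖ ≤ c * (τ - s) ^ (-(1 / α)) := by
  obtain ⟨c, hc0, hc⟩ := hK.exists_norm_heat_le (n := n) (γ := 1) hα zero_le_one
    (by exact_mod_cast hn)
  obtain ⟨G, hG⟩ := Φ.g_bounded
  refine ⟨c * |G|, by positivity, fun s τ hs hsτ hτ => ?_⟩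
  have h1 : 0 ≤ (τ - s) ^ (-(1 / α)) := Real.rpow_nonneg (sub_nonneg.2 hsτ.le) _
  calc _ ≤ (c * (τ - s) ^ (-(1 / α))) * |G| :=
        (ContinuousLinearMap.le_opNorm _ _).trans (mul_le_mul (hc _ ⟨sub_pos.2 hsτ, by linarith⟩)
          ((hG τ ⟨hs.trans_lt hsτ, hτ⟩).trans (le_abs_self G)) (norm_nonneg _) (by positivity))
    _ = _ := by ring

lemma integrableOn_heat_g (hK : L.adjoint.SmoothingKernel K α T) (hα : 1 < α) (hn : 2 ≤ n)
    (Φ : TestFunction L T n) (hs : 0 ≤ s) (hst : s < t) (ht : t ≤ T) :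
    IntegrableOn (fun τ => hK.heat n ((n : ℝ) - 1) (τ - s) (Φ.g τ)) (Ioo s t) := by
  have hα0 : 0 < α := one_pos.trans hα
  obtain ⟨c, hc0, hc⟩ := Φ.exists_norm_heat_g_le hK hα0 hn
  have h1 : IntegrableOn (fun τ => (τ - s) ^ (-(1 / α))) (Ioo s t) := by
    have h := (intervalIntegral.intervalIntegrable_rpow' (r := -(1 / α)) (a := 0) (b := t - s)
      (by rw [neg_lt_neg_iff]; exact (div_lt_one hα0).2 hα)).comp_sub_right s
    rw [zero_add, sub_add_cancel] at h
    exact (((intervalIntegrable_iff_integrableOn_Ioc_of_le hst.le).1 h).mono_set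
      Ioo_subset_Ioc_self)
  refine (h1.const_mul c).mono' ?_ ?_
  · exact ((Φ.continuousOn_heat_g hK hα0 hn).comp (f := fun τ => (τ, s)) (by fun_prop)
      fun τ hτ => ⟨hs, hτ.1, hτ.2.trans_le ht⟩).aestronglyMeasurable measurableSet_Ioo
  · filter_upwards [ae_restrict_mem measurableSet_Ioo] with τ hτ
    exact hc s τ hs hτ.1 (hτ.2.trans_le ht)

/-- Duhamel's formula for a test function. -/
lemma heat_sub_eq_integral (hK : L.adjoint.SmoothingKernel K α T) (hα : 1 < α) (hn : 2 ≤ n)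
    (Φ : TestFunction L T n) (hs : 0 ≤ s) (hst : s < t) (ht : t ≤ T) :
    hK.heat n n (t - s) (Φ.φ t) - Φ.φ s =
      ∫ τ in Ioo s t, hK.heat n ((n : ℝ) - 1) (τ - s) (Φ.g τ) := by
  have hT : 0 < T := (hs.trans_lt hst).trans_le ht
  have hi := Φ.integrableOn_heat_g hK hα hn hs hst ht
  refine HolderSpace.ext (funext fun x => ?_)
  have hmem : ∀ τ ∈ Ioo s t, τ - s ∈ Ioc 0 T := fun τ hτ =>
    ⟨sub_pos.2 hτ.1, by linarith [hτ.2]⟩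
  -- Evaluation at a point is a bounded functional, so the identity in `C^n_b` reduces to the scalar
  -- fundamental theorem of calculus for `τ ↦ P_{τ-s} φ(τ)(x)`.
  have h1 := (HolderSpace.eval (n : ℝ) x).integral_comp_comm hi
  simp only [HolderSpace.eval_apply] at h1
  rw [← h1, HolderSpace.coe_sub, Pi.sub_apply, hK.coe_heat ⟨sub_pos.2 hst, by linarith⟩]
  have hi' : IntervalIntegrable (fun τ => hK.heat n ((n : ℝ) - 1) (τ - s) (Φ.g τ) x) volume s t := by
    rw [intervalIntegrable_iff_integrableOn_Ioo_of_le hst.le]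
    exact (HolderSpace.eval (n : ℝ) x).integrable_comp hi
  have h2 := intervalIntegral.integral_eq_sub_of_hasDerivAt_of_le hst.le
    (hK.continuousOn_avg_comp (s := s) (Φ.continuousOn.mono (Icc_subset_Icc hs ht))
      (fun σ hσ => hσ.1) x)
    (fun τ hτ => by
      have hτT : τ ∈ Ioo 0 T := ⟨hs.trans_lt hτ.1, hτ.2.trans_le ht⟩
      have h := hK.hasDerivAt_avg_comp hT hτ.1 (φ := fun σ => (Φ.φ σ : E d → ℝ))
        (fun σ => (Φ.φ σ).continuous) (fun σ => ⟨_, (Φ.φ σ).abs_le_norm⟩) (Φ.cb_two hn τ)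
        (Φ.dtφ τ).continuous (Φ.dtφ τ).abs_le_norm (fun ε hε => Φ.eventually_abs_sub_le hτT hε) x
      have hp := hK.isProbabilityMeasure (τ - s)
      obtain ⟨b, hb⟩ := LevyTriplet.exists_op_bound L.adjoint (Φ.cb_two hn τ)
      have e : avg (heatMeasure K (τ - s)) (L.adjoint.op (Φ.φ τ : E d → ℝ)) x +
          avg (heatMeasure K (τ - s)) (Φ.dtφ τ : E d → ℝ) x =
          hK.heat n ((n : ℝ) - 1) (τ - s) (Φ.g τ) x := by
        rw [hK.coe_heat (hmem τ hτ)]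
        unfold avg
        rw [← integral_add (integrable_avg (LevyTriplet.continuous_op (Φ.cb_two hn τ)) hb x)
          (integrable_avg (Φ.dtφ τ).continuous (Φ.dtφ τ).abs_le_norm x)]
        refine integral_congr_ae (ae_of_all _ fun y => ?_)
        change _ = Φ.g τ (x - y)
        rw [Φ.g_eq τ hτT, add_comm]
      rw [e] at h
      exact h) hi'
  rw [intervalIntegral.integral_of_le hst.le, integral_Ioc_eq_integral_Ioo] at h2
  rw [h2, sub_self, heatMeasure_zero, avg_dirac_zero]

end TestFunction

end

/-! ### Fubini on a triangle and the weak form of the mild equation -/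

section

section triangle

variable {a t M : ℝ} {H : ℝ → ℝ → ℝ}

/-- The open triangle `0 < s < τ < t`. -/
def triangle (t : ℝ) : Set (ℝ × ℝ) := {p | 0 < p.2 ∧ p.2 < p.1 ∧ p.1 < t}

lemma measurableSet_triangle (t : ℝ) : MeasurableSet (triangle t) :=
  ((isOpen_lt continuous_const continuous_snd).inter ((isOpen_lt continuous_snd continuous_fst).inter
    (isOpen_lt continuous_fst continuous_const))).measurableSet

lemma triangle_indicator_fst {τ : ℝ} (hτ : τ < t) :
    (fun s => (triangle t).indicator (fun p => H p.1 p.2) (τ, s)) = (Ioo 0 τ).indicator (H τ) := by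
  funext s
  by_cases h : s ∈ Ioo 0 τ
  · rw [indicator_of_mem h, indicator_of_mem (show (τ, s) ∈ triangle t from ⟨h.1, h.2, hτ⟩)]
  · rw [indicator_of_notMem h, indicator_of_notMem fun h' => h ⟨h'.1, h'.2.1⟩]

lemma triangle_indicator_snd {s : ℝ} (hs : 0 < s) :
    (fun τ => (triangle t).indicator (fun p => H p.1 p.2) (τ, s)) =
      (Ioo s t).indicator fun τ => H τ s := by
  funext τ
  by_cases h : τ ∈ Ioo s t
  · rw [indicator_of_mem h, indicator_of_mem (show (τ, s) ∈ triangle t from ⟨hs, h.1, h.2⟩)]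
  · rw [indicator_of_notMem h, indicator_of_notMem fun h' => h ⟨h'.2.1, h'.2.2⟩]

lemma setIntegral_triangle_fst {τ : ℝ} (hτ : τ ∈ Ioo 0 t) :
    ∫ s in Ioo 0 t, (triangle t).indicator (fun p => H p.1 p.2) (τ, s) =
      ∫ s in Ioo 0 τ, H τ s := by
  rw [triangle_indicator_fst hτ.2, integral_indicator measurableSet_Ioo,
    Measure.restrict_restrict measurableSet_Ioo,
    inter_eq_left.2 (Ioo_subset_Ioo_right hτ.2.le)]

lemma setIntegral_triangle_snd {s : ℝ} (hs : s ∈ Ioo 0 t) :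
    ∫ τ in Ioo 0 t, (triangle t).indicator (fun p => H p.1 p.2) (τ, s) =
      ∫ τ in Ioo s t, H τ s := by
  rw [triangle_indicator_snd hs.1, integral_indicator measurableSet_Ioo,
    Measure.restrict_restrict measurableSet_Ioo,
    inter_eq_left.2 (Ioo_subset_Ioo_left hs.1.le)]

lemma integrable_triangle (ha0 : 0 ≤ a) (ha : a < 1) (ht : 0 < t)
    (hc : ContinuousOn (fun p : ℝ × ℝ => H p.1 p.2) (triangle t))
    (hb : ∀ τ s, 0 < s → s < τ → τ < t → |H τ s| ≤ M * ((τ - s) ^ (-a) * s ^ (-a))) :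
    Integrable ((triangle t).indicator fun p => H p.1 p.2)
      ((volume.restrict (Ioo 0 t)).prod (volume.restrict (Ioo 0 t))) := by
  have hm : AEStronglyMeasurable ((triangle t).indicator fun p => H p.1 p.2)
      ((volume.restrict (Ioo 0 t)).prod (volume.restrict (Ioo 0 t))) :=
    (aestronglyMeasurable_indicator_iff (measurableSet_triangle t)).2
      (hc.aestronglyMeasurable (measurableSet_triangle t))
  have hint : ∀ τ ∈ Ioo 0 t, IntegrableOn (H τ) (Ioo 0 τ) := fun τ hτ => by
    refine ((integrableOn_sub_rpow_mul_rpow ha0 ha ha0 ha hτ.1).const_mul M).mono' ?_ ?_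
    · exact (hc.comp (f := fun s => (τ, s)) (by fun_prop)
        fun s hs => ⟨hs.1, hs.2, hτ.2⟩).aestronglyMeasurable measurableSet_Ioo
    · filter_upwards [ae_restrict_mem measurableSet_Ioo] with s hs
      exact hb τ s hs.1 hs.2 hτ.2
  rw [integrable_prod_iff hm]
  constructor
  · filter_upwards [ae_restrict_mem measurableSet_Ioo] with τ hτ
    rw [triangle_indicator_fst hτ.2]
    exact (integrable_indicator_iff measurableSet_Ioo).2
      ((hint τ hτ).mono_measure Measure.restrict_le_self)
  -- The inner integral is at most a multiple of `τ^{1-2a}`, which is integrable because `2a - 1 <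
  -- 1`.
  · refine ((integrableOn_rpow_neg (a := a + a - 1) (by linarith) ht).const_mul
      (M * betaBound a a)).mono' hm.norm.integral_prod_right' ?_
    filter_upwards [ae_restrict_mem measurableSet_Ioo] with τ hτ
    rw [Real.norm_of_nonneg (integral_nonneg fun _ => norm_nonneg _)]
    have h1 : ∫ s in Ioo 0 t, ‖(triangle t).indicator (fun p => H p.1 p.2) (τ, s)‖ =
        ∫ s in Ioo 0 τ, |H τ s| := by
      rw [← setIntegral_triangle_fst (H := fun τ s => |H τ s|) hτ]
      refine integral_congr_ae (ae_of_all _ fun s => ?_)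
      exact norm_indicator_eq_indicator_norm _ _
    have hM : 0 ≤ M := by
      have h := (abs_nonneg _).trans (hb τ (τ / 2) (half_pos hτ.1) (half_lt_self hτ.1) hτ.2)
      have h2 : 0 < (τ - τ / 2) ^ (-a) * (τ / 2) ^ (-a) := by
        have h3 : 0 < τ / 2 := half_pos hτ.1
        rw [sub_half]
        positivity
      exact nonneg_of_mul_nonneg_left h h2
    rw [h1]
    calc ∫ s in Ioo 0 τ, |H τ s| ≤ ∫ s in Ioo 0 τ, M * ((τ - s) ^ (-a) * s ^ (-a)) := by
          refine setIntegral_mono_on (hint τ hτ).abs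
            ((integrableOn_sub_rpow_mul_rpow ha0 ha ha0 ha hτ.1).const_mul M) measurableSet_Ioo
            fun s hs => hb τ s hs.1 hs.2 hτ.2
      _ ≤ M * (betaBound a a * τ ^ (1 - a - a)) := by
          rw [integral_const_mul]
          exact mul_le_mul_of_nonneg_left (integral_sub_rpow_mul_rpow_le ha0 ha ha0 ha hτ.1) hM
      _ = _ := by rw [mul_assoc]; ring_nf

/-- Fubini's theorem on a triangle, for kernels with weak singularities. -/
lemma integral_triangle_swap (ha0 : 0 ≤ a) (ha : a < 1) (ht : 0 < t)
    (hc : ContinuousOn (fun p : ℝ × ℝ => H p.1 p.2) (triangle t))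
    (hb : ∀ τ s, 0 < s → s < τ → τ < t → |H τ s| ≤ M * ((τ - s) ^ (-a) * s ^ (-a))) :
    IntegrableOn (fun τ => ∫ s in Ioo 0 τ, H τ s) (Ioo 0 t) ∧
    IntegrableOn (fun s => ∫ τ in Ioo s t, H τ s) (Ioo 0 t) ∧
    ∫ τ in Ioo 0 t, ∫ s in Ioo 0 τ, H τ s = ∫ s in Ioo 0 t, ∫ τ in Ioo s t, H τ s := by
  have hi := integrable_triangle ha0 ha ht hc hb
  refine ⟨(integrable_congr ?_).1 hi.integral_prod_left,
    (integrable_congr ?_).1 hi.integral_prod_right, ?_⟩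
  · filter_upwards [ae_restrict_mem measurableSet_Ioo] with τ hτ
    exact setIntegral_triangle_fst hτ
  · filter_upwards [ae_restrict_mem measurableSet_Ioo] with s hs
    exact setIntegral_triangle_snd hs
  · rw [← setIntegral_congr_fun measurableSet_Ioo fun τ hτ => setIntegral_triangle_fst (H := H) hτ,
      ← setIntegral_congr_fun measurableSet_Ioo fun s hs => setIntegral_triangle_snd (H := H) hs]
    exact integral_integral_swap
      (f := fun τ s => (triangle t).indicator (fun p => H p.1 p.2) (τ, s)) hi

end triangle

variable {d : ℕ} {L : LevyTriplet d} {T : ℝ} {n : ℕ} {K : ℝ → E d → ℝ} {α t M : ℝ}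
  {q : ℝ → NegHolder d n} {y0 : NegHolder d n}

lemma integrableOn_apply_testFunction (hα : 1 < α) (hq : ContinuousOn q (Ioc 0 T))
    (hqb : ∀ t ∈ Ioc 0 T, ‖q t‖ ≤ M * t ^ (-(1 / α))) (Φ : TestFunction L T n) (ht : t ∈ Ioc 0 T) :
    IntegrableOn (fun s => q s (Φ.φ s)) (Ioo 0 t) := by
  have hα0 : 0 < α := one_pos.trans hα
  have hsub : ∀ s ∈ Ioo 0 t, s ∈ Ioc 0 T := fun s hs => ⟨hs.1, hs.2.le.trans ht.2⟩
  obtain ⟨C, hC⟩ := isCompact_Icc.exists_bound_of_continuousOn Φ.continuousOn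
  refine ((integrableOn_rpow_neg ((div_lt_one hα0).2 hα) ht.1).const_mul (M * C)).mono' ?_ ?_
  · exact ((hq.mono hsub).clm_apply (Φ.continuousOn.mono fun s hs =>
      Ioc_subset_Icc_self (hsub s hs))).aestronglyMeasurable measurableSet_Ioo
  · filter_upwards [ae_restrict_mem measurableSet_Ioo] with s hs
    calc ‖q s (Φ.φ s)‖ ≤ ‖q s‖ * ‖Φ.φ s‖ := (q s).le_opNorm _
      _ ≤ (M * s ^ (-(1 / α))) * C := mul_le_mul (hqb s (hsub s hs))
          (hC s (Ioc_subset_Icc_self (hsub s hs))) (norm_nonneg _)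
          ((norm_nonneg _).trans (hqb s (hsub s hs)))
      _ = _ := by ring

/-- The mild solution solves the equation in the sense of distributions. -/
theorem LevyTriplet.SmoothingKernel.mildSol_weak (hK : L.adjoint.SmoothingKernel K α T)
    (hα : 1 < α) (hn : 2 ≤ n) (hq : ContinuousOn q (Ioc 0 T))
    (hqb : ∀ t ∈ Ioc 0 T, ‖q t‖ ≤ M * t ^ (-(1 / α))) (Φ : TestFunction L T n) (ht : t ∈ Ioc 0 T) :
    IntegrableOn (fun s => hK.mildSol q y0 ((n : ℝ) - 1) s (Φ.g s)) (Ioo 0 t) ∧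
    hK.mildSol q y0 n t (Φ.φ t) - y0 (Φ.φ 0) =
      (∫ s in Ioo 0 t, hK.mildSol q y0 ((n : ℝ) - 1) s (Φ.g s)) -
        ∫ s in Ioo 0 t, q s (Φ.φ s) := by
  have hα0 : 0 < α := one_pos.trans hα
  have ha0 : 0 ≤ 1 / α := by positivity
  have ha : 1 / α < 1 := (div_lt_one hα0).2 hα
  have hn1 : (1 : ℝ) < n := by exact_mod_cast hn
  have hsub : ∀ s ∈ Ioo 0 t, s ∈ Ioc 0 T := fun s hs => ⟨hs.1, hs.2.le.trans ht.2⟩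
  -- This is the integrand of the double integral that arises when the mild formula at time `τ` is
  -- tested with `∂_t φ + 𝓛*φ`. Integrated in `τ` first, it is Duhamel's formula on `(s,t)` tested
  -- with `q s`.
  let H : ℝ → ℝ → ℝ := fun τ s => q s (hK.heat n ((n : ℝ) - 1) (τ - s) (Φ.g τ))
  obtain ⟨c, hc0, hc⟩ := Φ.exists_norm_heat_g_le hK hα0 hn
  have hHc : ContinuousOn (fun p : ℝ × ℝ => H p.1 p.2) (triangle t) := by
    refine ContinuousOn.clm_apply (f := fun p : ℝ × ℝ => q p.2) ?_ ?_
    · exact hq.comp (f := fun p : ℝ × ℝ => p.2) (by fun_prop)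
        fun p hp => ⟨hp.1, (hp.2.1.trans hp.2.2).le.trans ht.2⟩
    · exact (Φ.continuousOn_heat_g hK hα0 hn).mono
        fun p hp => ⟨hp.1.le, hp.2.1, hp.2.2.trans_le ht.2⟩
  have hHb : ∀ τ s, 0 < s → s < τ → τ < t →
      |H τ s| ≤ (M * c) * ((τ - s) ^ (-(1 / α)) * s ^ (-(1 / α))) := fun τ s h0 h1 h2 => by
    have hs : s ∈ Ioc 0 T := hsub s ⟨h0, h1.trans h2⟩
    calc |H τ s| ≤ (M * s ^ (-(1 / α))) * (c * (τ - s) ^ (-(1 / α))) :=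
          ((q s).le_opNorm _).trans (mul_le_mul (hqb s hs) (hc s τ h0.le h1 (h2.trans_le ht.2))
            (norm_nonneg _) ((norm_nonneg _).trans (hqb s hs)))
      _ = _ := by ring
  obtain ⟨hI1, hI2, hswap⟩ := integral_triangle_swap ha0 ha ht.1 hHc hHb
  have hA := Φ.integrableOn_heat_g hK hα hn le_rfl ht.1 ht.2
  have hA' := y0.integral_comp_comm hA
  rw [← Φ.heat_sub_eq_integral hK hα hn le_rfl ht.1 ht.2, map_sub] at hA'
  have hAi := y0.integrable_comp hA
  simp only [sub_zero] at hA' hAi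
  have hmild : ∀ τ ∈ Ioo 0 t, hK.mildSol q y0 ((n : ℝ) - 1) τ (Φ.g τ) =
      y0 (hK.heat n ((n : ℝ) - 1) τ (Φ.g τ)) - ∫ s in Ioo 0 τ, H τ s := fun τ hτ =>
    hK.mildSol_apply hτ.1 (hK.integrableOn_dualHeat hα0 zero_le_one hα hn1 rfl ha0 ha hq hqb
      (hsub τ hτ)) _
  have hinner : ∀ s ∈ Ioo 0 t, ∫ τ in Ioo s t, H τ s =
      q s (hK.heat n n (t - s) (Φ.φ t)) - q s (Φ.φ s) := fun s hs => by
    rw [← map_sub, Φ.heat_sub_eq_integral hK hα hn hs.1.le hs.2 ht.2]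
    exact (q s).integral_comp_comm (Φ.integrableOn_heat_g hK hα hn hs.1.le hs.2 ht.2)
  have hqφ := integrableOn_apply_testFunction hα hq hqb Φ ht
  have hI3 : IntegrableOn (fun s => q s (hK.heat n n (t - s) (Φ.φ t)) - q s (Φ.φ s)) (Ioo 0 t) :=
    hI2.congr_fun hinner measurableSet_Ioo
  -- Fubini's theorem yields integrability of the difference only; that of the first term follows by
  -- adding back the second.
  have hI4 : IntegrableOn (fun s => q s (hK.heat n n (t - s) (Φ.φ t))) (Ioo 0 t) := by
    have h := hI3.add hqφ
    refine h.congr_fun (fun s _ => ?_) measurableSet_Ioo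
    simp
  refine ⟨IntegrableOn.congr_fun (hAi.sub hI1) (fun τ hτ => (hmild τ hτ).symm) measurableSet_Ioo, ?_⟩
  rw [setIntegral_congr_fun measurableSet_Ioo hmild, integral_sub hAi hI1, hA', hswap,
    setIntegral_congr_fun measurableSet_Ioo hinner, integral_sub hI4 hqφ,
    hK.mildSol_apply ht.1 (hK.integrableOn_dualHeat (γ := 0) hα0 le_rfl hα0 (by linarith)
      (by simp) ha0 ha hq hqb ht)]
  ring

end

/-! ### The source of the mild solution and the final assembly -/

section

variable {d : ℕ} {L : LevyTriplet d} {T : ℝ} {n : ℕ} {K : ℝ → E d → ℝ} {α : ℝ}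

/-- Existence of the source `q = V₁ · D ρ + D · V₂` of the mild solution `ρ`, in weak form. -/
theorem LevyTriplet.SmoothingKernel.exists_source (hK : L.SmoothingKernel K α T) (hT : 0 < T)
    (hα : 1 < α) (hn : 2 ≤ n) {V1 : ℝ → Fin d → HolderSpace d n}
    (hV1 : ∀ i, ContinuousOn (fun t => V1 t i) (Icc 0 T)) :
    ∃ C : ℝ, 0 ≤ C ∧ ∀ (V2 : ℝ → Fin d → SignedMeasure (E d)) (F : ℝ), 0 ≤ F →
      (∀ i, ∀ t ∈ Icc 0 T, Tendsto (fun s => bLipDist (V2 s i) (V2 t i)) (𝓝[Icc 0 T] t) (𝓝 0)) →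
      (∀ t ∈ Icc 0 T, tvNorm (V2 t) ≤ F) → ∀ ρ0 : NegHolder d n,
      ∃ q : ℝ → NegHolder d n, ContinuousOn q (Ioc 0 T) ∧
        (∀ t ∈ Ioc 0 T, ‖q t‖ ≤ C * (F + ‖ρ0‖) * t ^ (-(1 / α))) ∧
        (∀ t ∈ Ioc 0 T, ∀ u, q t u =
          hK.mildSol q ρ0 ((n : ℝ) - 1) t (transport (one_le_two.trans hn) (V1 t) u) +
            ∑ i, ∫ᵛ y, pd i (u : E d → ℝ) y ∂•(V2 t i)) ∧
        (ρ0 ∈ bpContinuous d n → ∀ t ∈ Ioc 0 T, hK.mildSol q ρ0 n t ∈ bpContinuous d n) := by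
  have hn1 : 1 ≤ n := one_le_two.trans hn
  have hα0 : 0 < α := one_pos.trans hα
  have ha0 : 0 ≤ 1 / α := by positivity
  have ha : 1 / α < 1 := (div_lt_one hα0).2 hα
  have hTa : 0 ≤ T ^ (1 / α) := Real.rpow_nonneg hT.le _
  obtain ⟨c, hc0, hc⟩ := hK.exists_norm_dualHeat_le (n := n) (γ := 1) hα0 zero_le_one
    (by exact_mod_cast hn)
  obtain ⟨β, hβ0, hβ⟩ := exists_norm_transportL_le hn1 hV1
  have hBc : ContinuousOn (fun t => dualMapL _ _ (transportL hn1 (V1 t))) (Ioc 0 T) :=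
    (dualMapL _ _).continuous.comp_continuousOn
      ((continuousOn_transportL hn1 hV1).mono Ioc_subset_Icc_self)
  have hBb : ∀ t ∈ Ioc 0 T, ‖dualMapL _ _ (transportL hn1 (V1 t))‖ ≤ β := fun t ht =>
    (norm_dualMapL_le _).trans (hβ t (Ioc_subset_Icc_self ht))
  obtain ⟨C, hC0, hC⟩ := exists_mild_solution hT ha0 ha hc0 hβ0
    (hK.continuousOn_dualHeat hα0 n ((n : ℝ) - 1)) hc hBc hBb
  -- The transport part of the source contributes `β C`; the bounded part `F` is at most `F T^{1/α}
  -- t^{-1/α}`.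
  refine ⟨β * C + T ^ (1 / α), by positivity, fun V2 F hF hV2 hFb ρ0 => ?_⟩
  have hWc := (continuousOn_gradFunctional hn hV2).mono Ioc_subset_Icc_self
  have hWb : ∀ t ∈ Ioc 0 T, ‖gradFunctional hn1 (V2 t)‖ ≤ F := fun t ht =>
    (norm_gradFunctional_le hn1 _).trans (hFb t (Ioc_subset_Icc_self ht))
  obtain ⟨ρ, hρc, hρb, hρ, hρP⟩ := hC ρ0 _ F hF hWc hWb
  have hmild : ∀ t ∈ Ioc 0 T, hK.mildSol (fun s => dualMapL _ _ (transportL hn1 (V1 s)) (ρ s) +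
      gradFunctional hn1 (V2 s)) ρ0 ((n : ℝ) - 1) t = ρ t := fun t ht => by
    rw [hK.mildSol_of_pos ht.1, hρ t ht]
    rfl
  refine ⟨fun s => dualMapL _ _ (transportL hn1 (V1 s)) (ρ s) + gradFunctional hn1 (V2 s),
    continuousOn_source hBc hWc hρc, fun t ht => ?_, fun t ht u => ?_, fun hρ0 t ht => ?_⟩
  · refine (norm_source_le ha0 hβ0 hBb hF hWb hρb ht).trans
      (mul_le_mul_of_nonneg_right ?_ (Real.rpow_nonneg ht.1.le _))
    nlinarith [mul_nonneg hTa (norm_nonneg ρ0)]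
  · rw [hmild t ht, add_apply, dualMapL_apply, transportL_apply, gradFunctional_apply]
  -- The invariance is first obtained for `ρ` in `C^{-(n-1)}_b`, where the fixed point lives. It
  -- passes to the source `q` and then, through the mild formula with `r = n`, to the solution in
  -- `C^{-n}_b`.
  · have hρbp := hρP (bpContinuous d ((n : ℝ) - 1)) (isClosed_bpContinuous d _)
      (fun t ht => hK.dualHeat_mem_bpContinuous ht hρ0)
      (fun t ht s _ => hK.dualHeat_mem_bpContinuous ht (gradFunctional_mem_bpContinuous hn1 _))
      (fun t ht s _ x hx => hK.dualHeat_mem_bpContinuous ht (dualTransport_mem_bpContinuous hn1 _ hx))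
    rw [hK.mildSol_of_pos ht.1]
    refine Submodule.sub_mem _ (hK.dualHeat_mem_bpContinuous ht hρ0)
      (volterra_mem _ (isClosed_bpContinuous d n) fun s hs => ?_)
    refine hK.dualHeat_mem_bpContinuous ⟨sub_pos.2 hs.2, by linarith [hs.1, ht.2]⟩
      (Submodule.add_mem _ ?_ (gradFunctional_mem_bpContinuous hn1 _))
    exact dualTransport_mem_bpContinuous hn1 _ (hρbp s ⟨hs.1, hs.2.le.trans ht.2⟩)

lemma integrableOn_vectorIntegral_pd (hn : 2 ≤ n) {V2 : ℝ → Fin d → SignedMeasure (E d)}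
    (hV2 : ∀ i, ∀ t ∈ Icc 0 T,
      Tendsto (fun s => bLipDist (V2 s i) (V2 t i)) (𝓝[Icc 0 T] t) (𝓝 0))
    (Φ : TestFunction L T n) {t : ℝ} (ht : t ≤ T) :
    IntegrableOn (fun s => ∑ i, ∫ᵛ y, pd i (Φ.φ s : E d → ℝ) y ∂•(V2 s i)) (Ioo 0 t) := by
  have h : ContinuousOn (fun s => gradFunctional (one_le_two.trans hn) (V2 s) (Φ.φ s)) (Icc 0 T) :=
    (continuousOn_gradFunctional hn hV2).clm_apply Φ.continuousOn
  simp only [gradFunctional_apply] at h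
  exact (h.integrableOn_compact isCompact_Icc).mono_set
    (Ioo_subset_Icc_self.trans (Icc_subset_Icc_right ht))

end

end LevyFP

end

open LevyFP
theorem mainTheorem11 {d : ℕ} (hd : 0 < d) (L : LevyTriplet d) {α T : ℝ} (hT : 0 < T)
    (hK : L.Admissible α T) {n : ℕ} (hn : 2 ≤ n)
    (V1 : ℝ → Fin d → HolderSpace d n) (hV1 : ∀ i, ContinuousOn (fun t => V1 t i) (Icc 0 T)) :
    ∃ C : ℝ → ℝ,
      ∀ V2 : ℝ → Fin d → SignedMeasure (E d),
      (∀ i, ∀ t ∈ Icc 0 T,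
        Tendsto (fun s => bLipDist (V2 s i) (V2 t i)) (𝓝[Icc 0 T] t) (𝓝 0)) →
      BddAbove ((fun t => tvNorm (V2 t)) '' Icc 0 T) →
      ∀ ρ0 : NegHolder d n,
      ∃ ρ : ∀ r : ℝ, ℝ → NegHolder d r,
        (∀ t ∈ Ioc 0 T, Coherent n α (fun r => ρ r t)) ∧
        IsDistributionalSolution L T (one_le_two.trans hn) V1 V2 ρ0 ρ ∧
        (∃ M : ℝ, ∀ t ∈ Icc 0 T, ‖ρ n t‖ ≤ M) ∧
        (∀ γ ∈ Ioo 0 α,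
          ContinuousOn (ρ (n - γ)) (Ioc 0 T) ∧
          ∀ t ∈ Ioc 0 T, ‖t ^ (γ / α) • ρ (n - γ) t‖ ≤
            C γ * (sSup ((fun t => tvNorm (V2 t)) '' Icc 0 T) + ‖ρ0‖)) ∧
        (MeasureRepresentable ρ0 → ∀ t ∈ Icc 0 T, MeasureRepresentable (ρ n t)) := by
  obtain ⟨hα, hα2, -, hK⟩ := hK
  obtain ⟨K, hK⟩ := hK.exists_smoothingKernel
  have hα0 : 0 < α := one_pos.trans hα
  have ha0 : 0 ≤ 1 / α := by positivity
  have ha : 1 / α < 1 := (div_lt_one hα0).2 hα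
  have hn2 : (2 : ℝ) ≤ n := by exact_mod_cast hn
  have hTa : 0 ≤ T ^ (1 - 1 / α) := Real.rpow_nonneg hT.le _
  obtain ⟨C₀, hC₀, hsource⟩ := hK.exists_source hT hα hn hV1
  -- These constants are chosen before `V2` and `ρ0` enter, which makes the final constant uniform
  -- in them. The restriction `γ < α ≤ 2 ≤ n` keeps `n - γ` positive, and `γ = 0` is included for
  -- the bound in `C^{-n}_b`.
  have hc : ∀ γ : ℝ, ∃ c : ℝ, 0 ≤ γ → γ < α → 0 ≤ c ∧
      ∀ t ∈ Ioc 0 T, ‖hK.dualHeat n (n - γ) t‖ ≤ c * t ^ (-(γ / α)) := fun γ => by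
    by_cases h : 0 ≤ γ ∧ γ < α
    · obtain ⟨c, hc⟩ := hK.exists_norm_dualHeat_le (n := n) hα0 h.1 (by linarith)
      exact ⟨c, fun _ _ => hc⟩
    · exact ⟨0, fun h0 h1 => (h ⟨h0, h1⟩).elim⟩
  choose c hc using hc
  refine ⟨fun γ => c γ * (1 + C₀ * (betaBound (γ / α) (1 / α) * T ^ (1 - 1 / α))),
    fun V2 hV2 hbdd ρ0 => ?_⟩
  set F := sSup ((fun t => tvNorm (V2 t)) '' Icc 0 T) with hF
  have hFb : ∀ t ∈ Icc 0 T, tvNorm (V2 t) ≤ F := fun t ht => le_csSup hbdd ⟨t, ht, rfl⟩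
  have hF0 : 0 ≤ F := (tvNorm_nonneg _).trans (hFb 0 ⟨le_rfl, hT.le⟩)
  obtain ⟨q, hqc, hqb, hq, hbp⟩ := hsource V2 F hF0 hV2 hFb ρ0
  have hM : 0 ≤ C₀ * (F + ‖ρ0‖) := by positivity
  have hbound : ∀ γ, 0 ≤ γ → γ < α → ∀ r : ℝ, r = n - γ → ∀ t ∈ Ioc 0 T,
      ‖t ^ (γ / α) • hK.mildSol q ρ0 r t‖ ≤
        c γ * (1 + C₀ * (betaBound (γ / α) (1 / α) * T ^ (1 - 1 / α))) * (F + ‖ρ0‖) := by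
    intro γ hγ0 hγ r hr t ht
    obtain ⟨hc0, hcb⟩ := hc γ hγ0 hγ
    refine (hK.norm_mildSol_le hα0 hγ0 hγ hr ha0 ha hM hc0 hcb hqb ht).trans ?_
    refine (mul_le_mul_of_nonneg_left ?_ hc0).trans_eq (mul_assoc _ _ _).symm
    linarith
  have hint : ∀ r ∈ Ioc (n - α) n, ∀ t ∈ Ioc 0 T,
      IntegrableOn (fun s => hK.dualHeat n r (t - s) (q s)) (Ioo 0 t) := fun r hr t ht =>
    hK.integrableOn_dualHeat (γ := n - r) hα0 (by linarith [hr.2]) (by linarith [hr.1])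
      (by linarith [hr.1]) (by ring) ha0 ha hqc hqb ht
  refine ⟨fun r t => hK.mildSol q ρ0 r t, fun t ht r hr s hs u v huv => ?_,
    ⟨hK.mildSol_zero, fun Φ t ht => ?_⟩, ?_, fun γ hγ => ⟨?_, ?_⟩, fun hρ0 t ht => ?_⟩
  · exact hK.mildSol_congr ht.1 (hint r hr t ht) (hint s hs t ht) huv
  · rcases ht.1.eq_or_lt with rfl | ht0
    · simp [hK.mildSol_zero]
    have ht' : t ∈ Ioc 0 T := ⟨ht0, ht.2⟩
    obtain ⟨hI, hweak⟩ := hK.mildSol_weak (y0 := ρ0) hα hn hqc hqb Φ ht'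
    have hIq := integrableOn_apply_testFunction hα hqc hqb Φ ht'
    have hIV := integrableOn_vectorIntegral_pd hn hV2 Φ ht.2
    -- In the mild weak form the source appears as `q s (Φ.φ s)`. Its transport part combines with
    -- the pairing of `Φ.g s` into the integrand of the definition, and its measure part is the `V2`
    -- term.
    have hsplit : ∀ s ∈ Ioo 0 t, hK.mildSol q ρ0 ((n : ℝ) - 1) s (Φ.g s) - q s (Φ.φ s) +
        ∑ i, ∫ᵛ y, pd i (Φ.φ s : E d → ℝ) y ∂•(V2 s i) =
        hK.mildSol q ρ0 ((n : ℝ) - 1) s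
          (Φ.g s - transport (one_le_two.trans hn) (V1 s) (Φ.φ s)) := fun s hs => by
      rw [hq s ⟨hs.1, hs.2.le.trans ht.2⟩, map_sub]
      ring
    have hiff := fun f : ℝ → ℝ => intervalIntegrable_iff_integrableOn_Ioo_of_le (f := f)
      (μ := volume) ht.1
    refine ⟨(hiff _).2 (((hI.sub hIq).add hIV).congr_fun hsplit measurableSet_Ioo),
      (hiff _).2 hIV, ?_⟩
    rw [intervalIntegral.integral_of_le ht.1, intervalIntegral.integral_of_le ht.1,
      integral_Ioc_eq_integral_Ioo, integral_Ioc_eq_integral_Ioo, hweak,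
      ← setIntegral_congr_fun measurableSet_Ioo hsplit,
      integral_add (f := fun s => hK.mildSol q ρ0 ((n : ℝ) - 1) s (Φ.g s) - q s (Φ.φ s))
        (hI.sub hIq) hIV, integral_sub hI hIq]
    ring
  -- For positive times this is the weighted bound with `γ = 0`, where the weight is one; time `0`
  -- contributes `‖ρ0‖`.
  · refine ⟨max ‖ρ0‖ (c 0 * (1 + C₀ * (betaBound (0 / α) (1 / α) * T ^ (1 - 1 / α))) *
      (F + ‖ρ0‖)), fun t ht => ?_⟩
    rcases ht.1.eq_or_lt with rfl | ht0
    · exact (congrArg norm hK.mildSol_zero).trans_le (le_max_left _ _)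
    · have h := hbound 0 le_rfl hα0 n (by simp) t ⟨ht0, ht.2⟩
      rw [zero_div, Real.rpow_zero, one_smul] at h
      rw [zero_div]
      exact h.trans (le_max_right _ _)
  · exact hK.continuousOn_mildSol hα0 hγ.1.le hγ.2 (by linarith [hγ.2]) rfl ha0 ha hM hqc hqb
  · exact hbound γ hγ.1.le hγ.2 _ rfl
  · rcases ht.1.eq_or_lt with rfl | ht0
    · exact (congrArg MeasureRepresentable hK.mildSol_zero).mpr hρ0
    · exact measureRepresentable_of_mem_bpContinuous
        (hbp hρ0.mem_bpContinuous t ⟨ht0, ht.2⟩)
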